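/- **Setting.** Let $B$ be a complete Hausdorff topological field of characteristic zero, and let $G$ be a compact topological group acting continuously on $B$ by field automorphisms, with fixed field $F=B^G$. Let $K\subset F$ be a subfield with $[F:K]<\infty$, let $R$ be a commutative $K$-algebra, and put $S=B\otimes_K R$, with the $G$-action $g(b\otimes r)=gb\otimes r$. Every $B$-vector space carries the inductive limit topology of its finite-dimensional subspaces (each with the product topology of $B^n$). Let $\mathcal C_R$ be the category of $S$-modules $M$ with a continuous $S$-semilinear action $G\times M\to M$ and an increasing filtration $(W_nM)_{n\in\mathbb Z}$ by $G$-stable finitely generated $S$-submodules with $W_nM=0$ for $n<0$ and $\bigcup_n W_nM=M$. The morphisms are the $S$-linear $G$-equivariant maps preserving the filtrations, and $W_n(M\otimes N)=\sum_{i+j=n}W_iM\otimes W_jN$. (For $R=K$, $S=B$.) Let $U=\mathrm{Spec}\,\mathcal A$ be a pro-unipotent group over $B$, where $\mathcal A$ is a commutative Hopf algebra in $\mathcal C_K$ (all structure maps are morphisms of $\mathcal C_K$), and let $U_R=\mathrm{Spec}(\mathcal A\otimes_K R)$. A $U_R$-torsor is $P=\mathrm{Spec}\,\mathcal P$, where $\mathcal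 P$ is a commutative algebra in $\mathcal C_R$, faithfully flat over $S$, with a right action of $U_R$ given by a coaction $a:\mathcal P\to\mathcal P\otimes_S(\mathcal A\otimes_KR)$ that is a morphism of algebras in $\mathcal C_R$, such that * the map $\mathcal P\otimes_S\mathcal P\to\mathcal P\otimes_S(\mathcal A\otimes_K R)$, $p\otimes q\mapsto (p\otimes 1)\,a(q)$ (dual to $P\times U_R\to P\times P$, $(p,u)\mapsto(p,pu)$) is an isomorphism in $\mathcal C_R$ (so its inverse also preserves the filtrations); * $W_n\mathcal P$ is a free $S$-module of rank $\dim_B W_n\mathcal A$ for every $n$. Isomorphisms of torsors are isomorphisms of algebras in $\mathcal C_R$ compatible with the coactions. Let $G$ act on the points $U(S)=\mathrm{Hom}_{B\text{-alg}}(\mathcal A,S)$ and $P(S)=\mathrm{Hom}_{S\text{-alg}}(\mathcal P,S)$ by $\phi\mapsto g\phi g^{-1}$. Give $U(S)$ the topology induced by the restriction maps $U(S)\to\mathrm{Hom}_B(V,S)$, $V\subset\mathcal A$ a finite-dimensional subspace. Let $H^1(G,U(S))$ be the set of continuous maps $c:G\to U(S)$ with $c(gh)=c(g)\,g(c(h))$,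 modulo the action of $U(S)$ given by $(uc)(g)=u\,c(g)\,g(u^{-1})$. **Proposition 1.** The isomorphism classes of $U_R$-torsors are in bijection with $H^1(G,U(B\otimes_K R))$. More precisely, every $U_R$-torsor $P$ has a point $x\in P(S)$; for each such $x$ the rule $g(x)=x\,c(g)$ defines a continuous cocycle $c:G\to U(S)$; and there is a bijection from isomorphism classes of torsors to $H^1(G,U(S))$ that sends the class of $P$ to the class of $c$, for every choice of $x$. -/

import Mathlib

open scoped TensorProduct

universe u v

namespace TorsorSpaces

noncomputable section

/-! ### Topologies -/

section Topology

variable (B : Type*) [Field B] [TopologicalSpace B]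

/-- The inductive limit topology on a vector space `V` over a topological field `B`: the final
topology with respect to the inclusions of all finite-dimensional subspaces `N`, where `N` carries
the product topology of `Bⁿ` (which is its module topology). -/
abbrev finTopology (V : Type*) [AddCommGroup V] [Module B V] : TopologicalSpace V :=
  ⨆ N : {N : Submodule B V // FiniteDimensional B N},
    TopologicalSpace.coinduced (fun x : N.1 => (x : V)) (moduleTopology B N.1)

end Topology

/-! ### Filtered modules with a continuous semilinear action -/

section Category

/-- The tensor product filtration `W_n (M ⊗ N) = ∑_{i + j = n} W_i M ⊗ V_j N`, where
`W_i M ⊗ V_j N` stands for its image in `M ⊗ N`. -/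
def tensorFil (T : Type*) {M N : Type*} [CommRing T] [AddCommGroup M] [Module T M]
    [AddCommGroup N] [Module T N] (W : ℤ → Submodule T M) (V : ℤ → Submodule T N) (n : ℤ) :
    Submodule T (M ⊗[T] N) :=
  ⨆ i : ℤ, LinearMap.range (TensorProduct.mapIncl (W i) (V (n - i)))

/-- Objects of the category of filtered modules with `G`-action over a `B`-algebra `S` on which `G`
acts: `M` is an `S`-module with a continuous semilinear action of `G` (semilinearity is the class
`SMulDistribClass G S M`, and `M` has the inductive limit topology of its underlying `B`-vector
space), and `W` is an exhaustive increasing filtration of `M` by `G`-stable finitely generated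
`S`-submodules, zero in negative degrees. -/
structure IsFilteredRep (G B : Type*) {S M : Type*} [Group G] [TopologicalSpace G]
    [Field B] [TopologicalSpace B] [CommRing S] [MulSemiringAction G S]
    [AddCommGroup M] [Module S M] [Module B M] [DistribMulAction G M] [SMulDistribClass G S M]
    (W : ℤ → Submodule S M) : Prop where
  continuous_smul :
    @Continuous (G × M) M
      (@instTopologicalSpaceProd G M _ (finTopology B M)) (finTopology B M) (fun q => q.1 • q.2)
  mono : Monotone W
  eq_bot_of_neg : ∀ n < 0, W n = ⊥
  exhaustive : ∀ m : M, ∃ n, m ∈ W n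
  smul_mem : ∀ (g : G) (n : ℤ), ∀ m ∈ W n, g • m ∈ W n
  fg : ∀ n, (W n).FG

/-- The filtration is multiplicative: the unit `S → M` (with `S` in degree zero) and the
multiplication `M ⊗ M → M` are filtered. -/
structure IsFilteredAlgebra {S M : Type*} [CommRing S] [CommRing M] [Algebra S M]
    (W : ℤ → Submodule S M) : Prop where
  one_mem : (1 : M) ∈ W 0
  mul_mem : ∀ i j : ℤ, ∀ x ∈ W i, ∀ y ∈ W j, x * y ∈ W (i + j)

variable {G B : Type*} [Group G] [Field B] [MulSemiringAction G B]

/-- The diagonal action `p ⊗ a ↦ g p ⊗ g a` of `g` on `P ⊗_B A`. -/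
def diag {P A : Type*} [AddCommGroup P] [Module B P] [AddCommGroup A] [Module B A]
    [DistribMulAction G P] [DistribMulAction G A] [SMulDistribClass G B P]
    [SMulDistribClass G B A] (g : G) : P ⊗[B] A →+ P ⊗[B] A :=
  TensorProduct.liftAddHom
    { toFun := fun p =>
        { toFun := fun a => (g • p) ⊗ₜ[B] (g • a)
          map_zero' := by simp
          map_add' := fun a b => by rw [smul_add, TensorProduct.tmul_add] }
      map_zero' := by ext a; simp
      map_add' := fun p q => by ext a; simp [smul_add, TensorProduct.add_tmul] }
    (fun r p a => by
      change (g • r • p) ⊗ₜ[B] (g • a) = (g • p) ⊗ₜ[B] (g • r • a)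
      rw [smul_distrib_smul g r p, smul_distrib_smul g r a, TensorProduct.smul_tmul])

@[simp] theorem diag_tmul {P A : Type*} [AddCommGroup P] [Module B P] [AddCommGroup A]
    [Module B A] [DistribMulAction G P] [DistribMulAction G A] [SMulDistribClass G B P]
    [SMulDistribClass G B A] (g : G) (p : P) (a : A) :
    diag (B := B) g (p ⊗ₜ[B] a) = (g • p) ⊗ₜ[B] (g • a) := rfl

/-- The action of `g` on points: `f ↦ g ∘ f ∘ g⁻¹`. -/
def conj {E X Y : Type*} [CommRing E] [CommRing X] [CommRing Y] [Algebra E X] [Algebra E Y]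
    [MulSemiringAction G E] [MulSemiringAction G X] [MulSemiringAction G Y]
    [SMulDistribClass G E X] [SMulDistribClass G E Y] (g : G) (f : X →ₐ[E] Y) : X →ₐ[E] Y where
  toFun x := g • f (g⁻¹ • x)
  map_one' := by simp
  map_mul' x y := by simp [smul_mul']
  map_zero' := by simp
  map_add' x y := by simp
  commutes' r := by
    rw [Algebra.algebraMap_eq_smul_one, Algebra.algebraMap_eq_smul_one, smul_distrib_smul,
      map_smul, smul_distrib_smul]
    simp

end Category

/-! ### The group -/

section HopfObject

variable (G : Type*) {B A : Type*} [Group G] [TopologicalSpace G]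
  [Field B] [TopologicalSpace B] [MulSemiringAction G B] [CommRing A] [HopfAlgebra B A]
  [MulSemiringAction G A] [SMulDistribClass G B A]

/-- A commutative Hopf algebra in the category of filtered `B`-vector spaces with continuous
semilinear `G`-action: all structure maps are filtered and `G`-equivariant. (Equivariance of the
unit and of the multiplication is part of `MulSemiringAction G A`; the counit is filtered because
`W` vanishes in negative degrees.) -/
structure IsFilteredHopf (W : ℤ → Submodule B A) : Prop where
  rep : IsFilteredRep G B W
  alg : IsFilteredAlgebra W
  comul_mem : ∀ n, ∀ a ∈ W n, Coalgebra.comul (R := B) a ∈ tensorFil B W W n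
  comul_smul : ∀ (g : G) (a : A),
    Coalgebra.comul (R := B) (g • a) = diag g (Coalgebra.comul (R := B) a)
  counit_smul : ∀ (g : G) (a : A),
    Coalgebra.counit (R := B) (g • a) = g • Coalgebra.counit (R := B) a
  antipode_mem : ∀ n, ∀ a ∈ W n, HopfAlgebra.antipode B a ∈ W n
  antipode_smul : ∀ (g : G) (a : A),
    HopfAlgebra.antipode B (g • a) = g • HopfAlgebra.antipode B a

end HopfObject

/-- `Spec A` is pro-unipotent: it is an inverse limit of closed subgroups of groups of upper
unitriangular matrices. In terms of `A`: each element lies in a subalgebra generated by the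
matrix entries of a homomorphism from `Spec A` to some group of upper unitriangular matrices. -/
def IsProUnipotent (B A : Type*) [Field B] [CommRing A] [HopfAlgebra B A] : Prop :=
  ∀ a : A, ∃ (N : ℕ) (M : Matrix (Fin N) (Fin N) A),
    (∀ i, M i i = 1) ∧ (∀ i j, j < i → M i j = 0) ∧
    (∀ i j, Coalgebra.comul (R := B) (M i j) = ∑ k, M i k ⊗ₜ[B] M k j) ∧
    a ∈ Algebra.adjoin B {x : A | ∃ i j, x = M i j}

/-! ### Points and cohomology -/

section Cohomology

/-- The set `U(S) = Hom_{B-alg}(A, S)` of `S`-points of `U = Spec A`, with the convolution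
product. -/
abbrev Pts (B A S : Type*) [Field B] [CommRing A] [HopfAlgebra B A] [CommRing S] [Algebra B S] :
    Type _ := WithConv (A →ₐ[B] S)

/-- The group structure on `U(S)`. -/
instance ptsGroup {B A S : Type*} [Field B] [CommRing A] [HopfAlgebra B A] [CommRing S]
    [Algebra B S] : Group (Pts B A S) where
  inv f := WithConv.toConv (f.ofConv.comp (HopfAlgebra.antipodeAlgHom B A))
  inv_mul_cancel f := by
    apply WithConv.ofConv_injective
    apply AlgHom.ext
    intro a
    change (WithConv.toConv (f.ofConv.comp (HopfAlgebra.antipodeAlgHom B A)) * f) a =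
      (1 : Pts B A S) a
    rw [AlgHom.convMul_apply, AlgHom.convOne_apply]
    have key : ∀ t : A ⊗[B] A,
        Algebra.TensorProduct.lift (f.ofConv.comp (HopfAlgebra.antipodeAlgHom B A)) f.ofConv
          (fun _ _ => Commute.all _ _) t =
        f.ofConv (LinearMap.mul' B A ((HopfAlgebra.antipode B).rTensor A t)) := by
      intro t
      induction t with
      | zero => simp
      | tmul x y => simp
      | add x y hx hy => simp only [map_add, hx, hy]
    erw [key]
    rw [HopfAlgebra.mul_antipode_rTensor_comul_apply]
    simp

variable {G B A : Type*} [Group G] [TopologicalSpace G]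
  [Field B] [TopologicalSpace B] [MulSemiringAction G B] [CommRing A] [HopfAlgebra B A]
  [MulSemiringAction G A] [SMulDistribClass G B A]
  (S : Type*) [CommRing S] [Algebra B S] [MulSemiringAction G S] [SMulDistribClass G B S]

/-- The topology on `U(S)` induced by the maps `U(S) → Hom_B(V, S)`, for `V` a finite-dimensional
subspace of `A`. If `A` is finitely generated this is the topology induced by any closed embedding
of `U` in an affine space; in general it is the inverse limit topology. -/
abbrev ptsTopology (B A S : Type*) [Field B] [TopologicalSpace B] [CommRing A] [HopfAlgebra B A]
    [CommRing S] [Algebra B S] : TopologicalSpace (Pts B A S) :=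
  ⨅ V : {V : Submodule B A // FiniteDimensional B V},
    TopologicalSpace.induced
      (fun y : Pts B A S => y.ofConv.toLinearMap.domRestrict V.1) (finTopology B (V.1 →ₗ[B] S))

/-- The action `y ↦ g ∘ y ∘ g⁻¹` of `G` on `U(S)`. -/
def gact {S : Type*} [CommRing S] [Algebra B S] [MulSemiringAction G S] [SMulDistribClass G B S]
    (g : G) (y : Pts B A S) : Pts B A S :=
  WithConv.toConv (conj g y.ofConv)

variable {S} in
theorem gact_mul {W : ℤ → Submodule B A} (hA : IsFilteredHopf G W) (g : G) (y z : Pts B A S) :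
    gact g (y * z) = gact g y * gact g z := by
  apply WithConv.ofConv_injective
  apply AlgHom.ext
  intro a
  change g • ((y * z) (g⁻¹ • a)) = (gact g y * gact g z) a
  rw [AlgHom.convMul_apply, AlgHom.convMul_apply, hA.comul_smul]
  generalize Coalgebra.comul (R := B) a = t
  induction t with
  | zero => simp
  | tmul p q => simp [gact, conj, smul_mul']
  | add p q hp hq => simp only [map_add, smul_add, hp, hq]

variable {S} in
theorem gact_one {W : ℤ → Submodule B A} (hA : IsFilteredHopf G W) (g : G) :
    gact g (1 : Pts B A S) = 1 := by
  have h := gact_mul (S := S) hA g 1 1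
  rw [mul_one] at h
  exact (left_eq_mul.mp h)

variable (G B A) in
/-- Continuous 1-cocycles `c : G → U(S)`, `c (g h) = c g · g (c h)`. -/
structure Cocycle where
  toFun : G → Pts B A S
  continuous_toFun : @Continuous G (Pts B A S) _ (ptsTopology B A S) toFun
  map_mul : ∀ g h : G, toFun (g * h) = toFun g * gact g (toFun h)

/-- Two cocycles are equivalent if they are in one orbit of the action
`(y c)(g) = y · c g · g (y⁻¹)` of `U(S)`. -/
def cocycleSetoid {W : ℤ → Submodule B A} (hA : IsFilteredHopf G W) :
    Setoid (Cocycle G B A S) where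
  r c d := ∃ y : Pts B A S, ∀ g : G, d.toFun g = y * c.toFun g * gact g (y⁻¹)
  iseqv :=
    { refl := fun c => ⟨1, fun g => by rw [inv_one, gact_one hA, one_mul, mul_one]⟩
      symm := by
        rintro c d ⟨y, h⟩
        refine ⟨y⁻¹, fun g => ?_⟩
        have e : gact g y⁻¹ * gact g y = 1 := by
          rw [← gact_mul hA, inv_mul_cancel, gact_one hA]
        rw [h g, inv_inv, mul_assoc, mul_assoc, e, mul_one, inv_mul_cancel_left]
      trans := by
        rintro c d f ⟨y, h⟩ ⟨z, k⟩
        refine ⟨z * y, fun g => ?_⟩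
        rw [k g, h g, mul_inv_rev, gact_mul hA]
        simp only [mul_assoc] }

/-- The continuous non-abelian cohomology set `H¹(G, U(S))`. -/
def H1 {W : ℤ → Submodule B A} (hA : IsFilteredHopf G W) : Type _ :=
  Quotient (cocycleSetoid S hA)

end Cohomology

/-! ### Torsors -/

section Torsors

/-- The canonical map `P ⊗_S P → P ⊗_B A`, `p ⊗ q ↦ (p ⊗ 1) a(q)`, dual to
`P × U → P × P`, `(p, y) ↦ (p, p y)`. -/
def canMap {B A S P : Type*} [Field B] [CommRing A] [Algebra B A] [CommRing S]
    [Algebra B S] [CommRing P] [Algebra S P] [Algebra B P] [IsScalarTower B S P]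
    (a : P →ₐ[S] P ⊗[B] A) : P ⊗[S] P →ₐ[S] P ⊗[B] A :=
  Algebra.TensorProduct.lift Algebra.TensorProduct.includeLeft a (fun _ _ => Commute.all _ _)

/-- The right action `(x, y) ↦ x y` of `U(S)` on the points `P(S)`. -/
def actPt {B A S P : Type*} [Field B] [CommRing A] [HopfAlgebra B A] [CommRing S]
    [Algebra B S] [CommRing P] [Algebra S P] [Algebra B P] [IsScalarTower B S P]
    (a : P →ₐ[S] P ⊗[B] A) (x : P →ₐ[S] S) (y : Pts B A S) : P →ₐ[S] S :=
  (Algebra.TensorProduct.lift x y.ofConv (fun _ _ => Commute.all _ _)).comp a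

variable (G : Type v) {B A : Type u} [Group G] [TopologicalSpace G]
  [Field B] [TopologicalSpace B] [MulSemiringAction G B] [CommRing A] [HopfAlgebra B A]
  [MulSemiringAction G A] [SMulDistribClass G B A]
  (S : Type u) [CommRing S] [Algebra B S] [MulSemiringAction G S] [SMulDistribClass G B S]

/-- A `U_S`-torsor in the category of filtered `S`-modules with continuous semilinear `G`-action,
where `U = Spec A` and `W` is the weight filtration of `A`. Since
`P ⊗_S (S ⊗_B A) = P ⊗_B A`, the coaction is written as a map `P → P ⊗_B A`. -/
structure Torsor (W : ℤ → Submodule B A) where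
  /-- the coordinate ring -/
  carrier : Type u
  [commRing : CommRing carrier]
  [algebra : Algebra S carrier]
  -- the underlying `B`-algebra
  [algebraBase : Algebra B carrier]
  [tower : IsScalarTower B S carrier]
  -- the semilinear action by ring automorphisms
  [action : MulSemiringAction G carrier]
  [semilinear : SMulDistribClass G S carrier]
  -- a consequence of the preceding lines, recorded for instance resolution
  [semilinearBase : SMulDistribClass G B carrier]
  /-- the weight filtration -/
  fil : ℤ → Submodule S carrier
  rep : IsFilteredRep G B fil
  alg : IsFilteredAlgebra fil
  /-- the coaction -/
  coact : carrier →ₐ[S] carrier ⊗[B] A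
  coact_mem : ∀ n, ∀ p ∈ fil n,
    coact p ∈ tensorFil B (fun i => (fil i).restrictScalars B) W n
  coact_smul : ∀ (g : G) (p : carrier), coact (g • p) = diag g (coact p)
  coact_coassoc : ∀ p : carrier,
    TensorProduct.assoc B carrier A A
        ((coact.restrictScalars B).toLinearMap.rTensor A (coact p)) =
      (Coalgebra.comul (R := B) (A := A)).lTensor carrier (coact p)
  coact_counit : ∀ p : carrier,
    TensorProduct.rid B carrier
      ((Coalgebra.counit (R := B) (A := A)).lTensor carrier (coact p)) = p
  -- `P → Spec S` is faithfully flat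
  faithfullyFlat : Module.FaithfullyFlat S carrier
  -- `P × U → P × P` is an isomorphism in the category
  can_bijective : Function.Bijective (canMap (B := B) coact)
  can_strict : ∀ n,
    (canMap (B := B) coact) '' (tensorFil S fil fil n : Set (carrier ⊗[S] carrier)) =
      (tensorFil B (fun i => (fil i).restrictScalars B) W n : Set (carrier ⊗[B] A))
  -- `W_n P` is free of rank `dim W_n A`
  rank : ∀ n, Nonempty (Module.Basis (Fin (Module.finrank B (W n))) S (fil n))

attribute [instance] Torsor.commRing Torsor.algebra Torsor.algebraBase Torsor.tower
  Torsor.action Torsor.semilinear Torsor.semilinearBase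

variable {G S} in
/-- An isomorphism of torsors: an isomorphism of `S`-algebras that is strictly filtered,
`G`-equivariant and compatible with the coactions. -/
structure Torsor.Iso {W : ℤ → Submodule B A} (P Q : Torsor G S W) where
  /-- the isomorphism of coordinate rings -/
  toAlgEquiv : P.carrier ≃ₐ[S] Q.carrier
  map_smul : ∀ (g : G) (p : P.carrier), toAlgEquiv (g • p) = g • toAlgEquiv p
  mem_iff : ∀ n (p : P.carrier), toAlgEquiv p ∈ Q.fil n ↔ p ∈ P.fil n
  map_coact : ∀ p : P.carrier, Q.coact (toAlgEquiv p) =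
    (toAlgEquiv.toAlgHom.restrictScalars B).toLinearMap.rTensor A (P.coact p)

/-- The relation of being isomorphic on torsors. -/
def torsorSetoid (W : ℤ → Submodule B A) : Setoid (Torsor G S W) where
  r P Q := Nonempty (P.Iso Q)
  iseqv :=
    { refl := fun P => ⟨⟨AlgEquiv.refl, fun _ _ => rfl, fun _ _ => Iff.rfl, fun p =>
        (LinearMap.congr_fun (LinearMap.rTensor_id A P.carrier) (P.coact p)).symm⟩⟩
      symm := by
        rintro P Q ⟨f⟩
        refine ⟨⟨f.toAlgEquiv.symm, fun g q => ?_, fun n q => ?_, fun q => ?_⟩⟩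
        · apply f.toAlgEquiv.injective
          rw [f.map_smul, AlgEquiv.apply_symm_apply, AlgEquiv.apply_symm_apply]
        · rw [← f.mem_iff, AlgEquiv.apply_symm_apply]
        · obtain ⟨p, rfl⟩ := f.toAlgEquiv.surjective q
          rw [AlgEquiv.symm_apply_apply, f.map_coact, ← LinearMap.comp_apply,
            ← LinearMap.rTensor_comp]
          have : ((f.toAlgEquiv.symm.toAlgHom.restrictScalars B).toLinearMap ∘ₗ
              (f.toAlgEquiv.toAlgHom.restrictScalars B).toLinearMap) = LinearMap.id := by
            ext x
            simp
          rw [this, LinearMap.rTensor_id, LinearMap.id_apply]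
      trans := by
        rintro P Q T ⟨f⟩ ⟨k⟩
        refine ⟨⟨f.toAlgEquiv.trans k.toAlgEquiv, fun g p => ?_, fun n p => ?_, fun p => ?_⟩⟩
        · simp only [AlgEquiv.trans_apply, f.map_smul, k.map_smul]
        · simp only [AlgEquiv.trans_apply, f.mem_iff, k.mem_iff]
        · rw [AlgEquiv.trans_apply, k.map_coact, f.map_coact, ← LinearMap.comp_apply,
            ← LinearMap.rTensor_comp]
          rfl }

end Torsors

/-! ### The action on `B ⊗_K R` -/

section BaseChange

variable {G B K R : Type*} [Group G] [Field B] [MulSemiringAction G B] [Field K] [Algebra K B]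
  [SMulCommClass G K B] [CommRing R] [Algebra K R]

/-- The action `g (b ⊗ r) = g b ⊗ r` of `G` on `B ⊗_K R`. -/
instance baseChangeAction : MulSemiringAction G (B ⊗[K] R) :=
  haveI : SMulCommClass K G B := SMulCommClass.symm _ _ _
  { (TensorProduct.leftDistribMulAction : DistribMulAction G (B ⊗[K] R)) with
    smul_one := fun g => by
      rw [Algebra.TensorProduct.one_def]
      change (g • (1 : B)) ⊗ₜ[K] (1 : R) = _
      rw [smul_one]
    smul_mul := fun g x y => by
      induction x with
      | zero => simp
      | add x x' hx hx' => simp only [add_mul, smul_add, hx, hx']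
      | tmul b r =>
        induction y with
        | zero => simp
        | add y y' hy hy' => simp only [mul_add, smul_add, hy, hy']
        | tmul b' r' =>
          rw [Algebra.TensorProduct.tmul_mul_tmul]
          change (g • (b * b')) ⊗ₜ[K] (r * r') = ((g • b) ⊗ₜ[K] r) * ((g • b') ⊗ₜ[K] r')
          rw [smul_mul', Algebra.TensorProduct.tmul_mul_tmul] }

theorem baseChangeAction_tmul (g : G) (b : B) (r : R) :
    g • (b ⊗ₜ[K] r) = (g • b) ⊗ₜ[K] r := rfl

instance : SMulDistribClass G B (B ⊗[K] R) where
  smul_distrib_smul g b x := by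
    induction x with
    | zero => simp
    | add x y hx hy => simp only [smul_add, hx, hy]
    | tmul b' r =>
      simp only [TensorProduct.smul_tmul', smul_eq_mul, smul_mul']

end BaseChange

instance smulDistribSelf {G S : Type*} [Group G] [CommRing S] [MulSemiringAction G S] :
    SMulDistribClass G S S where
  smul_distrib_smul g s t := by simp only [smul_eq_mul, smul_mul']

end

end TorsorSpaces

/-! For every `S`-algebra `C`, the isomorphism `P ⊗ P ≅ P ⊗ A` makes `U(C)` act freely and
transitively on the `C`-points of a torsor: `diff x y` is the unique point `u` with `x u = y`. Once
`P(S)` is nonempty the classification is therefore formal. A point `x` has the cocycle `g ↦ diff x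
(g x)`. The map `u ↦ x u` identifies `P` with the trivial torsor whose `G`-action is twisted by that
cocycle (`nonempty_iso_twistTorsor`). Every cocycle occurs in this way (`exists_point_twistTorsor`).
Another point, or an isomorphic torsor, gives a cohomologous cocycle (`Iso.equivalent`).

The work lies in finding a point (`exists_point`). The identity of the coordinate ring is a point
with values in `P` itself. It is corrected by elements of `U(P)`, degree by degree, until its values
on each `W_n P` lie in `S`. When this holds below `n`, it holds on the part of `W_n P` generated by
lower degrees. The quotient of `W_n P` by that part is projective over `S`, because after the
faithfully flat base change to `P` it becomes the free module given by the same quotient for `A`. So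
the values extend to an `S`-valued linear map on `W_n P`. The difference from the current point
corresponds to a linear map `d : A → P` that kills the decomposable part, and an element of `U(P)`
has to realise it.

That element comes from `exists_algHom_eq_counit_add`, where unipotence and characteristic zero
enter. The `k`-th convolution power of the identity of `A` is polynomial in `k`, and its linear
coefficient `eulerian` is the logarithm of the identity. The composite `d ∘ eulerian` is a
derivation at the identity with locally nilpotent convolution powers, and its exponential is counit
plus `d` on `W_n`. This needs `W_0 A = B`, which is itself a consequence of unipotence: `W_0 A` is a
finite-dimensional subalgebra, on which the logarithm must vanish.

The topology reduces to algebra by compactness of `G`: a continuous map from `G` to a space with the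
inductive limit topology is a finite sum of terms `φ g • m` with `φ` continuous
(`isFinCont_of_continuous`). -/

set_option linter.unusedSectionVars false

namespace TorsorSpaces

/-! ### Continuous maps from compact spaces to inductive limits of finite-dimensional spaces -/

section FiniteContinuity

variable {G : Type*} [TopologicalSpace G] (B : Type*) [Field B] [TopologicalSpace B]

/-- Functions with values in a `B`-vector space that are finite sums of functions
`g ↦ φ g • m` with `φ` continuous. -/
def IsFinCont {M : Type*} [AddCommGroup M] [Module B M] (f : G → M) : Prop :=
  f ∈ Submodule.span B {h : G → M | ∃ φ : G → B, Continuous φ ∧ ∃ m : M, h = fun g => φ g • m}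

variable {B}
variable {M N : Type*} [AddCommGroup M] [Module B M] [AddCommGroup N] [Module B N]

namespace IsFinCont

theorem smul_const {φ : G → B} (hφ : Continuous φ) (m : M) :
    IsFinCont B (fun g => φ g • m) :=
  Submodule.subset_span ⟨φ, hφ, m, rfl⟩

theorem const (m : M) : IsFinCont B (fun _ : G => m) := by
  simpa using smul_const (G := G) (continuous_const (y := (1 : B))) m

theorem zero : IsFinCont B (fun _ : G => (0 : M)) := const 0

theorem add {f h : G → M} (hf : IsFinCont B f) (hh : IsFinCont B h) :
    IsFinCont B (fun g => f g + h g) :=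
  Submodule.add_mem _ hf hh

theorem sum {ι : Type*} (s : Finset ι) {f : ι → G → M} (hf : ∀ i ∈ s, IsFinCont B (f i)) :
    IsFinCont B (fun g => ∑ i ∈ s, f i g) := by
  have h := Submodule.sum_mem _ hf
  simpa [IsFinCont, Finset.sum_fn] using h

theorem induction {p : (G → M) → Prop} {f : G → M} (hf : IsFinCont B f)
    (hs : ∀ φ : G → B, Continuous φ → ∀ m : M, p (fun g => φ g • m)) (h0 : p (fun _ => 0))
    (ha : ∀ f h : G → M, p f → p h → p (fun g => f g + h g))
    (hc : ∀ (b : B) (f : G → M), p f → p (fun g => b • f g)) : p f := by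
  refine Submodule.span_induction (p := fun f _ => p f) ?_ h0 (fun f h _ _ => ha f h)
    (fun b f _ => hc b f) hf
  rintro _ ⟨φ, hφ, m, rfl⟩
  exact hs φ hφ m

theorem map (L : M →ₗ[B] N) {f : G → M} (hf : IsFinCont B f) : IsFinCont B (fun g => L (f g)) := by
  refine hf.induction (p := fun f => IsFinCont B (fun g => L (f g))) ?_ ?_ ?_ ?_
  · intro φ hφ m
    simpa using smul_const hφ (L m)
  · simpa using zero
  · intro f h hf hh
    simpa using hf.add hh
  · intro b f hf
    simp only [map_smul]
    exact Submodule.smul_mem _ b hf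

theorem comp {G' : Type*} [TopologicalSpace G'] {k : G' → G} (hk : Continuous k) {f : G → M}
    (hf : IsFinCont B f) : IsFinCont B (fun g => f (k g)) := by
  refine hf.induction (p := fun f => IsFinCont B (fun g => f (k g))) ?_ zero
    (fun f h hf hh => hf.add hh) (fun b f hf => Submodule.smul_mem _ b hf)
  intro φ hφ m
  exact smul_const (hφ.comp hk) m

theorem smul [ContinuousMul B] {φ : G → B} (hφ : Continuous φ) {f : G → M}
    (hf : IsFinCont B f) : IsFinCont B (fun g => φ g • f g) := by
  refine hf.induction (p := fun f => IsFinCont B (fun g => φ g • f g)) ?_ ?_ ?_ ?_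
  · intro ψ hψ m
    simpa [smul_smul] using smul_const (hφ.mul hψ) m
  · simpa using zero
  · intro f h hf hh
    simpa using hf.add hh
  · intro b f hf
    simp only [smul_comm _ b]
    exact Submodule.smul_mem _ b hf

/-- A family of semilinear maps that is continuous at every vector can be evaluated along a
continuous function. -/
theorem apply_semilinear [ContinuousMul B] (F : G → M →+ N) (σ : G → B → B)
    (hσ : ∀ φ : G → B, Continuous φ → Continuous (fun g => σ g (φ g)))
    (hF : ∀ g b m, F g (b • m) = σ g b • F g m)
    (hm : ∀ m, IsFinCont B (fun g => F g m)) {f : G → M} (hf : IsFinCont B f) :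
    IsFinCont B (fun g => F g (f g)) := by
  refine hf.induction (p := fun f => IsFinCont B (fun g => F g (f g))) ?_ ?_ ?_ ?_
  · intro φ hφ m
    simpa only [hF] using (hm m).smul (hσ φ hφ)
  · simpa using zero
  · intro f h hf hh
    simpa using hf.add hh
  · intro b f hf
    simpa only [hF] using hf.smul (hσ (fun _ => b) continuous_const)

theorem apply_linear [ContinuousMul B] (F : G → M →ₗ[B] N)
    (hm : ∀ m, IsFinCont B (fun g => F g m)) {f : G → M} (hf : IsFinCont B f) :
    IsFinCont B (fun g => F g (f g)) :=
  apply_semilinear (fun g => (F g).toAddMonoidHom) (fun _ b => b) (fun _ h => h)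
    (fun g b m => (F g).map_smul b m) hm hf

theorem mul [ContinuousMul B] {M : Type*} [CommRing M] [Algebra B M] {f h : G → M}
    (hf : IsFinCont B f) (hh : IsFinCont B h) : IsFinCont B (fun g => f g * h g) :=
  apply_linear (fun g => LinearMap.mulLeft B (f g))
    (fun m => hf.map (LinearMap.mulRight B m)) hh

theorem smul_action [ContinuousMul B] [Group G] [MulSemiringAction G B] [ContinuousSMul G B]
    [DistribMulAction G M] [SMulDistribClass G B M] (hm : ∀ m : M, IsFinCont B (fun g : G => g • m))
    {f : G → M} (hf : IsFinCont B f) : IsFinCont B (fun g => g • f g) :=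
  apply_semilinear (fun g => DistribSMul.toAddMonoidHom M g) (fun g b => g • b)
    (fun _ h => continuous_id.smul h) (fun g b m => smul_distrib_smul g b m) hm hf

theorem exists_eq_sum {f : G → M} (hf : IsFinCont B f) :
    ∃ (n : ℕ) (φ : Fin n → G → B) (m : Fin n → M), (∀ i, Continuous (φ i)) ∧
      f = fun g => ∑ i, φ i g • m i := by
  rw [IsFinCont, Submodule.mem_span_set'] at hf
  obtain ⟨n, b, h, rfl⟩ := hf
  choose φ hφ m hm using fun i => (h i).2
  refine ⟨n, φ, fun i => b i • m i, hφ, ?_⟩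
  funext g
  rw [Finset.sum_apply]
  refine Finset.sum_congr rfl fun i _ => ?_
  rw [Pi.smul_apply, hm i, smul_comm]

end IsFinCont

theorem continuous_linearMap_finTopology [TopologicalSpace N] [IsModuleTopology B N]
    [FiniteDimensional B N] (L : N →ₗ[B] M) :
    @Continuous N M _ (finTopology B M) L := by
  let R : {R : Submodule B M // FiniteDimensional B R} := ⟨LinearMap.range L, inferInstance⟩
  let tR : TopologicalSpace R.1 := moduleTopology B R.1
  have : IsModuleTopology B R.1 := ⟨rfl⟩
  have : ContinuousAdd R.1 := IsModuleTopology.toContinuousAdd B _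
  let tM : TopologicalSpace M := finTopology B M
  have h1 : Continuous (fun x : R.1 => (x : M)) := by
    rw [continuous_iff_coinduced_le]
    exact le_iSup (fun N : {N : Submodule B M // FiniteDimensional B N} =>
      TopologicalSpace.coinduced (fun x : N.1 => (x : M)) (moduleTopology B N.1)) R
  exact h1.comp (IsModuleTopology.continuous_of_linearMap L.rangeRestrict)

theorem continuous_of_linearMap_finTopology [TopologicalSpace N] [ContinuousAdd N]
    [ContinuousSMul B N] (L : M →ₗ[B] N) : @Continuous M N (finTopology B M) _ L := by
  rw [continuous_iSup_dom]
  intro R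
  rw [continuous_coinduced_dom]
  let tR : TopologicalSpace R.1 := moduleTopology B R.1
  have : IsModuleTopology B R.1 := ⟨rfl⟩
  exact IsModuleTopology.continuous_of_linearMap (L.domRestrict R.1)

variable [IsTopologicalRing B]

theorem IsFinCont.continuous {f : G → M} (hf : IsFinCont B f) :
    @Continuous G M _ (finTopology B M) f := by
  obtain ⟨n, φ, m, hφ, rfl⟩ := hf.exists_eq_sum
  let tM : TopologicalSpace M := finTopology B M
  exact (continuous_linearMap_finTopology (Fintype.linearCombination B m)).comp
    (continuous_pi hφ)

/-- A linearly independent set meets each finite-dimensional subspace in a finite set, so it is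
closed, and so are all its subsets. Inside a compact set it is then compact and discrete. -/
theorem finite_of_isCompact_of_linearIndependent [T2Space B] {K s : Set M}
    (hK : @IsCompact M (finTopology B M) K) (hs : LinearIndepOn B id s) (hsK : s ⊆ K) :
    s.Finite := by
  let tM : TopologicalSpace M := finTopology B M
  have hcl : ∀ t ⊆ s, IsClosed t := by
    intro t ht
    rw [isClosed_iSup_iff]
    intro R
    rw [isClosed_coinduced]
    let tR : TopologicalSpace R.1 := moduleTopology B R.1
    have : IsModuleTopology B R.1 := ⟨rfl⟩
    have := R.2
    have : T2Space R.1 := T2Space.of_injective_continuous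
      (f := (Module.finBasis B R.1).equivFun) (LinearEquiv.injective _)
      (IsModuleTopology.continuous_of_linearMap (Module.finBasis B R.1).equivFun.toLinearMap)
    have hli : LinearIndepOn B id t := hs.mono ht
    have h2 : LinearIndependent B (fun x : ((fun x : R.1 => (x : M)) ⁻¹' t) => (x : R.1)) := by
      refine LinearIndependent.of_comp R.1.subtype ?_
      exact hli.comp (fun x : ((fun x : R.1 => (x : M)) ⁻¹' t) => (⟨x.1, x.2⟩ : t))
        (fun x y h => by
          have := congrArg Subtype.val h
          exact Subtype.ext (Subtype.ext this))
    have : Finite ((fun x : R.1 => (x : M)) ⁻¹' t) := h2.finite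
    exact (Set.toFinite _).isClosed
  have hcs : IsCompact s := hK.of_isClosed_subset (hcl s subset_rfl) hsK
  refine hcs.finite ?_
  rw [isDiscrete_iff_discreteTopology, discreteTopology_iff_forall_isClosed]
  intro t
  have h := (hcl (Subtype.val '' t) (by simp)).preimage (continuous_subtype_val (p := (· ∈ s)))
  rwa [Set.preimage_image_eq _ Subtype.val_injective] at h

/-- A continuous function from a compact space to a vector space with the inductive limit topology
has values in a finite-dimensional subspace. -/
theorem isFinCont_of_continuous [T2Space B] [CompactSpace G] {f : G → M}
    (hf : @Continuous G M _ (finTopology B M) f) : IsFinCont B f := by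
  let tM : TopologicalSpace M := finTopology B M
  obtain ⟨s, hs, hspan, hli⟩ := exists_linearIndependent B (Set.range f)
  have hfin : s.Finite :=
    finite_of_isCompact_of_linearIndependent (isCompact_range hf) hli hs
  let R : Submodule B M := Submodule.span B (Set.range f)
  have : FiniteDimensional B R := by
    have : R = Submodule.span B s := hspan.symm
    rw [this]
    exact FiniteDimensional.span_of_finite B hfin
  -- A linear projection onto the span of the values extends the coordinates to all of `M`, where
  -- every linear functional is continuous.
  obtain ⟨π, hπ⟩ := R.subtype.exists_leftInverse_of_injective (Submodule.ker_subtype R)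
  have hπ' : ∀ x : R, π x = x := fun x => LinearMap.congr_fun hπ x
  let b := Module.finBasis B R
  have h : f = fun g => ∑ i, b.coord i (π (f g)) • ((b i : R) : M) := by
    funext g
    have hg : f g ∈ R := Submodule.subset_span ⟨g, rfl⟩
    have e1 := hπ' ⟨f g, hg⟩
    have e2 := congrArg (R.subtype) (b.sum_repr (π (f g)))
    simp only [map_sum, map_smul] at e2
    rw [e1] at e2
    simpa [e1] using e2.symm
  rw [h]
  exact IsFinCont.sum _ fun i _ => IsFinCont.smul_const
    ((continuous_of_linearMap_finTopology (b.coord i ∘ₗ π)).comp hf) _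

/-- Joint continuity of a semilinear action of a compact group can be tested on single vectors. -/
theorem continuous_smul_finTopology [Group G] [IsTopologicalGroup G] [CompactSpace G]
    [MulSemiringAction G B] [ContinuousSMul G B] [DistribMulAction G M] [SMulDistribClass G B M]
    (hm : ∀ m : M, IsFinCont B (fun g : G => g • m)) :
    @Continuous (G × M) M (@instTopologicalSpaceProd G M _ (finTopology B M)) (finTopology B M)
      (fun q => q.1 • q.2) := by
  let tM : TopologicalSpace M := finTopology B M
  -- The product `G × M` need not carry the inductive limit topology of the `G × N`. Currying moves
  -- the question to a map out of `M`, which can be tested on each `N`; local compactness of `G`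
  -- allows uncurrying.
  let Φ : M → C(G, M) := fun m => ⟨fun g => g • m, (hm m).continuous⟩
  have hΦ : Continuous Φ := by
    rw [continuous_iSup_dom]
    intro R
    rw [continuous_coinduced_dom]
    let tR : TopologicalSpace R.1 := moduleTopology B R.1
    have : IsModuleTopology B R.1 := ⟨rfl⟩
    have := R.2
    refine ContinuousMap.continuous_of_continuous_uncurry _ ?_
    let b := Module.finBasis B R.1
    have key : IsFinCont B (fun q : R.1 × G => q.2 • (q.1 : M)) := by
      have : (fun q : R.1 × G => q.2 • (q.1 : M)) =
          fun q => ∑ i, (q.2 • b.coord i q.1) • (q.2 • ((b i : R.1) : M)) := by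
        funext q
        have e2 := congrArg (fun x : R.1 => q.2 • (x : M)) (b.sum_repr q.1)
        simp only [Submodule.coe_sum, Submodule.coe_smul, Finset.smul_sum,
          smul_distrib_smul] at e2
        exact e2.symm
      rw [this]
      refine IsFinCont.sum _ fun i _ => IsFinCont.smul ?_ ((hm _).comp continuous_snd)
      exact continuous_snd.smul
        ((IsModuleTopology.continuous_of_linearMap (b.coord i)).comp continuous_fst)
    exact key.continuous
  have h := ContinuousMap.continuous_uncurry_of_continuous ⟨Φ, hΦ⟩
  exact h.comp continuous_swap

end FiniteContinuity

/-! ### Continuity of families of points of the group -/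

section PointContinuity

variable {G : Type*} [TopologicalSpace G] [CompactSpace G] {B : Type*} [Field B]
  [TopologicalSpace B] [IsTopologicalRing B] [T2Space B]
  {A S : Type*} [CommRing A] [HopfAlgebra B A] [CommRing S] [Algebra B S]

/-- Replaces the inverse limit topology on `U(S)` by a condition on single elements of `A`: on a
finite-dimensional `V`, a linear map is the sum of its values on a basis times the coordinates. -/
theorem continuous_pts_iff (c : G → Pts B A S) :
    @Continuous G (Pts B A S) _ (ptsTopology B A S) c ↔
      ∀ a : A, IsFinCont B (fun g => (c g).ofConv a) := by
  rw [continuous_iInf_rng]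
  simp only [continuous_induced_rng]
  constructor
  · intro h a
    let V : {V : Submodule B A // FiniteDimensional B V} :=
      ⟨Submodule.span B {a}, inferInstance⟩
    have := isFinCont_of_continuous (h V)
    exact this.map (LinearMap.applyₗ (⟨a, Submodule.mem_span_singleton_self a⟩ : V.1))
  · intro h V
    have := V.2
    refine IsFinCont.continuous ?_
    let b := Module.finBasis B V.1
    have : ((fun y : Pts B A S => y.ofConv.toLinearMap.domRestrict V.1) ∘ c) =
        fun g => ∑ i, (b.coord i).smulRight ((c g).ofConv (b i : V.1)) := by
      funext g
      refine b.ext fun j => ?_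
      simp [Finsupp.single_apply, ite_smul]
    rw [this]
    refine IsFinCont.sum _ fun i _ => ?_
    exact (h (b i : V.1)).map (LinearMap.smulRightₗ (b.coord i))

end PointContinuity

/-! ### Polynomial interpolation at the natural numbers, and powers of unipotent matrices -/

section Polynomials

variable {B : Type*} [Field B]

/-- A functional on `M` turns the hypothesis into a scalar polynomial with infinitely many roots,
and functionals separate the vectors of `M`. -/
theorem eq_zero_of_forall_sum_natCast_pow_smul [CharZero B] {M : Type*} [AddCommGroup M] [Module B M]
    (N : ℕ) (m : ℕ → M) (h : ∀ k : ℕ, ∑ i ∈ Finset.range N, (k : B) ^ i • m i = 0) :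
    ∀ i < N, m i = 0 := by
  intro i hi
  rw [← Module.forall_dual_apply_eq_zero_iff B]
  intro φ
  let p : Polynomial B := ∑ i ∈ Finset.range N, Polynomial.monomial i (φ (m i))
  have hp : p = 0 := by
    refine Polynomial.eq_zero_of_infinite_isRoot _
      ((Set.infinite_range_of_injective (Nat.cast_injective (R := B))).mono ?_)
    rintro _ ⟨k, rfl⟩
    have := congrArg φ (h k)
    rw [map_sum, map_zero] at this
    change p.eval (k : B) = 0
    rw [Polynomial.eval_finsetSum, ← this]
    refine Finset.sum_congr rfl fun i _ => ?_
    rw [Polynomial.eval_monomial, map_smul, smul_eq_mul, mul_comm]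
  have := congrArg (fun q => Polynomial.coeff q i) hp
  simpa [p, Polynomial.coeff_monomial, hi] using this

variable {A : Type*} [CommRing A] [Algebra B A]

variable (B) in
theorem eval_natCast_eq_sum (p : Polynomial A) (N : ℕ) (hN : p.natDegree < N) (k : ℕ) :
    p.eval (k : A) = ∑ i ∈ Finset.range N, (k : B) ^ i • p.coeff i := by
  rw [Polynomial.eval_eq_sum_range' hN]
  refine Finset.sum_congr rfl fun i _ => ?_
  rw [Algebra.smul_def, mul_comm]
  simp

theorem polynomial_eq_of_eval_natCast (B : Type*) [Field B] [CharZero B] {A : Type*} [CommRing A]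
    [Algebra B A] (p q : Polynomial A)
    (h : ∀ k : ℕ, p.eval (k : A) = q.eval (k : A)) : p = q := by
  rw [← sub_eq_zero]
  ext i
  by_cases hi : i < (p - q).natDegree + 1
  · refine eq_zero_of_forall_sum_natCast_pow_smul (B := B) _ _ (fun k => ?_) i hi
    rw [← eval_natCast_eq_sum B _ _ (Nat.lt_succ_self _), Polynomial.eval_sub, h, sub_self]
  · exact Polynomial.coeff_eq_zero_of_natDegree_lt (by omega)

/-- The linear coefficient of a polynomial is seen by a linear map through the values at the
natural numbers. -/
theorem apply_coeff_one_of_eval_natCast [CharZero B] {M : Type*} [AddCommGroup M] [Module B M]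
    (p : Polynomial A) (d : A →ₗ[B] M) (u v : M) (h : ∀ k : ℕ, d (p.eval (k : A)) = u + (k : B) • v) :
    d (p.coeff 1) = v := by
  -- The margin `2` keeps the indices `0` and `1` in range even when `p` is constant.
  let N := p.natDegree + 2
  let w : ℕ → M := fun i => if i = 0 then u else if i = 1 then v else 0
  have key := eq_zero_of_forall_sum_natCast_pow_smul (B := B) N (fun i => d (p.coeff i) - w i)
    (fun k => by
      simp only [smul_sub, Finset.sum_sub_distrib]
      have e1 := h k
      rw [eval_natCast_eq_sum B p N (by omega) k, map_sum] at e1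
      simp only [map_smul] at e1
      rw [e1, sub_eq_zero]
      simp only [N, Finset.sum_range_succ']
      simp [w, add_comm])
  have := key 1 (by omega)
  simpa [w, sub_eq_zero] using this

end Polynomials

section Matrices

/-- Cayley–Hamilton: the characteristic polynomial is `(X - 1) ^ N`. -/
theorem sub_one_pow_eq_zero_of_unitriangular {A : Type*} [CommRing A] {N : ℕ} (M : Matrix (Fin N) (Fin N) A)
    (h1 : ∀ i, M i i = 1) (h0 : ∀ i j, j < i → M i j = 0) : (M - 1) ^ N = 0 := by
  have h := Matrix.aeval_self_charpoly M
  have ht : M.BlockTriangular id := fun i j hij => h0 i j hij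
  rw [Matrix.charpoly_of_isUpperTriangular M ht] at h
  simpa [h1] using h

variable (B : Type*) [Field B] [CharZero B]

/-- Binomial expansion of `(1 + (M - 1)) ^ k`: only the terms with `m < N` survive, and `k.choose m`
is a polynomial in `k` once `m!` is invertible. -/
theorem exists_polynomial_pow_eq_eval {A : Type*} [CommRing A] [Algebra B A] {N : ℕ}
    (M : Matrix (Fin N) (Fin N) A) (hM : (M - 1) ^ N = 0) (i j : Fin N) :
    ∃ p : Polynomial A, ∀ k : ℕ, (M ^ k) i j = p.eval (k : A) := by
  refine ⟨∑ m ∈ Finset.range N, Polynomial.C ((algebraMap B A (m.factorial : B)⁻¹) *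
    ((M - 1) ^ m) i j) * descPochhammer A m, fun k => ?_⟩
  have e : M ^ k = ∑ m ∈ Finset.range N, k.choose m • (M - 1) ^ m := by
    conv_lhs => rw [← sub_add_cancel M 1, (Commute.one_right (M - 1)).add_pow]
    have : ∀ m, (M - 1) ^ m * 1 ^ (k - m) * (k.choose m : Matrix (Fin N) (Fin N) A) =
        k.choose m • (M - 1) ^ m := by
      intro m
      rw [one_pow, mul_one, nsmul_eq_mul, (Nat.cast_commute _ _).eq]
    simp only [this]
    have hz : ∀ m, N ≤ m → (M - 1) ^ m = 0 := fun m hm => pow_eq_zero_of_le hm hM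
    rcases le_total N (k + 1) with h | h
    · symm
      refine Finset.sum_subset (Finset.range_subset_range.2 h) fun m _ hm => ?_
      rw [hz m (by simpa using hm), smul_zero]
    · refine Finset.sum_subset (Finset.range_subset_range.2 h) fun m _ hm => ?_
      rw [Finset.mem_range] at hm
      rw [Nat.choose_eq_zero_of_lt (by omega), zero_smul]
  rw [e, Matrix.sum_apply, Polynomial.eval_finsetSum]
  refine Finset.sum_congr rfl fun m _ => ?_
  rw [Polynomial.eval_mul, Polynomial.eval_C, descPochhammer_eval_eq_descFactorial,
    Nat.descFactorial_eq_factorial_mul_choose, Matrix.smul_apply, nsmul_eq_mul, Nat.cast_mul]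
  have : algebraMap B A (m.factorial : B)⁻¹ * (m.factorial : A) = 1 := by
    rw [← map_natCast (algebraMap B A), ← map_mul,
      inv_mul_cancel₀ (Nat.cast_ne_zero.2 m.factorial_ne_zero), map_one]
  linear_combination (-(k.choose m : A) * ((M - 1) ^ m) i j) * this

end Matrices

/-! ### Convolution powers of the identity and their logarithm -/

section Adams

variable {B A : Type*} [Field B] [CommRing A] [HopfAlgebra B A]

noncomputable section

/-- The `k`-th convolution power of the identity of a commutative Hopf algebra. -/
def adams (k : ℕ) : A →ₐ[B] A := ((WithConv.toConv (AlgHom.id B A) : Pts B A A) ^ k).ofConv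

theorem adams_zero_apply (a : A) :
    adams (B := B) 0 a = algebraMap B A (Coalgebra.counit (R := B) a) := by
  rw [adams, pow_zero]
  rfl

theorem adams_add_apply (k l : ℕ) (a : A) : adams (B := B) (k + l) a =
    Algebra.TensorProduct.lift (adams (B := B) k) (adams (B := B) l) (fun _ _ => Commute.all _ _)
      (Coalgebra.comul (R := B) a) := by
  change ((WithConv.toConv (AlgHom.id B A) : Pts B A A) ^ (k + l)) a = _
  rw [pow_add, AlgHom.convMul_apply]
  rfl

theorem adams_one_apply (a : A) : adams (B := B) 1 a = a := by
  rw [adams, pow_one]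
  rfl

theorem adams_succ_apply (k : ℕ) (a : A) : adams (B := B) (k + 1) a =
    Algebra.TensorProduct.lift (AlgHom.id B A) (adams k) (fun _ _ => Commute.all _ _)
      (Coalgebra.comul (R := B) a) := by
  rw [add_comm, adams_add_apply]
  congr 1
  ext a <;> simp [adams_one_apply]

variable (B A) in
/-- The elements on which the convolution powers of the identity are polynomial. -/
def polynomialAdams : Subalgebra B A where
  carrier := {a | ∃ p : Polynomial A, ∀ k : ℕ, adams (B := B) k a = p.eval (k : A)}
  mul_mem' := by
    rintro a b ⟨p, hp⟩ ⟨q, hq⟩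
    exact ⟨p * q, fun k => by rw [map_mul, hp, hq, Polynomial.eval_mul]⟩
  add_mem' := by
    rintro a b ⟨p, hp⟩ ⟨q, hq⟩
    exact ⟨p + q, fun k => by rw [map_add, hp, hq, Polynomial.eval_add]⟩
  algebraMap_mem' r := ⟨Polynomial.C (algebraMap B A r), fun k => by simp⟩

/-- The counit axiom says that the matrix `E` of counits satisfies `E * M = M`, and `M` is
invertible because its determinant is `1`. -/
theorem counit_matrix_eq_one {N : ℕ} (M : Matrix (Fin N) (Fin N) A)
    (h1 : ∀ i, M i i = 1) (h0 : ∀ i j, j < i → M i j = 0)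
    (hM : ∀ i j, Coalgebra.comul (R := B) (M i j) = ∑ k, M i k ⊗ₜ[B] M k j) (i j : Fin N) :
    algebraMap B A (Coalgebra.counit (R := B) (M i j)) = (1 : Matrix (Fin N) (Fin N) A) i j := by
  let E : Matrix (Fin N) (Fin N) A :=
    Matrix.of fun i j => algebraMap B A (Coalgebra.counit (R := B) (M i j))
  have hE : E * M = M := by
    ext i j
    have h := Coalgebra.rTensor_counit_comul (R := B) (M i j)
    rw [hM, map_sum] at h
    have h' := congrArg (TensorProduct.lid B A) h
    simp only [LinearMap.rTensor_tmul, map_sum, TensorProduct.lid_tmul, one_smul] at h'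
    rw [Matrix.mul_apply]
    conv_rhs => rw [← h']
    refine Finset.sum_congr rfl fun k _ => ?_
    simp [E, Algebra.smul_def]
  have hdet : M.det = 1 := by
    have ht : M.BlockTriangular id := fun i j hij => h0 i j hij
    rw [Matrix.det_of_isUpperTriangular ht]
    simp [h1]
  have hu : IsUnit M := (Matrix.isUnit_iff_isUnit_det M).2 (by rw [hdet]; exact isUnit_one)
  have : E = 1 := hu.mul_right_cancel (by rw [hE, one_mul])
  exact congrFun (congrFun this i) j

/-- The comultiplication of the entries is matrix multiplication, so convolution powers act on them
as matrix powers. -/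
theorem adams_matrix {N : ℕ} (M : Matrix (Fin N) (Fin N) A)
    (h1 : ∀ i, M i i = 1) (h0 : ∀ i j, j < i → M i j = 0)
    (hM : ∀ i j, Coalgebra.comul (R := B) (M i j) = ∑ k, M i k ⊗ₜ[B] M k j) (k : ℕ) :
    ∀ i j, adams (B := B) k (M i j) = (M ^ k) i j := by
  induction k with
  | zero =>
    intro i j
    rw [adams_zero_apply, counit_matrix_eq_one M h1 h0 hM, pow_zero]
  | succ k ih =>
    intro i j
    rw [adams_succ_apply, hM, map_sum, pow_succ', Matrix.mul_apply]
    exact Finset.sum_congr rfl fun l _ => by simp [ih]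

variable [CharZero B]

theorem polynomialAdams_eq_top (hU : IsProUnipotent B A) : polynomialAdams B A = ⊤ := by
  rw [eq_top_iff]
  intro a _
  obtain ⟨N, M, h1, h0, hM, ha⟩ := hU a
  refine Algebra.adjoin_le ?_ ha
  rintro _ ⟨i, j, rfl⟩
  obtain ⟨p, hp⟩ := exists_polynomial_pow_eq_eval B M (sub_one_pow_eq_zero_of_unitriangular M h1 h0) i j
  exact ⟨p, fun k => by rw [adams_matrix M h1 h0 hM, hp]⟩

theorem exists_adams_eq_eval (hU : IsProUnipotent B A) (a : A) :
    ∃ p : Polynomial A, ∀ k : ℕ, adams (B := B) k a = p.eval (k : A) := by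
  have : a ∈ polynomialAdams B A := by
    rw [polynomialAdams_eq_top hU]
    trivial
  exact this

/-- The interpolation of the convolution powers of the identity of a pro-unipotent group. -/
def adamsPoly (hU : IsProUnipotent B A) : A →ₐ[B] Polynomial A :=
  -- Each `adams k` is an algebra homomorphism, and an interpolating polynomial is unique; together
  -- these make the choice multiplicative and linear.
  have h : ∀ (a : A) (q : Polynomial A), (∀ k : ℕ, adams (B := B) k a = q.eval (k : A)) →
      (exists_adams_eq_eval hU a).choose = q := fun a q hq =>
    polynomial_eq_of_eval_natCast B _ _ fun k => by
      rw [← (exists_adams_eq_eval hU a).choose_spec k, hq]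
  have s := fun a => (exists_adams_eq_eval hU a).choose_spec
  { toFun := fun a => (exists_adams_eq_eval hU a).choose
    map_one' := h _ _ fun k => by simp
    map_mul' := fun a b => h _ _ fun k => by rw [map_mul, s, s, Polynomial.eval_mul]
    map_zero' := h _ _ fun k => by simp
    map_add' := fun a b => h _ _ fun k => by rw [map_add, s, s, Polynomial.eval_add]
    commutes' := fun r => h _ _ fun k => by simp [Polynomial.algebraMap_apply] }

theorem eval_adamsPoly (hU : IsProUnipotent B A) (a : A) (k : ℕ) :
    (adamsPoly hU a).eval (k : A) = adams (B := B) k a :=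
  ((exists_adams_eq_eval hU a).choose_spec k).symm

theorem coeff_zero_adamsPoly (hU : IsProUnipotent B A) (a : A) :
    (adamsPoly hU a).coeff 0 = algebraMap B A (Coalgebra.counit (R := B) a) := by
  rw [Polynomial.coeff_zero_eq_eval_zero, ← adams_zero_apply, ← eval_adamsPoly hU, Nat.cast_zero]

/-- The convolution logarithm of the identity. -/
def eulerian (hU : IsProUnipotent B A) : A →ₗ[B] A :=
  (Polynomial.lcoeff A 1).restrictScalars B ∘ₗ (adamsPoly hU).toLinearMap

theorem eulerian_apply (hU : IsProUnipotent B A) (a : A) :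
    eulerian hU a = (adamsPoly hU a).coeff 1 := rfl

/-- Read off from the linear coefficient of a product of polynomials whose constant terms are the
counits. The logarithm is thus a derivation at the identity: it kills products of two elements of
the augmentation ideal. -/
theorem eulerian_mul (hU : IsProUnipotent B A) (a b : A) :
    eulerian hU (a * b) = Coalgebra.counit (R := B) b • eulerian hU a +
      Coalgebra.counit (R := B) a • eulerian hU b := by
  rw [eulerian_apply, map_mul, Polynomial.mul_coeff_one, coeff_zero_adamsPoly,
    coeff_zero_adamsPoly, eulerian_apply, eulerian_apply, Algebra.smul_def, Algebra.smul_def]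
  ring

/-- Differentiate `adams (k + l) a` in `k` at `k = 0`. By the comultiplication this is a sum of
terms `eulerian x * adams l y` with `x` in `V`, hence zero for every `l`. The interpolating
polynomial is therefore constant, and its values at `1` and `0` are `a` and the counit. -/
theorem adams_eq_counit_of_eulerian_eq_zero (hU : IsProUnipotent B A) (V : Submodule B A)
    (hV : ∀ a ∈ V, eulerian hU a = 0) (a : A)
    (ha : Coalgebra.comul (R := B) a ∈ LinearMap.range (TensorProduct.mapIncl V V)) :
    a = algebraMap B A (Coalgebra.counit (R := B) a) := by
  have hder : Polynomial.derivative (adamsPoly hU a) = 0 := by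
    refine polynomial_eq_of_eval_natCast B _ _ fun l => ?_
    rw [← Polynomial.taylor_coeff_one, Polynomial.eval_zero]
    let Θ : A ⊗[B] A →ₐ[B] Polynomial A := Algebra.TensorProduct.lift (adamsPoly hU)
      ((Algebra.ofId A (Polynomial A)).restrictScalars B |>.comp (adams l))
      (fun _ _ => Commute.all _ _)
    have e : Polynomial.taylor (l : A) (adamsPoly hU a) = Θ (Coalgebra.comul (R := B) a) := by
      refine polynomial_eq_of_eval_natCast B _ _ fun k => ?_
      rw [Polynomial.taylor_eval, ← Nat.cast_add, eval_adamsPoly, adams_add_apply]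
      generalize Coalgebra.comul (R := B) a = t
      induction t with
      | zero => simp
      | tmul x y => simp [Θ, eval_adamsPoly, Algebra.ofId_apply]
      | add x y hx hy => simp only [map_add, hx, hy, Polynomial.eval_add]
    rw [e]
    obtain ⟨t, ht⟩ := ha
    rw [← ht]
    clear ht
    induction t with
    | zero => simp
    | tmul x y =>
      simp only [TensorProduct.mapIncl, TensorProduct.map_tmul, Submodule.subtype_apply, Θ,
        Algebra.TensorProduct.lift_tmul, AlgHom.comp_apply]
      change (adamsPoly hU x * Polynomial.C (adams l (y : A))).coeff 1 = 0
      rw [Polynomial.coeff_mul_C, ← eulerian_apply, hV x x.2, zero_mul]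
    | add x y hx hy => simp only [map_add, Polynomial.coeff_add, hx, hy, add_zero]
  have : Module ℚ A := Module.compHom A (algebraMap ℚ B)
  have : IsAddTorsionFree A := IsAddTorsionFree.of_module_rat A
  have h1 : adamsPoly hU a = Polynomial.C ((adamsPoly hU a).coeff 0) :=
    Polynomial.eq_C_of_derivative_eq_zero hder
  rw [← adams_zero_apply, ← eval_adamsPoly hU a 0]
  conv_lhs => rw [← adams_one_apply (B := B) a, ← eval_adamsPoly hU a 1]
  rw [h1, Polynomial.eval_C, Polynomial.eval_C]

end
end Adams

/-! ### Exponentials of derivations at the identity -/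

section Exponential

variable {B A C : Type*} [Field B] [CommRing A] [HopfAlgebra B A] [CommRing C] [Algebra B C]

noncomputable section

/-- The map `x ⊗ y ↦ f x * k y`. -/
def mulMap (f k : A →ₗ[B] C) : A ⊗[B] A →ₗ[B] C := LinearMap.mul' B C ∘ₗ TensorProduct.map f k

@[simp] theorem mulMap_tmul (f k : A →ₗ[B] C) (x y : A) :
    mulMap f k (x ⊗ₜ[B] y) = f x * k y := by
  simp [mulMap]

variable (B A C) in
/-- The counit, with values in an algebra. -/
def counitMap : A →ₗ[B] C := Algebra.linearMap B C ∘ₗ Coalgebra.counit (R := B)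

@[simp] theorem counitMap_apply (a : A) :
    counitMap B A C a = algebraMap B C (Coalgebra.counit (R := B) a) := rfl

theorem mulMap_counitMap_comul (f : A →ₗ[B] C) (a : A) :
    mulMap (counitMap B A C) f (Coalgebra.comul (R := B) a) = f a := by
  have h : mulMap (counitMap B A C) f = f ∘ₗ (TensorProduct.lid B A).toLinearMap ∘ₗ
      (Coalgebra.counit (R := B)).rTensor A := by
    ext x y
    simp [← Algebra.smul_def]
  rw [h]
  simp

theorem mulMap_comul_counitMap (f : A →ₗ[B] C) (a : A) :
    mulMap f (counitMap B A C) (Coalgebra.comul (R := B) a) = f a := by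
  have h : mulMap f (counitMap B A C) = f ∘ₗ (TensorProduct.rid B A).toLinearMap ∘ₗ
      (Coalgebra.counit (R := B)).lTensor A := by
    ext x y
    simp [← Algebra.smul_def, mul_comm _ (algebraMap B C _)]
  rw [h]
  simp

/-- The divided convolution powers `d ^ n / n!` of a linear map. -/
def divPow (d : A →ₗ[B] C) : ℕ → (A →ₗ[B] C)
  | 0 => counitMap B A C
  | n + 1 => ((n : B) + 1)⁻¹ • (mulMap d (divPow d n) ∘ₗ Coalgebra.comul (R := B))

theorem divPow_one_apply (d : A →ₗ[B] C) (a : A) : divPow d 1 a = d a := by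
  simp [divPow, mulMap_comul_counitMap]

/-- Integral power series are constant. After the constant term is removed, a nonzero integral
element would have a minimal polynomial with nonzero constant coefficient, whereas evaluation at `X
= 0` shows that this coefficient vanishes. -/
theorem coeff_one_eq_zero_of_isIntegral (f : PowerSeries B) (hf : IsIntegral B f) :
    PowerSeries.coeff 1 f = 0 := by
  let g := f - algebraMap B (PowerSeries B) (PowerSeries.constantCoeff f)
  have hg : IsIntegral B g := hf.sub isIntegral_algebraMap
  have hg0 : PowerSeries.constantCoeff g = 0 := by
    simp [g]
  have : g = 0 := by
    by_contra hne
    have h1 := minpoly.coeff_zero_ne_zero hg hne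
    have h2 := congrArg PowerSeries.constantCoeff (minpoly.aeval B g)
    apply h1
    rw [Polynomial.aeval_def, Polynomial.hom_eval₂, hg0, Polynomial.eval₂_at_zero] at h2
    simpa [PowerSeries.algebraMap_apply] using h2
  have h3 : f = PowerSeries.C (PowerSeries.constantCoeff f) := by
    rw [sub_eq_zero] at this
    simpa [PowerSeries.algebraMap_apply] using this
  rw [h3, PowerSeries.coeff_C]
  simp

variable [CharZero B]

theorem divPow_succ_apply (d : A →ₗ[B] C) (n : ℕ) (a : A) :
    divPow d (n + 1) a * ((n : C) + 1) = mulMap d (divPow d n) (Coalgebra.comul (R := B) a) := by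
  have h : ((n : B) + 1) ≠ 0 := by exact_mod_cast n.succ_ne_zero
  have e : ((n : C) + 1) = algebraMap B C ((n : B) + 1) := by simp
  rw [e, mul_comm, ← Algebra.smul_def, divPow, LinearMap.smul_apply, smul_smul,
    mul_inv_cancel₀ h, one_smul]
  rfl

/-- The series `F a = ∑ divPow d n a X ^ n` formally satisfies `F' = d * F` for the convolution
product. Since `d` is a derivation, `F (a * b)` and `F a * F b` satisfy the same recursion; the
Leibniz rule for `F a * F b` gives its form in each degree. -/
theorem divPow_mul (d : A →ₗ[B] C)
    (hd : ∀ a b : A, d (a * b) = counitMap B A C b * d a + counitMap B A C a * d b) (n : ℕ) :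
    ∀ a b : A, divPow d n (a * b) =
      ∑ p ∈ Finset.HasAntidiagonal.antidiagonal n, divPow d p.1 a * divPow d p.2 b := by
  induction n with
  | zero =>
    intro a b
    simp [divPow]
  | succ n ih =>
    intro a b
    have key : ∀ t s : A ⊗[B] A, mulMap d (divPow d n) (t * s) =
        ∑ p ∈ Finset.HasAntidiagonal.antidiagonal n,
          (mulMap d (divPow d p.1) t * mulMap (counitMap B A C) (divPow d p.2) s +
            mulMap (counitMap B A C) (divPow d p.1) t * mulMap d (divPow d p.2) s) := by
      intro t s
      induction t with
      | zero => simp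
      | add t t' ht ht' =>
        rw [add_mul, map_add, ht, ht', ← Finset.sum_add_distrib]
        refine Finset.sum_congr rfl fun p _ => ?_
        simp only [map_add]
        ring
      | tmul x y =>
        induction s with
        | zero => simp
        | add s s' hs hs' =>
          rw [mul_add, map_add, hs, hs', ← Finset.sum_add_distrib]
          refine Finset.sum_congr rfl fun p _ => ?_
          simp only [map_add]
          ring
        | tmul z w =>
          rw [Algebra.TensorProduct.tmul_mul_tmul, mulMap_tmul, hd, ih, Finset.mul_sum]
          refine Finset.sum_congr rfl fun p _ => ?_
          simp only [mulMap_tmul]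
          ring
    have hne : ((n : B) + 1) ≠ 0 := by exact_mod_cast n.succ_ne_zero
    have hu : IsUnit ((n : C) + 1) := by
      have : ((n : C) + 1) = algebraMap B C ((n : B) + 1) := by simp
      rw [this]
      exact (isUnit_iff_ne_zero.2 hne).map _
    refine hu.mul_right_cancel ?_
    rw [divPow_succ_apply, Bialgebra.comul_mul, key]
    simp only [mulMap_counitMap_comul, ← divPow_succ_apply]
    let F : A → PowerSeries C := fun a => PowerSeries.mk fun m => divPow d m a
    have h := congrArg (PowerSeries.coeff n)
      (Derivation.leibniz (PowerSeries.derivative C) (F a) (F b))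
    rw [PowerSeries.coeff_derivative, PowerSeries.coeff_mul, map_add, smul_eq_mul, smul_eq_mul,
      PowerSeries.coeff_mul, PowerSeries.coeff_mul] at h
    simp only [F, PowerSeries.coeff_mk, PowerSeries.coeff_derivative] at h
    rw [h, Finset.sum_add_distrib, add_comm]
    congr 1
    rw [← Finset.Nat.sum_antidiagonal_swap]
    refine Finset.sum_congr rfl fun p _ => ?_
    simp only [Prod.fst_swap, Prod.snd_swap]
    ring

/-- The exponential `a ↦ ∑ (d ^ n / n!) a X ^ n` of a derivation at the identity. -/
def expSeries (d : A →ₗ[B] C)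
    (hd : ∀ a b : A, d (a * b) = counitMap B A C b * d a + counitMap B A C a * d b) :
    A →ₐ[B] PowerSeries C :=
  have h1 : d 1 = 0 := by
    have := hd 1 1
    simpa using this
  AlgHom.ofLinearMap
    { toFun := fun a => PowerSeries.mk fun n => divPow d n a
      map_add' := fun a b => by ext; simp
      map_smul' := fun r a => by
        ext
        rw [PowerSeries.coeff_mk, map_smul, RingHom.id_apply, Algebra.smul_def, Algebra.smul_def,
          IsScalarTower.algebraMap_apply B C (PowerSeries C)]
        erw [PowerSeries.coeff_C_mul]
        simp }
    (by
      ext n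
      cases n with
      | zero => simp [divPow]
      | succ n =>
        simp [divPow, Bialgebra.comul_one, Algebra.TensorProduct.one_def, h1, PowerSeries.coeff_one])
    (fun a b => by
      ext n
      change PowerSeries.coeff n (PowerSeries.mk fun n => divPow d n (a * b)) = PowerSeries.coeff n
        ((PowerSeries.mk fun n => divPow d n a) * (PowerSeries.mk fun n => divPow d n b))
      rw [PowerSeries.coeff_mk, divPow_mul d hd, PowerSeries.coeff_mul]
      simp)

theorem coeff_expSeries (d : A →ₗ[B] C)
    (hd : ∀ a b : A, d (a * b) = counitMap B A C b * d a + counitMap B A C a * d b)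
    (n : ℕ) (a : A) : PowerSeries.coeff n (expSeries d hd a) = divPow d n a :=
  PowerSeries.coeff_mk (R := C) n fun n => divPow d n a

/-- A derivation at the identity with locally nilpotent convolution powers can be exponentiated. -/
theorem exists_algHom_eq_exp (d : A →ₗ[B] C)
    (hd : ∀ a b : A, d (a * b) = counitMap B A C b * d a + counitMap B A C a * d b)
    (hn : ∀ a : A, ∃ N : ℕ, ∀ n ≥ N, divPow d n a = 0) :
    ∃ v : A →ₐ[B] C, ∀ a : A, (∀ n ≥ 2, divPow d n a = 0) → v a = counitMap B A C a + d a := by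
  let i : Polynomial C →ₐ[B] PowerSeries C :=
    (Polynomial.coeToPowerSeries.algHom C : Polynomial C →ₐ[C] PowerSeries C).restrictScalars B
  have hi : ∀ p : Polynomial C, i p = (p : PowerSeries C) := fun p => by
    simp [i, Polynomial.coeToPowerSeries.algHom_apply]
  have hinj : Function.Injective i := fun p q h => by
    rw [hi, hi] at h
    exact Polynomial.coe_inj.1 h
  have hr : ∀ a, ∃ p : Polynomial C, i p = expSeries d hd a := by
    intro a
    obtain ⟨N, hN⟩ := hn a
    refine ⟨PowerSeries.trunc N (expSeries d hd a), ?_⟩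
    rw [hi]
    ext m
    rw [Polynomial.coeff_coe, PowerSeries.coeff_trunc]
    split_ifs with hm
    · rfl
    · rw [coeff_expSeries, hN m (by omega)]
  let q : A →ₐ[B] Polynomial C := (AlgEquiv.ofInjective i hinj).symm.toAlgHom.comp
    ((expSeries d hd).codRestrict i.range hr)
  have hq : ∀ a, i (q a) = expSeries d hd a := fun a =>
    congrArg Subtype.val ((AlgEquiv.ofInjective i hinj).apply_symm_apply
      ((expSeries d hd).codRestrict i.range hr a))
  -- Local nilpotence makes the exponential series polynomials, so `X = 1` can be substituted.
  refine ⟨((Polynomial.aeval (1 : C)).restrictScalars B).comp q, fun a ha => ?_⟩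
  have : q a = Polynomial.C (counitMap B A C a) + Polynomial.C (d a) * Polynomial.X := by
    apply hinj
    rw [hq, hi]
    ext m
    rw [coeff_expSeries, Polynomial.coeff_coe, Polynomial.coeff_add, Polynomial.coeff_C,
      Polynomial.coeff_C_mul_X]
    match m with
    | 0 => simp [divPow]
    | 1 => simp [divPow_one_apply]
    | m + 2 => simp [ha (m + 2) (by omega)]
  rw [AlgHom.comp_apply, this]
  simp

end
end Exponential

/-! ### The filtration is connected, and linear maps in degree `n` lift to points -/

section Filtration

theorem tensorFil_induction {T M N : Type*} [CommRing T] [AddCommGroup M] [Module T M]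
    [AddCommGroup N] [Module T N] {W : ℤ → Submodule T M} {V : ℤ → Submodule T N} {n : ℤ}
    {p : M ⊗[T] N → Prop} (h0 : p 0) (ha : ∀ s t, p s → p t → p (s + t))
    (ht : ∀ i : ℤ, ∀ x ∈ W i, ∀ y ∈ V (n - i), p (x ⊗ₜ[T] y)) {t : M ⊗[T] N}
    (h : t ∈ tensorFil T W V n) : p t := by
  refine Submodule.iSup_induction _ (motive := p) h ?_ h0 ha
  rintro i _ ⟨s, rfl⟩
  induction s with
  | zero => simpa using h0
  | add s t hs ht => simpa using ha _ _ hs ht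
  | tmul x y => exact ht i x x.2 y y.2

theorem tmul_mem_tensorFil {T M N : Type*} [CommRing T] [AddCommGroup M] [Module T M]
    [AddCommGroup N] [Module T N] {W : ℤ → Submodule T M} {V : ℤ → Submodule T N} {n i j : ℤ}
    (hij : i + j = n) {x : M} (hx : x ∈ W i) {y : N} (hy : y ∈ V j) :
    x ⊗ₜ[T] y ∈ tensorFil T W V n := by
  obtain rfl : j = n - i := by omega
  exact Submodule.mem_iSup_of_mem i ⟨(⟨x, hx⟩ : W i) ⊗ₜ[T] (⟨y, hy⟩ : V (n - i)), rfl⟩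

variable {G B A C : Type*} [Group G] [TopologicalSpace G]
  [Field B] [TopologicalSpace B] [MulSemiringAction G B] [CommRing A] [HopfAlgebra B A]
  [MulSemiringAction G A] [SMulDistribClass G B A] [CommRing C] [Algebra B C]
  {W : ℤ → Submodule B A}

theorem adams_mem (hA : IsFilteredHopf G W) (k : ℕ) :
    ∀ (n : ℤ), ∀ a ∈ W n, adams (B := B) k a ∈ W n := by
  induction k with
  | zero =>
    intro n a ha
    rcases lt_or_ge n 0 with hn | hn
    · rw [hA.rep.eq_bot_of_neg n hn, Submodule.mem_bot] at ha
      simp [ha]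
    · rw [adams_zero_apply, Algebra.algebraMap_eq_smul_one]
      exact Submodule.smul_mem _ _ (hA.rep.mono hn hA.alg.one_mem)
  | succ k ih =>
    intro n a ha
    rw [adams_succ_apply]
    refine tensorFil_induction (p := fun t => Algebra.TensorProduct.lift (AlgHom.id B A)
      (adams (B := B) k) (fun _ _ => Commute.all _ _) t ∈ W n) (by simp)
      (fun s t hs ht => by simpa using Submodule.add_mem _ hs ht) ?_ (hA.comul_mem n a ha)
    intro i x hx y hy
    have := hA.alg.mul_mem i (n - i) x hx _ (ih _ y hy)
    simpa using this

variable [CharZero B]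

/-- `W 0` is a finite-dimensional subalgebra, so its elements are integral over `B`. The exponential
of any functional composed with `eulerian` is an algebra homomorphism to power series, and integral
series have no linear term. -/
theorem eulerian_eq_zero_of_mem_zero (hA : IsFilteredHopf G W) (hU : IsProUnipotent B A)
    (a : A) (ha : a ∈ W 0) : eulerian hU a = 0 := by
  rw [← Module.forall_dual_apply_eq_zero_iff B]
  intro φ
  let d : A →ₗ[B] B := φ ∘ₗ eulerian hU
  have hd : ∀ a b : A, d (a * b) = counitMap B A B b * d a + counitMap B A B a * d b := by
    intro a b
    simp [d, eulerian_mul]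
  let V : Subalgebra B A := (W 0).toSubalgebra hA.alg.one_mem
    (fun x y hx hy => by simpa using hA.alg.mul_mem 0 0 x hx y hy)
  have hint : IsIntegral B a := IsIntegral.of_mem_of_fg V (by simpa [V] using hA.rep.fg 0) a ha
  have := coeff_one_eq_zero_of_isIntegral _ (hint.map (expSeries d hd))
  rwa [coeff_expSeries, divPow_one_apply] at this

/-- The filtration of a filtered pro-unipotent group in characteristic zero is connected. -/
theorem eq_counit_of_mem_nonpos (hA : IsFilteredHopf G W) (hU : IsProUnipotent B A) {i : ℤ}
    (hi : i ≤ 0) {a : A} (ha : a ∈ W i) :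
    a = algebraMap B A (Coalgebra.counit (R := B) a) := by
  have ha0 := hA.rep.mono hi ha
  refine adams_eq_counit_of_eulerian_eq_zero hU (W 0)
    (fun a ha => eulerian_eq_zero_of_mem_zero hA hU a ha) a ?_
  -- As `W` vanishes in negative degrees, only `W 0 ⊗ W 0` contributes to degree `0`, so the
  -- comultiplication stays in it.
  refine tensorFil_induction (p := fun t => t ∈ LinearMap.range
    (TensorProduct.mapIncl (W 0) (W 0))) (Submodule.zero_mem _)
    (fun s t hs ht => Submodule.add_mem _ hs ht) ?_ (hA.comul_mem 0 a ha0)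
  intro i x hx y hy
  rcases lt_trichotomy i 0 with h | rfl | h
  · rw [hA.rep.eq_bot_of_neg i h, Submodule.mem_bot] at hx
    simp [hx]
  · exact ⟨(⟨x, hx⟩ : W 0) ⊗ₜ[B] (⟨y, by simpa using hy⟩ : W 0), rfl⟩
  · rw [hA.rep.eq_bot_of_neg _ (by omega), Submodule.mem_bot] at hy
    simp [hy]

/-- A linear map that vanishes on `W (n - 1)` and on the products of elements of lower positive
degrees agrees on `W n` with a point of the group, up to the counit. -/
theorem exists_algHom_eq_counit_add (hA : IsFilteredHopf G W) (hU : IsProUnipotent B A) {n : ℤ}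
    (hn : 1 ≤ n) (d : A →ₗ[B] C) (h1 : ∀ a ∈ W (n - 1), d a = 0)
    (h2 : ∀ i : ℤ, 0 < i → i < n → ∀ a ∈ W i, ∀ b ∈ W (n - i), d (a * b) = 0) :
    ∃ v : A →ₐ[B] C, ∀ a ∈ W n, v a = counitMap B A C a + d a := by
  have hd1 : d 1 = 0 := h1 1 (hA.rep.mono (by omega) hA.alg.one_mem)
  -- Modulo what `d` kills, every element of `W n` is primitive: terms of intermediate degree
  -- multiply into decomposables, and the extreme terms have one factor in `W 0 = B`.
  have hadams : ∀ k : ℕ, ∀ a ∈ W n, d (adams (B := B) k a) = 0 + (k : B) • d a := by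
    intro k
    induction k with
    | zero =>
      intro a _
      rw [adams_zero_apply, Algebra.algebraMap_eq_smul_one, map_smul, hd1]
      simp
    | succ k ih =>
      intro a ha
      have e : d (adams (B := B) (k + 1) a) =
          mulMap d (counitMap B A C) (Coalgebra.comul (R := B) a) +
          mulMap (counitMap B A C) (d ∘ₗ (adams (B := B) k).toLinearMap)
            (Coalgebra.comul (R := B) a) := by
        rw [adams_succ_apply]
        refine tensorFil_induction (p := fun t => d (Algebra.TensorProduct.lift (AlgHom.id B A)
          (adams (B := B) k) (fun _ _ => Commute.all _ _) t) = mulMap d (counitMap B A C) t +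
          mulMap (counitMap B A C) (d ∘ₗ (adams (B := B) k).toLinearMap) t) (by simp)
          (fun s t hs ht => by simp only [map_add, hs, ht]; abel) ?_ (hA.comul_mem n a ha)
        intro i x hx y hy
        simp only [Algebra.TensorProduct.lift_tmul, AlgHom.id_apply, mulMap_tmul,
          LinearMap.comp_apply, AlgHom.toLinearMap_apply]
        rcases le_or_gt i 0 with hi | hi
        · have hx' := eq_counit_of_mem_nonpos hA hU hi hx
          have hdx : d x = 0 := by
            rw [hx', Algebra.algebraMap_eq_smul_one, map_smul, hd1, smul_zero]
          rw [hdx, zero_mul, zero_add]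
          conv_lhs => rw [hx', ← Algebra.smul_def, map_smul]
          rw [counitMap_apply, Algebra.smul_def]
        · rcases lt_or_ge i n with hin | hin
          · rw [h2 i hi hin x hx _ (adams_mem hA k _ y hy), h1 x (hA.rep.mono (by omega) hx),
              h1 _ (hA.rep.mono (by omega) (adams_mem hA k _ y hy))]
            simp
          · have hy' := eq_counit_of_mem_nonpos hA hU (by omega) hy
            have hay : adams (B := B) k y = algebraMap B A (Coalgebra.counit (R := B) y) := by
              conv_lhs => rw [hy']
              simp
            rw [hay, Algebra.algebraMap_eq_smul_one, map_smul, hd1, smul_zero, mul_zero, add_zero,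
              mul_smul_comm, mul_one, map_smul, counitMap_apply, Algebra.smul_def, mul_comm]
      rw [e, mulMap_comul_counitMap, mulMap_counitMap_comul, LinearMap.comp_apply,
        AlgHom.toLinearMap_apply, ih a ha]
      push_cast
      rw [add_smul, one_smul]
      abel
  -- Precomposing with the logarithm makes `d` a derivation on all of `A` without changing it on `W
  -- n`: there `d (adams k a)` is linear in `k` with slope `d a`.
  let D : A →ₗ[B] C := d ∘ₗ eulerian hU
  have hDn : ∀ a ∈ W n, D a = d a := by
    intro a ha
    refine apply_coeff_one_of_eval_natCast (adamsPoly hU a) d 0 (d a) fun k => ?_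
    rw [eval_adamsPoly, hadams k a ha]
  have hD0 : ∀ a ∈ W (n - 1), D a = 0 := fun a ha => by
    rw [hDn a (hA.rep.mono (by omega) ha), h1 a ha]
  have hDder : ∀ a b : A, D (a * b) = counitMap B A C b * D a + counitMap B A C a * D b := by
    intro a b
    simp only [D, LinearMap.comp_apply, eulerian_mul, map_add, map_smul]
    simp only [counitMap_apply, Algebra.smul_def]
  have hvan : ∀ (m : ℕ) (j : ℤ), ∀ a ∈ W j,
      (∀ i : ℤ, ∀ x ∈ W i, ∀ y ∈ W (j - i), D x * divPow D m y = 0) → divPow D (m + 1) a = 0 := by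
    intro m j a ha h
    have : mulMap D (divPow D m) (Coalgebra.comul (R := B) a) = 0 :=
      tensorFil_induction (p := fun t => mulMap D (divPow D m) t = 0) (by simp)
        (fun s t hs ht => by rw [map_add, hs, ht, add_zero])
        (fun i x hx y hy => by rw [mulMap_tmul, h i x hx y hy]) (hA.comul_mem j a ha)
    rw [divPow, LinearMap.smul_apply, LinearMap.comp_apply, this, smul_zero]
  -- Each factor `D` kills `W 0` and so uses up at least one degree.
  have hnil : ∀ (m : ℕ) (j : ℤ), j < m → ∀ a ∈ W j, divPow D m a = 0 := by
    intro m
    induction m with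
    | zero =>
      intro j hj a ha
      rw [hA.rep.eq_bot_of_neg j (by simpa using hj), Submodule.mem_bot] at ha
      simp [ha]
    | succ m ih =>
      intro j hj a ha
      refine hvan m j a ha fun i x hx y hy => ?_
      rcases le_or_gt i 0 with hi | hi
      · rw [hD0 x (hA.rep.mono (by omega) hx), zero_mul]
      · rw [ih (j - i) (by push_cast at hj; omega) y hy, mul_zero]
  obtain ⟨v, hv⟩ := exists_algHom_eq_exp D hDder (fun a => by
    obtain ⟨j, hj⟩ := hA.rep.exhaustive a
    exact ⟨j.toNat + 1, fun m hm => hnil m j (by omega) a hj⟩)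
  have hlow : ∀ m : ℕ, ∀ a ∈ W (n - 1), divPow D (m + 1) a = 0 := by
    intro m a ha
    refine hvan m _ a ha fun i x hx y hy => ?_
    rcases lt_or_ge i n with hi | hi
    · rw [hD0 x (hA.rep.mono (by omega) hx), zero_mul]
    · rw [hA.rep.eq_bot_of_neg _ (by omega), Submodule.mem_bot] at hy
      simp [hy]
  refine ⟨v, fun a ha => ?_⟩
  rw [hv a, hDn a ha]
  intro m hm
  obtain ⟨m, rfl⟩ : ∃ k, m = k + 2 := ⟨m - 2, by omega⟩
  -- On `W n` the exponential stops after its linear term: one factor `D` already needs degree `n`,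
  -- which leaves the other factors an element of `W 0`, killed by `hlow`.
  refine hvan (m + 1) n a ha fun i x hx y hy => ?_
  rcases lt_or_ge i n with hi | hi
  · rw [hD0 x (hA.rep.mono (by omega) hx), zero_mul]
  · rw [hlow m y (hA.rep.mono (by omega) hy), mul_zero]

end Filtration

/-! ### Functoriality of points, and the simply transitive action on points of a torsor -/

section MapPoints

variable {B A : Type*} [Field B] [CommRing A] [HopfAlgebra B A]

noncomputable section

theorem convMul_ofConv_apply {C : Type*} [CommRing C] [Algebra B C] (y z : Pts B A C) (a : A) :
    (y * z).ofConv a = Algebra.TensorProduct.lift y.ofConv z.ofConv (fun _ _ => Commute.all _ _)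
      (Coalgebra.comul (R := B) a) :=
  AlgHom.convMul_apply y z a

/-- Functoriality of the points of the group. -/
def mapPt {C D : Type*} [CommRing C] [Algebra B C] [CommRing D] [Algebra B D] (f : C →ₐ[B] D) :
    Pts B A C →* Pts B A D where
  toFun y := WithConv.toConv (f.comp y.ofConv)
  map_one' := by
    apply WithConv.ofConv_injective
    ext a
    exact f.commutes _
  map_mul' y z := by
    apply WithConv.ofConv_injective
    ext a
    change f ((y * z).ofConv a) = _
    rw [convMul_ofConv_apply, convMul_ofConv_apply]
    generalize Coalgebra.comul (R := B) a = t
    induction t with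
    | zero => simp
    | tmul x y => simp
    | add x y hx hy => simp only [map_add, hx, hy]

@[simp] theorem mapPt_apply {C D : Type*} [CommRing C] [Algebra B C] [CommRing D] [Algebra B D]
    (f : C →ₐ[B] D) (y : Pts B A C) (a : A) : (mapPt f y).ofConv a = f (y.ofConv a) := rfl

end
end MapPoints

section Points

variable {G : Type v} {B A : Type u} [Group G] [TopologicalSpace G]
  [Field B] [TopologicalSpace B] [MulSemiringAction G B] [CommRing A] [HopfAlgebra B A]
  [MulSemiringAction G A] [SMulDistribClass G B A]
  {S : Type u} [CommRing S] [Algebra B S] [MulSemiringAction G S]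
  {W : ℤ → Submodule B A}

noncomputable section

namespace Torsor

variable (P : Torsor G S W)

/-- The isomorphism `P ⊗ P ≃ P ⊗ A`. -/
def canEquiv : P.carrier ⊗[S] P.carrier ≃ₐ[S] P.carrier ⊗[B] A :=
  AlgEquiv.ofBijective (canMap P.coact) P.can_bijective

theorem canEquiv_apply (t : P.carrier ⊗[S] P.carrier) : P.canEquiv t = canMap P.coact t := rfl

@[simp] theorem canEquiv_tmul (p q : P.carrier) :
    P.canEquiv (p ⊗ₜ q) = (p ⊗ₜ[B] (1 : A)) * P.coact q := by
  simp [canEquiv_apply, canMap]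

theorem canEquiv_symm_tmul_one (p : P.carrier) : P.canEquiv.symm (p ⊗ₜ[B] (1 : A)) = p ⊗ₜ 1 := by
  rw [AlgEquiv.symm_apply_eq]
  simp

theorem canEquiv_symm_coact (p : P.carrier) : P.canEquiv.symm (P.coact p) = 1 ⊗ₜ p := by
  rw [AlgEquiv.symm_apply_eq]
  simp [← Algebra.TensorProduct.one_def]

variable {P} {C : Type*} [CommRing C] [Algebra S C] [Algebra B C] [IsScalarTower B S C]

/-- The action of points of the group on points of a torsor with values in an `S`-algebra. -/
def act (x : P.carrier →ₐ[S] C) (y : Pts B A C) : P.carrier →ₐ[S] C :=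
  (Algebra.TensorProduct.lift x y.ofConv (fun _ _ => Commute.all _ _)).comp P.coact

theorem act_apply (x : P.carrier →ₐ[S] C) (y : Pts B A C) (p : P.carrier) : act x y p =
    Algebra.TensorProduct.lift x y.ofConv (fun _ _ => Commute.all _ _) (P.coact p) := rfl

theorem act_one (x : P.carrier →ₐ[S] C) : act x (1 : Pts B A C) = x := by
  ext p
  conv_rhs => rw [← P.coact_counit p]
  rw [act_apply]
  generalize P.coact p = t
  induction t with
  | zero => simp
  | tmul q a =>
    have : (1 : Pts B A C).ofConv a = algebraMap B C (Coalgebra.counit (R := B) a) := rfl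
    rw [Algebra.TensorProduct.lift_tmul, this, LinearMap.lTensor_tmul, TensorProduct.rid_tmul,
      ← IsScalarTower.algebraMap_smul S, map_smul, IsScalarTower.algebraMap_smul S,
      Algebra.smul_def, mul_comm]
  | add x y hx hy => simp only [map_add, hx, hy]

theorem act_act (x : P.carrier →ₐ[S] C) (y z : Pts B A C) :
    act (act x y) z = act x (y * z) := by
  ext p
  let M : P.carrier ⊗[B] (A ⊗[B] A) →ₐ[S] C :=
    Algebra.TensorProduct.lift x (Algebra.TensorProduct.lift y.ofConv z.ofConv
      (fun _ _ => Commute.all _ _)) (fun _ _ => Commute.all _ _)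
  have h1 : ∀ t : P.carrier ⊗[B] A, Algebra.TensorProduct.lift (act x y) z.ofConv
      (fun _ _ => Commute.all _ _) t = M (TensorProduct.assoc B P.carrier A A
        ((P.coact.restrictScalars B).toLinearMap.rTensor A t)) := by
    intro t
    induction t with
    | zero => simp
    | add s t hs ht => simp only [map_add, hs, ht]
    | tmul q a =>
      simp only [Algebra.TensorProduct.lift_tmul, act_apply, LinearMap.rTensor_tmul,
        AlgHom.toLinearMap_apply, AlgHom.restrictScalars_apply]
      generalize P.coact q = s
      induction s with
      | zero => simp
      | add s t hs ht => simp only [map_add, add_mul, TensorProduct.add_tmul, hs, ht]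
      | tmul r b => simp [M, mul_assoc]
  have h2 : ∀ t : P.carrier ⊗[B] A, Algebra.TensorProduct.lift x (y * z).ofConv
      (fun _ _ => Commute.all _ _) t =
        M ((Coalgebra.comul (R := B) (A := A)).lTensor P.carrier t) := by
    intro t
    induction t with
    | zero => simp
    | add s t hs ht => simp only [map_add, hs, ht]
    | tmul q a => simp [M, convMul_ofConv_apply]
  rw [act_apply, act_apply, h1, h2, P.coact_coassoc]

/-- The point of the group that carries one point of a torsor to another one. -/
def diff (x y : P.carrier →ₐ[S] C) : Pts B A C :=
  WithConv.toConv ((((Algebra.TensorProduct.lift x y (fun _ _ => Commute.all _ _)).comp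
    P.canEquiv.symm.toAlgHom).restrictScalars B).comp Algebra.TensorProduct.includeRight)

theorem diff_apply (x y : P.carrier →ₐ[S] C) (a : A) : (diff x y).ofConv a =
    Algebra.TensorProduct.lift x y (fun _ _ => Commute.all _ _)
      (P.canEquiv.symm (1 ⊗ₜ[B] a)) := rfl

/-- Precomposition with the canonical isomorphism turns pairs `(x, u)` into pairs `(x, x u)`; `diff`
inverts this. Checking it on all of `P ⊗ A` is what makes `act_diff` immediate. -/
theorem lift_diff (x y : P.carrier →ₐ[S] C) (t : P.carrier ⊗[B] A) :
    Algebra.TensorProduct.lift x (diff x y).ofConv (fun _ _ => Commute.all _ _) t =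
      Algebra.TensorProduct.lift x y (fun _ _ => Commute.all _ _) (P.canEquiv.symm t) := by
  induction t with
  | zero => simp
  | add s t hs ht => simp only [map_add, hs, ht]
  | tmul p a =>
    have e : p ⊗ₜ[B] a = (p ⊗ₜ[B] (1 : A)) * (1 ⊗ₜ[B] a) := by simp
    rw [Algebra.TensorProduct.lift_tmul, diff_apply, e, map_mul, map_mul, canEquiv_symm_tmul_one,
      Algebra.TensorProduct.lift_tmul, map_one, mul_one]

@[simp] theorem act_diff (x y : P.carrier →ₐ[S] C) : act x (diff x y) = y := by
  ext p
  rw [act_apply, lift_diff, canEquiv_symm_coact, Algebra.TensorProduct.lift_tmul, map_one, one_mul]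

@[simp] theorem diff_act (x : P.carrier →ₐ[S] C) (y : Pts B A C) : diff x (act x y) = y := by
  apply WithConv.ofConv_injective
  ext a
  have h : ∀ t : P.carrier ⊗[S] P.carrier,
      Algebra.TensorProduct.lift x (act x y) (fun _ _ => Commute.all _ _) t =
      Algebra.TensorProduct.lift x y.ofConv (fun _ _ => Commute.all _ _) (P.canEquiv t) := by
    intro t
    induction t with
    | zero => simp
    | add s t hs ht => simp only [map_add, hs, ht]
    | tmul p q => simp [act_apply]
  rw [diff_apply, h, AlgEquiv.apply_symm_apply]
  simp

theorem act_injective (x : P.carrier →ₐ[S] C) :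
    Function.Injective (act x : Pts B A C → P.carrier →ₐ[S] C) := fun y z h => by
  rw [← diff_act x y, h, diff_act]

theorem comp_act {D : Type*} [CommRing D] [Algebra S D] [Algebra B D] [IsScalarTower B S D]
    (f : C →ₐ[S] D) (x : P.carrier →ₐ[S] C) (y : Pts B A C) :
    f.comp (act x y) = act (f.comp x) (mapPt (f.restrictScalars B) y) := by
  ext p
  rw [AlgHom.comp_apply, act_apply, act_apply]
  generalize P.coact p = t
  induction t with
  | zero => simp
  | add s t hs ht => simp only [map_add, hs, ht]
  | tmul p q => simp

theorem mapPt_diff {D : Type*} [CommRing D] [Algebra S D] [Algebra B D] [IsScalarTower B S D]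
    (f : C →ₐ[S] D) (x y : P.carrier →ₐ[S] C) :
    mapPt (f.restrictScalars B) (diff x y) = diff (f.comp x) (f.comp y) := by
  apply act_injective (f.comp x)
  rw [act_diff, ← comp_act, act_diff]

variable [SMulDistribClass G B S]

theorem conj_act (g : G) (x : P.carrier →ₐ[S] S) (y : Pts B A S) :
    conj g (act x y) = act (conj g x) (gact g y) := by
  ext p
  change g • act x y (g⁻¹ • p) = _
  rw [act_apply, act_apply, P.coact_smul]
  generalize P.coact p = t
  induction t with
  | zero => simp
  | add s t hs ht => simp only [map_add, smul_add, hs, ht]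
  | tmul p q => simp [smul_mul', conj, gact]

theorem conj_mul {X Y : Type*} [CommRing X] [CommRing Y] [Algebra S X] [Algebra S Y]
    [MulSemiringAction G X] [MulSemiringAction G Y] [SMulDistribClass G S X]
    [SMulDistribClass G S Y] (g h : G) (x : X →ₐ[S] Y) :
    conj (g * h) x = conj g (conj h x) := by
  ext p
  simp [conj, mul_smul]

variable [IsTopologicalGroup G] [CompactSpace G] [IsTopologicalRing B] [T2Space B]
  [ContinuousSMul G B]

theorem isFinCont_smul (p : P.carrier) : IsFinCont B (fun g : G => g • p) := by
  refine isFinCont_of_continuous ?_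
  let _ : TopologicalSpace P.carrier := finTopology B P.carrier
  exact P.rep.continuous_smul.comp (continuous_id.prodMk continuous_const)

/-- The cocycle of a torsor with a chosen point. -/
def cocycle (hS : ∀ s : S, IsFinCont B (fun g : G => g • s)) (x : P.carrier →ₐ[S] S) :
    Cocycle G B A S where
  toFun g := diff x (conj g x)
  continuous_toFun := by
    rw [continuous_pts_iff]
    intro a
    simp only [diff_apply]
    generalize P.canEquiv.symm (1 ⊗ₜ[B] a) = t
    induction t with
    | zero => simpa using IsFinCont.zero
    | add s t hs ht => simpa only [map_add] using hs.add ht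
    | tmul p q =>
      simp only [Algebra.TensorProduct.lift_tmul]
      refine (IsFinCont.const (x p)).mul (IsFinCont.smul_action hS ?_)
      exact ((isFinCont_smul q).comp continuous_inv).map (x.restrictScalars B).toLinearMap
  -- Both sides move `x` to `(g h) x = g (x · c h) = (g x) · g (c h)`, and the action on points is
  -- free.
  map_mul g h := by
    apply act_injective x
    rw [← act_act, act_diff, act_diff, conj_mul]
    conv_lhs => rw [← act_diff x (conj h x), conj_act]

theorem act_cocycle (hS : ∀ s : S, IsFinCont B (fun g : G => g • s)) (x : P.carrier →ₐ[S] S)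
    (g : G) : act x ((cocycle hS x).toFun g) = conj g x :=
  act_diff _ _

end Torsor
end
end Points

/-! ### Submodules of tensor products and descent of flatness -/

section TensorSubmodules

variable {R : Type*} [CommRing R]

/-- The image of `M ⊗ V` in `M ⊗ N` for a submodule `V` of `N`. -/
def lTensorRange (M : Type*) [AddCommGroup M] [Module R M] {N : Type*} [AddCommGroup N] [Module R N]
    (V : Submodule R N) : Submodule R (M ⊗[R] N) :=
  LinearMap.range (V.subtype.lTensor M)

variable {M N : Type*} [AddCommGroup M] [Module R M] [AddCommGroup N] [Module R N]

theorem tmul_mem_lTensorRange {V : Submodule R N} (m : M) {x : N} (hx : x ∈ V) :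
    m ⊗ₜ x ∈ lTensorRange M V :=
  ⟨m ⊗ₜ ⟨x, hx⟩, rfl⟩

theorem lTensorRange_induction {V : Submodule R N} {p : M ⊗[R] N → Prop} (h0 : p 0)
    (ha : ∀ s t, p s → p t → p (s + t)) (ht : ∀ m : M, ∀ x ∈ V, p (m ⊗ₜ x)) {t : M ⊗[R] N}
    (h : t ∈ lTensorRange M V) : p t := by
  obtain ⟨s, rfl⟩ := h
  induction s with
  | zero => simpa using h0
  | add s t hs ht => simpa using ha _ _ hs ht
  | tmul m x => exact ht m x x.2

theorem lTensorRange_mono {V V' : Submodule R N} (h : V ≤ V') :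
    lTensorRange M V ≤ lTensorRange M V' := fun _ ht =>
  lTensorRange_induction (Submodule.zero_mem _) (fun _ _ => Submodule.add_mem _)
    (fun m _ hx => tmul_mem_lTensorRange m (h hx)) ht

theorem mul_mem_lTensorRange {M N : Type*} [CommRing M] [Algebra R M] [CommRing N] [Algebra R N]
    {V V' : Submodule R N} {s t : M ⊗[R] N} (hs : s ∈ lTensorRange M V)
    (ht : t ∈ lTensorRange M V') : s * t ∈ lTensorRange M (V * V') := by
  refine lTensorRange_induction (p := fun s => s * t ∈ lTensorRange M (V * V'))
    (by simp) (fun s s' h h' => by rw [add_mul]; exact Submodule.add_mem _ h h') ?_ hs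
  intro m x hx
  refine lTensorRange_induction (p := fun t => m ⊗ₜ x * t ∈ lTensorRange M (V * V'))
    (by simp) (fun s s' h h' => by rw [mul_add]; exact Submodule.add_mem _ h h') ?_ ht
  intro m' x' hx'
  rw [Algebra.TensorProduct.tmul_mul_tmul]
  exact tmul_mem_lTensorRange _ (Submodule.mul_mem_mul hx hx')

/-- Flatness of `M` makes `M ⊗ U → M ⊗ N` injective, so membership in the image of `V` can be tested
in `M ⊗ N`. -/
theorem mem_range_lTensor_comap_iff [Module.Flat R M] {V U : Submodule R N} (h : V ≤ U)
    (t : M ⊗[R] U) : t ∈ LinearMap.range ((V.comap U.subtype).subtype.lTensor M) ↔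
      U.subtype.lTensor M t ∈ lTensorRange M V := by
  constructor
  · rintro ⟨s, rfl⟩
    let e : V.comap U.subtype →ₗ[R] V := U.subtype.restrict fun x hx => hx
    refine ⟨e.lTensor M s, ?_⟩
    rw [← LinearMap.comp_apply, ← LinearMap.comp_apply, ← LinearMap.lTensor_comp,
      ← LinearMap.lTensor_comp]
    rfl
  · rintro ⟨s, hs⟩
    let e : V →ₗ[R] V.comap U.subtype :=
      (Submodule.inclusion h).codRestrict (V.comap U.subtype) fun x => x.2
    refine ⟨e.lTensor M s, ?_⟩
    apply Module.Flat.lTensor_preserves_injective_linearMap (M := M) U.subtype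
      U.subtype_injective
    rw [← hs, ← LinearMap.comp_apply, ← LinearMap.comp_apply, ← LinearMap.lTensor_comp,
      ← LinearMap.lTensor_comp]
    rfl

theorem lTensor_mkQ_eq_zero_iff (V : Submodule R N) (t : M ⊗[R] N) :
    V.mkQ.lTensor M t = 0 ↔ t ∈ LinearMap.range (V.subtype.lTensor M) := by
  rw [← LinearMap.mem_ker, lTensor_mkQ]

/-- Injectivity of `Q ⊗ f` can be tested after tensoring with the faithfully flat `M`, where it
becomes injectivity of `(M ⊗ Q) ⊗ f`. -/
theorem flat_of_flat_tensorProduct (M : Type*) [AddCommGroup M] [Module R M]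
    [Module.FaithfullyFlat R M] (Q : Type*) [AddCommGroup Q] [Module R Q]
    (h : Module.Flat R (M ⊗[R] Q)) : Module.Flat R Q := by
  rw [Module.Flat.iff_lTensor_preserves_injective_linearMap]
  intro N N' _ _ _ _ f hf
  rw [← Module.FaithfullyFlat.lTensor_injective_iff_injective R M]
  have h1 := Module.Flat.lTensor_preserves_injective_linearMap (M := M ⊗[R] Q) f hf
  have e : (f.lTensor Q).lTensor M = (TensorProduct.assoc R M Q N').toLinearMap ∘ₗ
      f.lTensor (M ⊗[R] Q) ∘ₗ (TensorProduct.assoc R M Q N).symm.toLinearMap := by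
    ext; simp
  rw [e]
  simpa using h1

end TensorSubmodules

/-! ### Transport of submodules and linear maps between a torsor and the Hopf algebra -/

section Existence

variable {G : Type v} {B A : Type u} [Group G] [TopologicalSpace G]
  [Field B] [TopologicalSpace B] [MulSemiringAction G B] [CommRing A] [HopfAlgebra B A]
  [MulSemiringAction G A] [SMulDistribClass G B A]
  {S : Type u} [CommRing S] [Algebra B S] [MulSemiringAction G S]
  {W : ℤ → Submodule B A}

noncomputable section

namespace Torsor

variable (P : Torsor G S W)

instance : Module.FaithfullyFlat S P.carrier := P.faithfullyFlat

/-- The canonical isomorphism as a linear map over the torsor. -/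
def canLinearEquiv : P.carrier ⊗[S] P.carrier ≃ₗ[P.carrier] P.carrier ⊗[B] A :=
  { P.canEquiv.toRingEquiv.toAddEquiv with
    map_smul' := fun p t => by
      change P.canEquiv (p • t) = p • P.canEquiv t
      rw [← one_smul P.carrier (P.canEquiv t), smul_smul, mul_one, Algebra.smul_def,
        Algebra.smul_def, map_mul]
      congr 1
      change P.canEquiv (p ⊗ₜ 1) = p ⊗ₜ 1
      simp }

/-- A submodule `V` of the torsor corresponds to a subspace `U` of the Hopf algebra if
`P ⊗ V` corresponds to `P ⊗ U` under the canonical isomorphism. -/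
structure Corresponds (V : Submodule S P.carrier) (U : Submodule B A) : Prop where
  coact_mem : ∀ q ∈ V, P.coact q ∈ lTensorRange P.carrier U
  symm_mem : ∀ a ∈ U, P.canEquiv.symm (1 ⊗ₜ a) ∈ lTensorRange P.carrier V

namespace Corresponds

variable {P} {V V' : Submodule S P.carrier} {U U' : Submodule B A}

theorem canEquiv_mem (h : P.Corresponds V U) {t : P.carrier ⊗[S] P.carrier}
    (ht : t ∈ lTensorRange P.carrier V) : P.canEquiv t ∈ lTensorRange P.carrier U := by
  refine lTensorRange_induction (p := fun t => P.canEquiv t ∈ lTensorRange P.carrier U)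
    (by simp) (fun s s' h h' => by rw [map_add]; exact Submodule.add_mem _ h h') ?_ ht
  intro p q hq
  rw [canEquiv_tmul]
  refine lTensorRange_mono ?_ (mul_mem_lTensorRange (V := 1)
    (tmul_mem_lTensorRange p (Submodule.one_le.1 le_rfl)) (h.coact_mem q hq))
  rw [one_mul]

theorem canEquiv_symm_mem (h : P.Corresponds V U) {t : P.carrier ⊗[B] A}
    (ht : t ∈ lTensorRange P.carrier U) : P.canEquiv.symm t ∈ lTensorRange P.carrier V := by
  refine lTensorRange_induction (p := fun t => P.canEquiv.symm t ∈ lTensorRange P.carrier V)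
    (by simp) (fun s s' h h' => by rw [map_add]; exact Submodule.add_mem _ h h') ?_ ht
  intro p a ha
  have e : p ⊗ₜ[B] a = (p ⊗ₜ[B] (1 : A)) * (1 ⊗ₜ[B] a) := by simp
  rw [e, map_mul, canEquiv_symm_tmul_one]
  refine lTensorRange_mono ?_ (mul_mem_lTensorRange (V := 1)
    (tmul_mem_lTensorRange p (Submodule.one_le.1 le_rfl)) (h.symm_mem a ha))
  rw [one_mul]

theorem canEquiv_mem_iff (h : P.Corresponds V U) (t : P.carrier ⊗[S] P.carrier) :
    P.canEquiv t ∈ lTensorRange P.carrier U ↔ t ∈ lTensorRange P.carrier V :=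
  ⟨fun ht => by simpa using h.canEquiv_symm_mem ht, h.canEquiv_mem⟩

theorem sup (h : P.Corresponds V U) (h' : P.Corresponds V' U') :
    P.Corresponds (V ⊔ V') (U ⊔ U') where
  coact_mem q hq := by
    obtain ⟨x, hx, y, hy, rfl⟩ := Submodule.mem_sup.1 hq
    rw [map_add]
    exact Submodule.add_mem _ (lTensorRange_mono le_sup_left (h.coact_mem x hx))
      (lTensorRange_mono le_sup_right (h'.coact_mem y hy))
  symm_mem q hq := by
    obtain ⟨x, hx, y, hy, rfl⟩ := Submodule.mem_sup.1 hq
    rw [TensorProduct.tmul_add, map_add]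
    exact Submodule.add_mem _ (lTensorRange_mono le_sup_left (h.symm_mem x hx))
      (lTensorRange_mono le_sup_right (h'.symm_mem y hy))

theorem bot : P.Corresponds ⊥ ⊥ where
  coact_mem q hq := by
    rw [Submodule.mem_bot] at hq
    simp [hq]
  symm_mem a ha := by
    rw [Submodule.mem_bot] at ha
    simp [ha]

theorem finset_sup {ι : Type*} (s : Finset ι) {V : ι → Submodule S P.carrier}
    {U : ι → Submodule B A} (h : ∀ i ∈ s, P.Corresponds (V i) (U i)) :
    P.Corresponds (s.sup V) (s.sup U) := by
  classical
  induction s using Finset.induction_on with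
  | empty => simpa using bot
  | insert i s _ ih =>
    rw [Finset.sup_insert, Finset.sup_insert]
    exact (h i (Finset.mem_insert_self _ _)).sup
      (ih fun j hj => h j (Finset.mem_insert_of_mem hj))

theorem mul (h : P.Corresponds V U) (h' : P.Corresponds V' U') :
    P.Corresponds (V * V') (U * U') where
  coact_mem q hq := by
    refine Submodule.mul_induction_on hq (fun x hx y hy => ?_) fun x y hx hy => ?_
    · rw [map_mul]
      exact mul_mem_lTensorRange (h.coact_mem x hx) (h'.coact_mem y hy)
    · rw [map_add]
      exact Submodule.add_mem _ hx hy
  symm_mem q hq := by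
    refine Submodule.mul_induction_on hq (fun x hx y hy => ?_) fun x y hx hy => ?_
    · have e : (1 : P.carrier) ⊗ₜ[B] (x * y) = (1 ⊗ₜ x) * (1 ⊗ₜ y) := by simp
      rw [e, map_mul]
      exact mul_mem_lTensorRange (h.symm_mem x hx) (h'.symm_mem y hy)
    · rw [TensorProduct.tmul_add, map_add]
      exact Submodule.add_mem _ hx hy

/-- The isomorphism `P ⊗ V ≃ P ⊗ U` for corresponding `V` and `U`. -/
theorem exists_linearEquiv (h : P.Corresponds V U) :
    ∃ θ : P.carrier ⊗[S] V ≃ₗ[P.carrier] P.carrier ⊗[B] U,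
      ∀ t, U.subtype.lTensor P.carrier (θ t) = P.canEquiv (V.subtype.lTensor P.carrier t) := by
  let κ : P.carrier ⊗[S] V →ₗ[P.carrier] P.carrier ⊗[S] P.carrier :=
    TensorProduct.AlgebraTensorModule.lTensor P.carrier P.carrier V.subtype
  let μ : P.carrier ⊗[B] U →ₗ[P.carrier] P.carrier ⊗[B] A :=
    TensorProduct.AlgebraTensorModule.lTensor P.carrier P.carrier U.subtype
  have hκ : Function.Injective κ :=
    Module.Flat.lTensor_preserves_injective_linearMap (M := P.carrier) V.subtype
      V.subtype_injective
  have hμ : Function.Injective μ :=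
    Module.Flat.lTensor_preserves_injective_linearMap (M := P.carrier) U.subtype
      U.subtype_injective
  have hr : (LinearMap.range κ).map P.canLinearEquiv.toLinearMap = LinearMap.range μ := by
    ext t
    constructor
    · rintro ⟨_, ⟨s, rfl⟩, rfl⟩
      exact h.canEquiv_mem ⟨s, rfl⟩
    · rintro ⟨s, rfl⟩
      exact ⟨P.canEquiv.symm (μ s), h.canEquiv_symm_mem ⟨s, rfl⟩, P.canEquiv.apply_symm_apply _⟩
  refine ⟨(LinearEquiv.ofInjective κ hκ).trans
    ((P.canLinearEquiv.submoduleMap (LinearMap.range κ)).trans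
      ((LinearEquiv.ofEq _ _ hr).trans (LinearEquiv.ofInjective μ hμ).symm)), fun t => ?_⟩
  change μ ((LinearEquiv.ofInjective μ hμ).symm _) = _
  rw [← LinearEquiv.ofInjective_apply (h := hμ), LinearEquiv.apply_symm_apply]
  rfl

/-- The isomorphism `θ` for the larger pair restricts to the smaller one, so it induces an
isomorphism of the quotients tensored with `P`. -/
theorem ker_eq (h : P.Corresponds V U) (hV : V ≤ V') (hU : U ≤ U')
    (θ : P.carrier ⊗[S] V' ≃ₗ[P.carrier] P.carrier ⊗[B] U')
    (hθ : ∀ t, U'.subtype.lTensor P.carrier (θ t) = P.canEquiv (V'.subtype.lTensor P.carrier t))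
    (t : P.carrier ⊗[S] V') :
    θ t ∈ LinearMap.range ((U.comap U'.subtype).subtype.lTensor P.carrier) ↔
      t ∈ LinearMap.range ((V.comap V'.subtype).subtype.lTensor P.carrier) := by
  rw [mem_range_lTensor_comap_iff hV, mem_range_lTensor_comap_iff hU, hθ, h.canEquiv_mem_iff]

/-- Over `P` the quotient becomes `P ⊗ (U' ⧸ U)`. This is free over `P`, because `B` is a field, and
`P` is flat over `S`; flatness then descends. -/
theorem flat_quotient (h : P.Corresponds V U) (h' : P.Corresponds V' U') (hV : V ≤ V')
    (hU : U ≤ U') : Module.Flat S (V' ⧸ V.comap V'.subtype) := by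
  obtain ⟨θ, hθ⟩ := h'.exists_linearEquiv
  apply flat_of_flat_tensorProduct P.carrier
  let f : P.carrier ⊗[S] V' →ₗ[P.carrier] P.carrier ⊗[S] (V' ⧸ V.comap V'.subtype) :=
    TensorProduct.AlgebraTensorModule.lTensor P.carrier P.carrier (V.comap V'.subtype).mkQ
  let k : P.carrier ⊗[S] V' →ₗ[P.carrier] P.carrier ⊗[B] (U' ⧸ U.comap U'.subtype) :=
    TensorProduct.AlgebraTensorModule.lTensor P.carrier P.carrier (U.comap U'.subtype).mkQ ∘ₗ
      θ.toLinearMap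
  have hf : Function.Surjective f :=
    LinearMap.lTensor_surjective P.carrier (Submodule.mkQ_surjective _)
  have hk : Function.Surjective k :=
    (LinearMap.lTensor_surjective P.carrier (Submodule.mkQ_surjective _)).comp θ.surjective
  have e : LinearMap.ker f = LinearMap.ker k := by
    ext t
    have h1 := lTensor_mkQ_eq_zero_iff (M := P.carrier) (V.comap V'.subtype) t
    have h2 := lTensor_mkQ_eq_zero_iff (M := P.carrier) (U.comap U'.subtype) (θ t)
    rw [LinearMap.mem_ker, LinearMap.mem_ker]
    exact h1.trans ((h.ker_eq hV hU θ hθ t).symm.trans h2.symm)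
  let E := ((f.quotKerEquivOfSurjective hf).symm.trans
    ((Submodule.quotEquivOfEq _ _ e).trans (k.quotKerEquivOfSurjective hk))).restrictScalars S
  exact Module.Flat.of_linearEquiv E

/-- The quotient is flat and finitely presented, hence projective, so `V` is a direct summand of
`V'`. -/
theorem exists_extend (h : P.Corresponds V U) (h' : P.Corresponds V' U') (hV : V ≤ V')
    (hU : U ≤ U') (hfg : V.FG) [Module.FinitePresentation S V'] (w : V →ₗ[S] S) :
    ∃ z : V' →ₗ[S] S, ∀ (q : V) (q' : V'), (q : P.carrier) = q' → z q' = w q := by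
  have := h.flat_quotient h' hV hU
  have hmap : (V.comap V'.subtype).map V'.subtype = V := by
    rw [Submodule.map_comap_subtype, inf_eq_right.2 hV]
  have hfg' : (V.comap V'.subtype).FG :=
    Submodule.fg_of_fg_map_injective V'.subtype V'.subtype_injective (by rwa [hmap])
  have : Module.FinitePresentation S (V' ⧸ V.comap V'.subtype) :=
    Module.finitePresentation_of_surjective (V.comap V'.subtype).mkQ
      (Submodule.mkQ_surjective _) (by rwa [Submodule.ker_mkQ])
  have : Module.Projective S (V' ⧸ V.comap V'.subtype) :=
    Module.Flat.projective_of_finitePresentation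
  obtain ⟨s, hs⟩ := Module.projective_lifting_property (V.comap V'.subtype).mkQ LinearMap.id
    (Submodule.mkQ_surjective _)
  let r : V' →ₗ[S] V' := LinearMap.id - s ∘ₗ (V.comap V'.subtype).mkQ
  have hr : ∀ q, r q ∈ V.comap V'.subtype := by
    intro q
    rw [← Submodule.Quotient.mk_eq_zero, ← Submodule.mkQ_apply]
    have := LinearMap.congr_fun hs ((V.comap V'.subtype).mkQ q)
    simp only [LinearMap.comp_apply, LinearMap.id_apply] at this
    simp only [r, LinearMap.sub_apply, LinearMap.comp_apply, LinearMap.id_apply, map_sub, this,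
      sub_self]
  let r' : V' →ₗ[S] V := (V'.subtype ∘ₗ r).codRestrict V hr
  refine ⟨w ∘ₗ r', fun q q' hq => ?_⟩
  rw [LinearMap.comp_apply]
  congr 1
  apply Subtype.ext
  have h0 : (V.comap V'.subtype).mkQ q' = 0 := by
    rw [Submodule.mkQ_apply, Submodule.Quotient.mk_eq_zero]
    change (q' : P.carrier) ∈ V
    rw [← hq]
    exact q.2
  change ((r q' : V') : P.carrier) = q
  simp only [r, LinearMap.sub_apply, LinearMap.comp_apply, LinearMap.id_apply, h0, map_zero,
    sub_zero, hq]

/-- Transport of a linear map on the torsor to the Hopf algebra. -/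
theorem exists_transport (h : P.Corresponds V U) (h' : P.Corresponds V' U') (hV : V ≤ V')
    (hU : U ≤ U') (y : P.carrier →ₐ[S] P.carrier) (δ : V' →ₗ[S] P.carrier)
    (hδ : ∀ q : V', (q : P.carrier) ∈ V → δ q = 0) :
    ∃ d : A →ₗ[B] P.carrier, (∀ a ∈ U, d a = 0) ∧ ∀ q : V',
      LinearMap.mul' B P.carrier (TensorProduct.map (y.restrictScalars B).toLinearMap d
        (P.coact q)) = δ q := by
  obtain ⟨θ, hθ⟩ := h'.exists_linearEquiv
  let m : P.carrier ⊗[S] V' →ₗ[S] P.carrier :=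
    LinearMap.mul' S P.carrier ∘ₗ TensorProduct.map y.toLinearMap δ
  have hm : ∀ p t, m (p • t) = y p * m t := by
    intro p t
    induction t with
    | zero => simp
    | add s t hs ht => simp only [smul_add, map_add, hs, ht, mul_add]
    | tmul q x => simp [m, TensorProduct.smul_tmul', mul_assoc]
  -- The required identity says that `y ⊗ d` followed by multiplication, composed with `θ`, is `m`.
  -- This forces the value at `1 ⊗ a`; outside `U'` any linear extension will do.
  let d₀ : U' →ₗ[B] P.carrier := (m.restrictScalars B) ∘ₗ
    (θ.symm.toLinearMap.restrictScalars B) ∘ₗ TensorProduct.mk B P.carrier U' 1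
  obtain ⟨d, hd⟩ := LinearMap.exists_extend d₀
  have hd' : ∀ a : U', d a = m (θ.symm (1 ⊗ₜ a)) := fun a => LinearMap.congr_fun hd a
  refine ⟨d, fun a ha => ?_, fun q => ?_⟩
  · have e := hd' ⟨a, hU ha⟩
    change d a = _ at e
    rw [e]
    have h1 : θ (θ.symm (1 ⊗ₜ[B] (⟨a, hU ha⟩ : U'))) ∈
        LinearMap.range ((U.comap U'.subtype).subtype.lTensor P.carrier) := by
      rw [LinearEquiv.apply_symm_apply]
      exact ⟨1 ⊗ₜ ⟨⟨a, hU ha⟩, ha⟩, rfl⟩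
    rw [h.ker_eq hV hU θ hθ] at h1
    obtain ⟨s, hs⟩ := h1
    rw [← hs]
    clear hs
    induction s with
    | zero => simp
    | add s t hs ht => rw [map_add, map_add, hs, ht, add_zero]
    | tmul p x =>
      simp only [m, LinearMap.lTensor_tmul, LinearMap.comp_apply, TensorProduct.map_tmul]
      rw [hδ ((V.comap V'.subtype).subtype x) x.2]
      simp
  · have key : ∀ s : P.carrier ⊗[B] U', LinearMap.mul' B P.carrier
        (TensorProduct.map (y.restrictScalars B).toLinearMap d (U'.subtype.lTensor P.carrier s)) =
          m (θ.symm s) := by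
      intro s
      induction s with
      | zero => simp
      | add s t hs ht => simp only [map_add, hs, ht]
      | tmul p a =>
        have e : θ.symm (p ⊗ₜ[B] a) = p • θ.symm (1 ⊗ₜ[B] a) := by
          rw [← map_smul, TensorProduct.smul_tmul', smul_eq_mul, mul_one]
        rw [e, hm, ← hd']
        simp
    have e : P.coact q = U'.subtype.lTensor P.carrier (θ (1 ⊗ₜ q)) := by
      rw [hθ]
      simp [← Algebra.TensorProduct.one_def]
    rw [e, key, LinearEquiv.symm_apply_apply]
    simp [m]

end Corresponds
end Torsor
end
end Existence

/-! ### Existence of a point by successive correction in each degree -/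

section Existence

variable {G : Type v} {B A : Type u} [Group G] [TopologicalSpace G]
  [Field B] [TopologicalSpace B] [MulSemiringAction G B] [CommRing A] [HopfAlgebra B A]
  [MulSemiringAction G A] [SMulDistribClass G B A]
  {S : Type u} [CommRing S] [Algebra B S] [MulSemiringAction G S]
  {W : ℤ → Submodule B A}

/-- The elements of `W n` that come from lower degrees. -/
noncomputable def decomposables {T M : Type*} [CommRing T] [CommRing M] [Algebra T M] (W : ℤ → Submodule T M)
    (n : ℤ) : Submodule T M :=
  W (n - 1) ⊔ (Finset.Ioo 0 n).sup fun i => W i * W (n - i)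

theorem decomposables_le {T M : Type*} [CommRing T] [CommRing M] [Algebra T M]
    {W : ℤ → Submodule T M} (hW : IsFilteredAlgebra W) (hm : Monotone W) (n : ℤ) :
    decomposables W n ≤ W n := by
  refine sup_le (hm (by omega)) (Finset.sup_le fun i _ => Submodule.mul_le.2 fun x hx y hy => ?_)
  simpa using hW.mul_mem i (n - i) x hx y hy

/-- A homomorphism that maps `W (n - 1)` into a subalgebra also maps the decomposable part of `W n`
there; this is used with a preimage subalgebra as `V`. -/
theorem decomposables_le_toSubmodule {T M : Type*} [CommRing T] [CommRing M] [Algebra T M]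
    {W : ℤ → Submodule T M} (hm : Monotone W) {n : ℤ} (V : Subalgebra T M)
    (hV : W (n - 1) ≤ Subalgebra.toSubmodule V) :
    decomposables W n ≤ Subalgebra.toSubmodule V := by
  refine sup_le hV (Finset.sup_le fun i hi => Submodule.mul_le.2 fun x hx y hy => ?_)
  rw [Finset.mem_Ioo] at hi
  exact V.mul_mem (hV (hm (by omega) hx)) (hV (hm (by omega) hy))

theorem decomposables_fg {T M : Type*} [CommRing T] [CommRing M] [Algebra T M]
    {W : ℤ → Submodule T M} (hW : ∀ n, (W n).FG) (n : ℤ) : (decomposables W n).FG := by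
  refine (hW _).sup ?_
  rw [Finset.sup_eq_iSup]
  exact Submodule.fg_biSup _ _ fun i _ => (hW i).mul (hW _)

namespace Torsor

variable (P : Torsor G S W)

theorem coact_mem_lTensorRange (n : ℤ) (q : P.carrier) (hq : q ∈ P.fil n)
    (hm : Monotone W) : P.coact q ∈ lTensorRange P.carrier (W n) := by
  refine tensorFil_induction (p := fun t => t ∈ lTensorRange P.carrier (W n))
    (Submodule.zero_mem _) (fun _ _ => Submodule.add_mem _) ?_ (P.coact_mem n q hq)
  intro i x hx a ha
  rcases lt_or_ge i 0 with hi | hi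
  · rw [P.rep.eq_bot_of_neg i hi] at hx
    have : x = 0 := hx
    simp [this]
  · exact tmul_mem_lTensorRange x (hm (by omega) ha)

/-- Comparing the filtration of the torsor with that of the group in both directions uses
strictness: filteredness of the inverse canonical map gives the second half. -/
theorem corresponds_fil (hm : Monotone W) (n : ℤ) : P.Corresponds (P.fil n) (W n) where
  coact_mem q hq := P.coact_mem_lTensorRange n q hq hm
  symm_mem a ha := by
    have h1 : (1 : P.carrier) ⊗ₜ[B] a ∈
        (tensorFil B (fun i => (P.fil i).restrictScalars B) W n : Set (P.carrier ⊗[B] A)) :=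
      tmul_mem_tensorFil (W := fun i => (P.fil i).restrictScalars B) (V := W) (i := 0)
        (zero_add n) P.alg.one_mem ha
    rw [← P.can_strict n] at h1
    obtain ⟨t, ht, e⟩ := h1
    rw [← e, ← canEquiv_apply, AlgEquiv.symm_apply_apply]
    refine tensorFil_induction (p := fun t => t ∈ lTensorRange P.carrier (P.fil n))
      (Submodule.zero_mem _) (fun _ _ => Submodule.add_mem _) ?_ ht
    intro i x hx y hy
    rcases lt_or_ge i 0 with hi | hi
    · rw [P.rep.eq_bot_of_neg i hi, Submodule.mem_bot] at hx
      simp [hx]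
    · exact tmul_mem_lTensorRange x (P.rep.mono (by omega) hy)

theorem corresponds_decomposables (hm : Monotone W) (n : ℤ) :
    P.Corresponds (decomposables P.fil n) (decomposables W n) :=
  (P.corresponds_fil hm _).sup (Corresponds.finset_sup _ fun i _ =>
    (P.corresponds_fil hm i).mul (P.corresponds_fil hm _))

variable [CharZero B]

/-- The values of `y` on the decomposables, already in `S`, extend to a linear map `z` on `W_n P`.
The defect `z - y` transports to `d` on `A`, and a point `v` of the group equal to counit plus `d`
on `W n` makes `y · v` equal to `z` there. -/
theorem exists_lift_fil (hA : IsFilteredHopf G W) (hU : IsProUnipotent B A) {n : ℤ} (hn : 1 ≤ n)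
    (y : P.carrier →ₐ[S] P.carrier)
    (hy : ∀ p ∈ P.fil (n - 1), y p ∈ (⊥ : Subalgebra S P.carrier)) :
    ∃ y' : P.carrier →ₐ[S] P.carrier, (∀ p ∈ P.fil n, y' p ∈ (⊥ : Subalgebra S P.carrier)) ∧
      ∀ p ∈ P.fil (n - 1), y' p = y p := by
  have hm := hA.rep.mono
  have hV := decomposables_le P.alg P.rep.mono n
  have hyV : decomposables P.fil n ≤
      Subalgebra.toSubmodule ((⊥ : Subalgebra S P.carrier).comap y) :=
    decomposables_le_toSubmodule P.rep.mono _ hy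
  have hinj : Function.Injective (algebraMap S P.carrier) := FaithfulSMul.algebraMap_injective _ _
  let β := Algebra.botEquivOfInjective hinj
  have hβ : ∀ t : (⊥ : Subalgebra S P.carrier), algebraMap S P.carrier (β t) = t := by
    intro t
    obtain ⟨s, rfl⟩ := β.symm.surjective t
    rw [AlgEquiv.apply_symm_apply]
    exact (congrArg Subtype.val (β.symm.commutes s)).symm
  let w : decomposables P.fil n →ₗ[S] S := β.toLinearMap ∘ₗ
    (y.toLinearMap ∘ₗ (decomposables P.fil n).subtype).codRestrict
      (Subalgebra.toSubmodule (⊥ : Subalgebra S P.carrier)) (fun q => hyV q.2)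
  have hw : ∀ q, algebraMap S P.carrier (w q) = y q := fun q => hβ _
  obtain ⟨b⟩ := P.rank n
  have : Module.Free S (P.fil n) := Module.Free.of_basis b
  have : Module.Finite S (P.fil n) := Module.Finite.of_basis b
  have : Module.FinitePresentation S (P.fil n) := Module.finitePresentation_of_projective _ _
  have hc := P.corresponds_decomposables hm n
  have hc' := P.corresponds_fil hm n
  have hU' := decomposables_le hA.alg hm n
  obtain ⟨z, hz⟩ := hc.exists_extend hc' hV hU' (decomposables_fg P.rep.fg n) w
  let δ : P.fil n →ₗ[S] P.carrier :=
    Algebra.linearMap S P.carrier ∘ₗ z - y.toLinearMap ∘ₗ (P.fil n).subtype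
  obtain ⟨d, hd, hdδ⟩ := hc.exists_transport hc' hV hU' y δ fun q hq => by
    have := hz ⟨q, hq⟩ q rfl
    simp [δ, this, hw]
  obtain ⟨v, hv⟩ := exists_algHom_eq_counit_add hA hU hn d
    (fun a ha => hd a (Submodule.mem_sup_left ha))
    (fun i hi hin a ha b hb => hd _ (Submodule.mem_sup_right
      ((Finset.le_sup (f := fun i => W i * W (n - i)) (Finset.mem_Ioo.2 ⟨hi, hin⟩))
        (Submodule.mul_mem_mul ha hb))))
  have key : ∀ q : P.fil n, act y (WithConv.toConv v) (q : P.carrier) =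
      algebraMap S P.carrier (z q) := by
    intro q
    have e1 : ∀ t ∈ lTensorRange P.carrier (W n), Algebra.TensorProduct.lift y v
        (fun _ _ => Commute.all _ _) t = Algebra.TensorProduct.lift y
          (1 : Pts B A P.carrier).ofConv (fun _ _ => Commute.all _ _) t +
        LinearMap.mul' B P.carrier (TensorProduct.map (y.restrictScalars B).toLinearMap d t) := by
      intro t ht
      refine lTensorRange_induction (p := fun t => Algebra.TensorProduct.lift y v
        (fun _ _ => Commute.all _ _) t = Algebra.TensorProduct.lift y
          (1 : Pts B A P.carrier).ofConv (fun _ _ => Commute.all _ _) t +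
        LinearMap.mul' B P.carrier (TensorProduct.map (y.restrictScalars B).toLinearMap d t))
        (by simp) (fun s t hs ht => by simp only [map_add, hs, ht]; abel) ?_ ht
      intro p a ha
      have : (1 : Pts B A P.carrier).ofConv a = counitMap B A P.carrier a := rfl
      simp [hv a ha, this, mul_add]
    rw [act_apply, e1 _ (P.coact_mem_lTensorRange n q q.2 hm), hdδ, ← act_apply, act_one]
    simp [δ]
  refine ⟨act y (WithConv.toConv v), fun p hp => ?_, fun p hp => ?_⟩
  · rw [key ⟨p, hp⟩]
    exact Subalgebra.algebraMap_mem _ _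
  · have hp' : p ∈ decomposables P.fil n := Submodule.mem_sup_left hp
    rw [key ⟨p, hV hp'⟩, hz ⟨p, hp'⟩ ⟨p, hV hp'⟩ rfl, hw]

/-- By connectedness and the rank condition `W_0 P` is free on one generator `b`. It contains `1 = s
b` and `b * b = t b`, whence `b = s (b * b) = t (s b) = t`. -/
theorem fil_zero_le_bot (hA : IsFilteredHopf G W) (hU : IsProUnipotent B A) (p : P.carrier)
    (hp : p ∈ P.fil 0) : p ∈ (⊥ : Subalgebra S P.carrier) := by
  have hA1 : (1 : A) ≠ 0 := by
    intro h
    have := congrArg (Coalgebra.counit (R := B)) h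
    simp at this
  have hfin : Module.finrank B (W 0) = 1 := by
    refine finrank_eq_one (⟨1, hA.alg.one_mem⟩ : W 0) (fun h => hA1 (congrArg Subtype.val h)) ?_
    intro w
    refine ⟨Coalgebra.counit (R := B) (w : A), Subtype.ext ?_⟩
    conv_rhs => rw [eq_counit_of_mem_nonpos hA hU le_rfl w.2]
    simp [Algebra.algebraMap_eq_smul_one]
  obtain ⟨b⟩ := P.rank 0
  rw [hfin] at b
  have hb : ∀ x : P.fil 0, ∃ s : S, x = s • b 0 := fun x =>
    ⟨b.repr x 0, by conv_lhs => rw [← b.sum_repr x]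
                    simp⟩
  obtain ⟨s, hs⟩ := hb ⟨1, P.alg.one_mem⟩
  obtain ⟨t, ht⟩ := hb ⟨(b 0 : P.carrier) * b 0, by
    simpa using P.alg.mul_mem 0 0 _ (b 0).2 _ (b 0).2⟩
  obtain ⟨r, hr⟩ := hb ⟨p, hp⟩
  have hs' : (1 : P.carrier) = s • (b 0 : P.carrier) := congrArg Subtype.val hs
  have ht' : (b 0 : P.carrier) * b 0 = t • (b 0 : P.carrier) := congrArg Subtype.val ht
  have hr' : p = r • (b 0 : P.carrier) := congrArg Subtype.val hr
  have hb1 : (b 0 : P.carrier) = t • (1 : P.carrier) := by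
    calc (b 0 : P.carrier) = 1 * b 0 := (one_mul _).symm
      _ = s • ((b 0 : P.carrier) * b 0) := by
        conv_lhs => rw [hs']
        rw [smul_mul_assoc]
      _ = t • (1 : P.carrier) := by rw [ht', hs', smul_comm]
  rw [hr', hb1, smul_smul, ← Algebra.algebraMap_eq_smul_one]
  exact Subalgebra.algebraMap_mem _ _

/-- A torsor under a filtered pro-unipotent group has a point. -/
theorem exists_point (hA : IsFilteredHopf G W) (hU : IsProUnipotent B A) :
    Nonempty (P.carrier →ₐ[S] S) := by
  -- A correction in degree `n + 1` leaves the values on `W_n P` unchanged, so the sequence of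
  -- corrected points is eventually constant on each element and has a limit.
  have step : ∀ (n : ℕ) (y : {y : P.carrier →ₐ[S] P.carrier //
      ∀ p ∈ P.fil n, y p ∈ (⊥ : Subalgebra S P.carrier)}),
      ∃ y' : {y : P.carrier →ₐ[S] P.carrier //
        ∀ p ∈ P.fil (n + 1 : ℕ), y p ∈ (⊥ : Subalgebra S P.carrier)},
        ∀ p ∈ P.fil n, y'.1 p = y.1 p := by
    intro n y
    have e : ((n + 1 : ℕ) : ℤ) - 1 = n := by simp
    obtain ⟨y', h1, h2⟩ := P.exists_lift_fil hA hU (n := (n + 1 : ℕ)) (by simp) y.1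
      (by rw [e]; exact y.2)
    exact ⟨⟨y', h1⟩, by rw [e] at h2; exact h2⟩
  choose F hF using step
  let y : ∀ n : ℕ, {y : P.carrier →ₐ[S] P.carrier //
      ∀ p ∈ P.fil n, y p ∈ (⊥ : Subalgebra S P.carrier)} := fun n =>
    Nat.rec ⟨AlgHom.id S P.carrier, fun p hp => P.fil_zero_le_bot hA hU p (by simpa using hp)⟩
      (fun n y => F n y) n
  have hy : ∀ n : ℕ, ∀ p ∈ P.fil n, (y (n + 1)).1 p = (y n).1 p := fun n => hF n (y n)
  have hst : ∀ (n k : ℕ), ∀ p ∈ P.fil n, (y (n + k)).1 p = (y n).1 p := by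
    intro n k p hp
    induction k with
    | zero => rfl
    | succ k ih =>
      rw [← ih]
      exact hy (n + k) p (P.rep.mono (by simp) hp)
  have hex : ∀ p : P.carrier, ∃ n : ℕ, p ∈ P.fil n := fun p => by
    obtain ⟨n, hn⟩ := P.rep.exhaustive p
    exact ⟨n.toNat, P.rep.mono (Int.self_le_toNat n) hn⟩
  choose N hN using hex
  have hval : ∀ p m, N p ≤ m → (y m).1 p = (y (N p)).1 p := by
    intro p m hm
    obtain ⟨k, rfl⟩ := Nat.exists_eq_add_of_le hm
    exact hst _ _ _ (hN p)
  have hcommon : ∀ p q r : P.carrier, ∃ m, N p ≤ m ∧ N q ≤ m ∧ N r ≤ m := fun p q r =>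
    ⟨max (N p) (max (N q) (N r)), by simp, by simp, by simp⟩
  let f : P.carrier →ₐ[S] P.carrier := AlgHom.ofLinearMap
    { toFun := fun p => (y (N p)).1 p
      map_add' := fun p q => by
        obtain ⟨m, h1, h2, h3⟩ := hcommon p q (p + q)
        rw [← hval p m h1, ← hval q m h2, ← hval _ m h3, map_add]
      map_smul' := fun s p => by
        obtain ⟨m, h1, h2, _⟩ := hcommon p (s • p) p
        rw [← hval p m h1, ← hval _ m h2, map_smul, RingHom.id_apply] }
    (map_one (y (N 1)).1)
    (fun p q => by
      obtain ⟨m, h1, h2, h3⟩ := hcommon p q (p * q)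
      change (y (N (p * q))).1 (p * q) = (y (N p)).1 p * (y (N q)).1 q
      rw [← hval p m h1, ← hval q m h2, ← hval _ m h3, map_mul])
  exact ⟨(Algebra.botEquivOfInjective
    (FaithfulSMul.algebraMap_injective S P.carrier)).toAlgHom.comp
      (f.codRestrict ⊥ fun p => (y (N p)).2 p (hN p))⟩

end Torsor
end Existence

/-! ### The trivial torsor and its translations -/

section TrivialTorsor

variable {B A : Type*} [Field B] [CommRing A] [HopfAlgebra B A]
  {S : Type*} [CommRing S] [Algebra B S]

noncomputable section

variable (B A S) in
/-- The tautological point of the trivial torsor. -/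
def unitPt : Pts B A (S ⊗[B] A) := WithConv.toConv Algebra.TensorProduct.includeRight

@[simp] theorem unitPt_apply (a : A) : (unitPt B A S).ofConv a = 1 ⊗ₜ a := rfl

/-- A point of the group, pulled back to the trivial torsor. -/
def basePt : Pts B A S →* Pts B A (S ⊗[B] A) :=
  mapPt (Algebra.TensorProduct.includeLeft : S →ₐ[B] S ⊗[B] A)

@[simp] theorem basePt_apply (y : Pts B A S) (a : A) : (basePt y).ofConv a = y.ofConv a ⊗ₜ 1 := rfl

/-- The Yoneda principle for `S ⊗ A`: identities between homomorphisms become identities in groups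
of points. -/
theorem algHom_ext_unitPt {C : Type*} [CommRing C] [Algebra S C] [Algebra B C] [IsScalarTower B S C]
    {f k : S ⊗[B] A →ₐ[S] C}
    (h : mapPt (f.restrictScalars B) (unitPt B A S) = mapPt (k.restrictScalars B) (unitPt B A S)) :
    f = k := by
  apply Algebra.TensorProduct.ext
  · ext
  · ext a
    exact DFunLike.congr_fun (congrArg WithConv.ofConv h) a

theorem mapPt_comp {C D E : Type*} [CommRing C] [Algebra B C] [CommRing D] [Algebra B D]
    [CommRing E] [Algebra B E] (f : D →ₐ[B] E) (k : C →ₐ[B] D) (y : Pts B A C) :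
    mapPt f (mapPt k y) = mapPt (f.comp k) y := rfl

/-- The algebra map `S ⊗ A → C` corresponding to a point of the group. -/
def ofPt {C : Type*} [CommRing C] [Algebra S C] [Algebra B C] [IsScalarTower B S C]
    (y : Pts B A C) : S ⊗[B] A →ₐ[S] C :=
  Algebra.TensorProduct.lift (Algebra.ofId S C) y.ofConv (fun _ _ => Commute.all _ _)

section

variable {C : Type*} [CommRing C] [Algebra S C] [Algebra B C] [IsScalarTower B S C]

theorem ofPt_tmul (y : Pts B A C) (s : S) (a : A) : ofPt y (s ⊗ₜ a) = s • y.ofConv a := by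
  simp [ofPt, Algebra.ofId_apply, Algebra.smul_def]

@[simp] theorem mapPt_ofPt_unitPt (y : Pts B A C) :
    mapPt ((ofPt y : S ⊗[B] A →ₐ[S] C).restrictScalars B) (unitPt B A S) = y := by
  apply WithConv.ofConv_injective
  ext a
  change ofPt y (1 ⊗ₜ a) = _
  rw [ofPt_tmul, one_smul]

theorem mapPt_basePt (f : S ⊗[B] A →ₐ[S] C) (y : Pts B A S) :
    mapPt (f.restrictScalars B) (basePt y) = mapPt ((Algebra.ofId S C).restrictScalars B) y := by
  apply WithConv.ofConv_injective
  ext a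
  change f (y.ofConv a ⊗ₜ 1) = algebraMap S C (y.ofConv a)
  rw [← f.commutes]
  rfl

end

/-- Left translation by a point of the group. -/
def translate (y : Pts B A S) : S ⊗[B] A →ₐ[S] S ⊗[B] A := ofPt (basePt y * unitPt B A S)

/-- `translate y` is pullback along `u ↦ y u`, hence reverses the order of composition. -/
theorem translate_translate (y z : Pts B A S) (f : S ⊗[B] A) :
    translate y (translate z f) = translate (z * y) f := by
  have : (translate y).comp (translate z) = translate (z * y) := by
    apply algHom_ext_unitPt
    have h1 : mapPt (((translate y).comp (translate z)).restrictScalars B) (unitPt B A S) =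
        mapPt ((translate y).restrictScalars B)
          (mapPt ((translate z).restrictScalars B) (unitPt B A S)) := rfl
    rw [h1]
    simp only [translate, mapPt_ofPt_unitPt, map_mul]
    rw [mapPt_basePt, mul_assoc]
    rfl
  exact DFunLike.congr_fun this f

theorem translate_one (f : S ⊗[B] A) : translate (1 : Pts B A S) f = f := by
  have : translate (1 : Pts B A S) = AlgHom.id S (S ⊗[B] A) := by
    apply algHom_ext_unitPt
    simp only [translate, mapPt_ofPt_unitPt, map_one, one_mul]
    rfl
  exact DFunLike.congr_fun this f

theorem basePt_mul_unitPt_apply (y : Pts B A S) (a : A) :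
    (basePt y * unitPt B A S).ofConv a =
      y.ofConv.toLinearMap.rTensor A (Coalgebra.comul (R := B) a) := by
  rw [convMul_ofConv_apply]
  generalize Coalgebra.comul (R := B) a = t
  induction t with
  | zero => simp
  | add s t hs ht => simp only [map_add, hs, ht]
  | tmul p q => simp

theorem translate_tmul (y : Pts B A S) (s : S) (a : A) : translate y (s ⊗ₜ a) =
    s • y.ofConv.toLinearMap.rTensor A (Coalgebra.comul (R := B) a) := by
  rw [translate, ofPt_tmul, basePt_mul_unitPt_apply]

variable (B A S) in
/-- The coaction on the trivial torsor. -/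
def trivialCoact : S ⊗[B] A →ₐ[S] (S ⊗[B] A) ⊗[B] A :=
  ofPt (mapPt (Algebra.TensorProduct.includeLeft : S ⊗[B] A →ₐ[B] (S ⊗[B] A) ⊗[B] A) (unitPt B A S) *
    WithConv.toConv Algebra.TensorProduct.includeRight)

theorem mapPt_trivialCoact : mapPt ((trivialCoact B A S).restrictScalars B) (unitPt B A S) =
    mapPt (Algebra.TensorProduct.includeLeft : S ⊗[B] A →ₐ[B] (S ⊗[B] A) ⊗[B] A) (unitPt B A S) *
      WithConv.toConv Algebra.TensorProduct.includeRight :=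
  mapPt_ofPt_unitPt _

theorem trivialCoact_tmul (s : S) (a : A) : trivialCoact B A S (s ⊗ₜ a) =
    (TensorProduct.mk B S A s).rTensor A (Coalgebra.comul (R := B) a) := by
  rw [trivialCoact, ofPt_tmul, convMul_ofConv_apply]
  generalize Coalgebra.comul (R := B) a = t
  induction t with
  | zero => simp
  | add s t hs ht => simp only [map_add, smul_add, hs, ht]
  | tmul p q => simp [TensorProduct.smul_tmul']

/-- Left translations commute with the right action. -/
theorem trivialCoact_translate (y : Pts B A S) (f : S ⊗[B] A) :
    trivialCoact B A S (translate y f) =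
      Algebra.TensorProduct.map (translate y) (AlgHom.id B A) (trivialCoact B A S f) := by
  have : (trivialCoact B A S).comp (translate y) =
      (Algebra.TensorProduct.map (translate y) (AlgHom.id B A)).comp (trivialCoact B A S) := by
    apply algHom_ext_unitPt
    have h1 : mapPt (((trivialCoact B A S).comp (translate y)).restrictScalars B) (unitPt B A S) =
        mapPt ((trivialCoact B A S).restrictScalars B)
          (mapPt ((translate y).restrictScalars B) (unitPt B A S)) := rfl
    have h2 : mapPt (((Algebra.TensorProduct.map (translate y) (AlgHom.id B A)).comp
        (trivialCoact B A S)).restrictScalars B) (unitPt B A S) =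
        mapPt ((Algebra.TensorProduct.map (translate y) (AlgHom.id B A)).restrictScalars B)
          (mapPt ((trivialCoact B A S).restrictScalars B) (unitPt B A S)) := rfl
    rw [h1, h2, mapPt_trivialCoact, translate, mapPt_ofPt_unitPt, map_mul, map_mul,
      mapPt_trivialCoact, mapPt_basePt, ← mul_assoc]
    congr 1
    · have h3 : mapPt ((Algebra.TensorProduct.map (ofPt (basePt y * unitPt B A S))
          (AlgHom.id B A)).restrictScalars B)
          (mapPt (Algebra.TensorProduct.includeLeft : S ⊗[B] A →ₐ[B] (S ⊗[B] A) ⊗[B] A)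
            (unitPt B A S)) =
          mapPt (Algebra.TensorProduct.includeLeft : S ⊗[B] A →ₐ[B] (S ⊗[B] A) ⊗[B] A)
            (mapPt ((ofPt (basePt y * unitPt B A S) : S ⊗[B] A →ₐ[S] S ⊗[B] A).restrictScalars B)
              (unitPt B A S)) := by
        apply WithConv.ofConv_injective
        ext a
        exact Algebra.TensorProduct.map_tmul _ _ _ _
      rw [h3, mapPt_ofPt_unitPt, map_mul]
      rfl
    · apply WithConv.ofConv_injective
      ext a
      simp
  exact DFunLike.congr_fun this f

theorem trivialCoact_coassoc (f : S ⊗[B] A) :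
    TensorProduct.assoc B (S ⊗[B] A) A A
        (((trivialCoact B A S).restrictScalars B).toLinearMap.rTensor A (trivialCoact B A S f)) =
      (Coalgebra.comul (R := B) (A := A)).lTensor (S ⊗[B] A) (trivialCoact B A S f) := by
  induction f with
  | zero => simp
  | add f k hf hk => simp only [map_add, hf, hk]
  | tmul s a =>
    rw [trivialCoact_tmul]
    have h1 : ∀ t : A ⊗[B] A, TensorProduct.assoc B (S ⊗[B] A) A A
        (((trivialCoact B A S).restrictScalars B).toLinearMap.rTensor A
          ((TensorProduct.mk B S A s).rTensor A t)) =
        (TensorProduct.mk B S A s).rTensor (A ⊗[B] A) (TensorProduct.assoc B A A A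
          ((Coalgebra.comul (R := B) (A := A)).rTensor A t)) := by
      intro t
      induction t with
      | zero => simp
      | add x y hx hy => simp only [map_add, hx, hy]
      | tmul x y =>
        simp only [LinearMap.rTensor_tmul, TensorProduct.mk_apply, AlgHom.toLinearMap_apply,
          AlgHom.restrictScalars_apply, trivialCoact_tmul]
        generalize Coalgebra.comul (R := B) x = r
        induction r with
        | zero => simp
        | add x y hx hy => simp only [map_add, TensorProduct.add_tmul, hx, hy]
        | tmul z w => simp
    rw [h1, Coalgebra.coassoc_apply, LinearMap.rTensor, LinearMap.rTensor, LinearMap.lTensor,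
      LinearMap.lTensor, TensorProduct.map_map, TensorProduct.map_map]
    rfl

theorem trivialCoact_counit (f : S ⊗[B] A) :
    TensorProduct.rid B (S ⊗[B] A)
      ((Coalgebra.counit (R := B) (A := A)).lTensor (S ⊗[B] A) (trivialCoact B A S f)) = f := by
  induction f with
  | zero => simp
  | add f k hf hk => simp only [map_add, hf, hk]
  | tmul s a =>
    rw [trivialCoact_tmul]
    have h1 : ∀ t : A ⊗[B] A, TensorProduct.rid B (S ⊗[B] A)
        ((Coalgebra.counit (R := B) (A := A)).lTensor (S ⊗[B] A)
          ((TensorProduct.mk B S A s).rTensor A t)) =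
        s ⊗ₜ TensorProduct.rid B A ((Coalgebra.counit (R := B) (A := A)).lTensor A t) := by
      intro t
      induction t with
      | zero => simp
      | add x y hx hy => simp only [map_add, TensorProduct.tmul_add, hx, hy]
      | tmul x y => simp
    rw [h1, Coalgebra.lTensor_counit_comul]
    simp

variable (B A S) in
/-- The point `(p, q) ↦ p⁻¹ q` of the group over the square of the trivial torsor. -/
def divPt : Pts B A ((S ⊗[B] A) ⊗[S] (S ⊗[B] A)) :=
  (mapPt ((Algebra.TensorProduct.includeLeft :
      S ⊗[B] A →ₐ[S] (S ⊗[B] A) ⊗[S] (S ⊗[B] A)).restrictScalars B) (unitPt B A S))⁻¹ *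
    mapPt ((Algebra.TensorProduct.includeRight :
      S ⊗[B] A →ₐ[S] (S ⊗[B] A) ⊗[S] (S ⊗[B] A)).restrictScalars B) (unitPt B A S)

variable (B A S) in
/-- The inverse of the canonical map of the trivial torsor. -/
def trivialCanInv : (S ⊗[B] A) ⊗[B] A →ₐ[S] (S ⊗[B] A) ⊗[S] (S ⊗[B] A) :=
  Algebra.TensorProduct.lift Algebra.TensorProduct.includeLeft (divPt B A S).ofConv
    (fun _ _ => Commute.all _ _)

/-- On points: `(p, q) ↦ (p, p⁻¹ q)` inverts `(p, u) ↦ (p, p u)`. -/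
theorem canMap_trivialCanInv (t : (S ⊗[B] A) ⊗[B] A) :
    canMap (trivialCoact B A S) (trivialCanInv B A S t) = t := by
  have h : mapPt ((canMap (trivialCoact B A S)).restrictScalars B) (divPt B A S) =
      WithConv.toConv Algebra.TensorProduct.includeRight := by
    rw [divPt, map_mul, map_inv, mapPt_comp, mapPt_comp]
    have h1 : mapPt (((canMap (trivialCoact B A S)).restrictScalars B).comp
        ((Algebra.TensorProduct.includeLeft :
          S ⊗[B] A →ₐ[S] (S ⊗[B] A) ⊗[S] (S ⊗[B] A)).restrictScalars B)) (unitPt B A S) =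
        mapPt (Algebra.TensorProduct.includeLeft : S ⊗[B] A →ₐ[B] (S ⊗[B] A) ⊗[B] A)
          (unitPt B A S) := by
      apply WithConv.ofConv_injective
      ext a
      simp [canMap]
    have h2 : mapPt (((canMap (trivialCoact B A S)).restrictScalars B).comp
        ((Algebra.TensorProduct.includeRight :
          S ⊗[B] A →ₐ[S] (S ⊗[B] A) ⊗[S] (S ⊗[B] A)).restrictScalars B)) (unitPt B A S) =
        mapPt ((trivialCoact B A S).restrictScalars B) (unitPt B A S) := by
      apply WithConv.ofConv_injective
      ext a
      simp [canMap, ← Algebra.TensorProduct.one_def]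
    rw [h1, h2, mapPt_trivialCoact, inv_mul_cancel_left]
  have : (canMap (trivialCoact B A S)).comp (trivialCanInv B A S) = AlgHom.id S _ := by
    apply Algebra.TensorProduct.ext
    · apply AlgHom.ext
      intro p
      simp [trivialCanInv, canMap]
    · apply AlgHom.ext
      intro a
      have := DFunLike.congr_fun (congrArg WithConv.ofConv h) a
      simpa [trivialCanInv, ← Algebra.TensorProduct.one_def] using this
  exact DFunLike.congr_fun this t

theorem trivialCanInv_canMap (t : (S ⊗[B] A) ⊗[S] (S ⊗[B] A)) :
    trivialCanInv B A S (canMap (trivialCoact B A S) t) = t := by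
  have h : (trivialCanInv B A S).comp (trivialCoact B A S) =
      Algebra.TensorProduct.includeRight := by
    apply algHom_ext_unitPt
    have h1 : mapPt (((trivialCanInv B A S).comp (trivialCoact B A S)).restrictScalars B)
        (unitPt B A S) = mapPt ((trivialCanInv B A S).restrictScalars B)
          (mapPt ((trivialCoact B A S).restrictScalars B) (unitPt B A S)) := rfl
    have h2 : mapPt ((trivialCanInv B A S).restrictScalars B)
        (mapPt (Algebra.TensorProduct.includeLeft : S ⊗[B] A →ₐ[B] (S ⊗[B] A) ⊗[B] A)
          (unitPt B A S)) = mapPt ((Algebra.TensorProduct.includeLeft :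
          S ⊗[B] A →ₐ[S] (S ⊗[B] A) ⊗[S] (S ⊗[B] A)).restrictScalars B) (unitPt B A S) := by
      apply WithConv.ofConv_injective
      ext a
      simp [trivialCanInv]
    have h3 : mapPt ((trivialCanInv B A S).restrictScalars B)
        (WithConv.toConv Algebra.TensorProduct.includeRight) = divPt B A S := by
      apply WithConv.ofConv_injective
      ext a
      simp [trivialCanInv, ← Algebra.TensorProduct.one_def]
    rw [h1, mapPt_trivialCoact, map_mul, h2, h3, divPt, mul_inv_cancel_left]
  have : (trivialCanInv B A S).comp (canMap (trivialCoact B A S)) = AlgHom.id S _ := by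
    apply Algebra.TensorProduct.ext
    · apply AlgHom.ext
      intro p
      simp [trivialCanInv, canMap]
    · apply AlgHom.ext
      intro q
      have := DFunLike.congr_fun h q
      simpa [canMap, ← Algebra.TensorProduct.one_def] using this
  exact DFunLike.congr_fun this t

end
end TrivialTorsor

/-! ### Filtrations and the diagonal action on the trivial torsor -/

section TrivialFiltration

variable {R : Type*} [CommRing R]

theorem baseChange_induction {S M : Type*} [CommRing S] [Algebra R S] [AddCommGroup M] [Module R M]
    {V : Submodule R M} {p : S ⊗[R] M → Prop} (h0 : p 0)
    (ha : ∀ s t, p s → p t → p (s + t)) (ht : ∀ s : S, ∀ x ∈ V, p (s ⊗ₜ x)) {t : S ⊗[R] M}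
    (h : t ∈ V.baseChange S) : p t := by
  obtain ⟨s, rfl⟩ := h
  induction s with
  | zero => simpa using h0
  | add s t hs ht => simpa using ha _ _ hs ht
  | tmul m x => exact ht m x x.2

theorem mul_mem_tensorFil {M N : Type*} [CommRing M] [Algebra R M] [CommRing N] [Algebra R N]
    {W : ℤ → Submodule R M} {V : ℤ → Submodule R N} (hW : IsFilteredAlgebra W)
    (hV : IsFilteredAlgebra V) {m n : ℤ} {s t : M ⊗[R] N} (hs : s ∈ tensorFil R W V m)
    (ht : t ∈ tensorFil R W V n) : s * t ∈ tensorFil R W V (m + n) := by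
  refine tensorFil_induction (p := fun s => s * t ∈ tensorFil R W V (m + n))
    (by simp) (fun s s' h h' => by rw [add_mul]; exact Submodule.add_mem _ h h') ?_ hs
  intro i x hx y hy
  refine tensorFil_induction (p := fun t => x ⊗ₜ y * t ∈ tensorFil R W V (m + n))
    (by simp) (fun s s' h h' => by rw [mul_add]; exact Submodule.add_mem _ h h') ?_ ht
  intro j x' hx' y' hy'
  rw [Algebra.TensorProduct.tmul_mul_tmul]
  exact tmul_mem_tensorFil (W := W) (V := V) (i := i + j) (j := (m - i) + (n - j)) (by ring)
    (hW.mul_mem _ _ _ hx _ hx') (hV.mul_mem _ _ _ hy _ hy')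

theorem isFilteredAlgebra_baseChange {S M : Type*} [CommRing S] [Algebra R S] [CommRing M]
    [Algebra R M] {W : ℤ → Submodule R M} (hW : IsFilteredAlgebra W) :
    IsFilteredAlgebra (fun n => (W n).baseChange S) where
  one_mem := Submodule.tmul_mem_baseChange_of_mem 1 hW.one_mem
  mul_mem i j s hs t ht := by
    refine baseChange_induction (p := fun s => s * t ∈ (W (i + j)).baseChange S)
      (by simp) (fun s s' h h' => by rw [add_mul]; exact Submodule.add_mem _ h h') ?_ hs
    intro a x hx
    refine baseChange_induction (p := fun t => a ⊗ₜ x * t ∈ (W (i + j)).baseChange S)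
      (by simp) (fun s s' h h' => by rw [mul_add]; exact Submodule.add_mem _ h h') ?_ ht
    intro b y hy
    rw [Algebra.TensorProduct.tmul_mul_tmul]
    exact Submodule.tmul_mem_baseChange_of_mem _ (hW.mul_mem _ _ _ hx _ hy)

end TrivialFiltration

section DiagonalAction

variable {G B A S : Type*} [Group G] [Field B] [MulSemiringAction G B] [CommRing A]
  [MulSemiringAction G A] [CommRing S] [Algebra B S] [MulSemiringAction G S] [SMulDistribClass G B S]

theorem diag_one_smul [Module B A] [SMulDistribClass G B A] (t : S ⊗[B] A) :
    diag (1 : G) t = t := by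
  induction t with
  | zero => simp
  | add s t hs ht => simp only [map_add, hs, ht]
  | tmul s a => simp

theorem diag_mul_smul [Module B A] [SMulDistribClass G B A] (g h : G) (t : S ⊗[B] A) :
    diag (g * h) t = diag g (diag h t) := by
  induction t with
  | zero => simp
  | add s t hs ht => simp only [map_add, hs, ht]
  | tmul s a => simp [mul_smul]

theorem diag_smul [Module B A] [SMulDistribClass G B A] (g : G) (s : S) (t : S ⊗[B] A) :
    diag g (s • t) = (g • s) • diag g t := by
  induction t with
  | zero => simp
  | add s t hs ht => simp only [map_add, smul_add, hs, ht]
  | tmul r a => simp [TensorProduct.smul_tmul', smul_mul']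

variable [Algebra B A] [SMulDistribClass G B A]

theorem diag_map_one (g : G) : diag g (1 : S ⊗[B] A) = 1 := by
  simp [Algebra.TensorProduct.one_def]

theorem diag_map_mul (g : G) (s t : S ⊗[B] A) : diag g (s * t) = diag g s * diag g t := by
  induction s with
  | zero => simp
  | add s s' hs hs' => simp only [map_add, add_mul, hs, hs']
  | tmul s a =>
    induction t with
    | zero => simp
    | add s s' hs hs' => simp only [map_add, mul_add, hs, hs']
    | tmul r b => simp [smul_mul']

end DiagonalAction

/-! ### Twisting the trivial torsor by a cocycle -/

section TwistedTorsor

variable {G : Type v} {B A : Type u} [Group G] [TopologicalSpace G]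
  [Field B] [TopologicalSpace B] [MulSemiringAction G B] [CommRing A] [HopfAlgebra B A]
  [MulSemiringAction G A] [SMulDistribClass G B A]
  {S : Type u} [CommRing S] [Algebra B S] [MulSemiringAction G S] [SMulDistribClass G B S]
  {W : ℤ → Submodule B A}

noncomputable section

theorem gact_inv (hA : IsFilteredHopf G W) (g : G) (y : Pts B A S) : gact g y⁻¹ = (gact g y)⁻¹ := by
  rw [eq_inv_iff_mul_eq_one, ← gact_mul hA, inv_mul_cancel, gact_one hA]

theorem gact_apply_smul (g : G) (y : Pts B A S) (a : A) :
    (gact g y).ofConv (g • a) = g • y.ofConv a := by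
  simp [gact, conj]

theorem one_gact (y : Pts B A S) : gact (1 : G) y = y := by
  apply WithConv.ofConv_injective
  ext a
  simp [gact, conj]

theorem diag_translate (hA : IsFilteredHopf G W) (g : G) (y : Pts B A S) (t : S ⊗[B] A) :
    diag g (translate y t) = translate (gact g y) (diag g t) := by
  induction t with
  | zero => simp
  | add s t hs ht => simp only [map_add, hs, ht]
  | tmul s a =>
    rw [translate_tmul, diag_tmul, translate_tmul, diag_smul, hA.comul_smul]
    congr 1
    generalize Coalgebra.comul (R := B) a = t
    induction t with
    | zero => simp
    | add s t hs ht => simp only [map_add, hs, ht]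
    | tmul p q => simp [gact_apply_smul]

theorem Cocycle.map_one (c : Cocycle G B A S) : c.toFun 1 = 1 := by
  have h := c.map_mul 1 1
  rw [mul_one, one_gact] at h
  exact left_eq_mul.mp h

/-- The action of `G` on the trivial torsor, twisted by a cocycle. -/
@[reducible] def twistAction (hA : IsFilteredHopf G W) (c : Cocycle G B A S) : MulSemiringAction G (S ⊗[B] A) where
  -- The inverse compensates for the contravariance of `translate`, so that the cocycle identity
  -- gives a left action.
  smul g t := translate (c.toFun g)⁻¹ (diag g t)
  one_smul t := by
    change translate (c.toFun 1)⁻¹ (diag (1 : G) t) = t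
    rw [c.map_one, inv_one, translate_one, diag_one_smul]
  mul_smul g h t := by
    change translate (c.toFun (g * h))⁻¹ (diag (g * h) t) =
      translate (c.toFun g)⁻¹ (diag g (translate (c.toFun h)⁻¹ (diag h t)))
    rw [diag_translate hA, translate_translate, c.map_mul, mul_inv_rev, gact_inv hA,
      diag_mul_smul]
  smul_zero g := by
    change translate (c.toFun g)⁻¹ (diag g 0) = 0
    rw [map_zero, map_zero]
  smul_add g s t := by
    change translate (c.toFun g)⁻¹ (diag g (s + t)) =
      translate (c.toFun g)⁻¹ (diag g s) + translate (c.toFun g)⁻¹ (diag g t)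
    rw [map_add, map_add]
  smul_one g := by
    change translate (c.toFun g)⁻¹ (diag g 1) = 1
    rw [diag_map_one, map_one]
  smul_mul g s t := by
    change translate (c.toFun g)⁻¹ (diag g (s * t)) =
      translate (c.toFun g)⁻¹ (diag g s) * translate (c.toFun g)⁻¹ (diag g t)
    rw [diag_map_mul, map_mul]

/-- `D` and `E` stand for the twisted action on `S ⊗ A` and the diagonal action built from it.
Taking them as plain maps keeps the twisted and untwisted actions on the same type apart. -/
theorem trivialCoact_diag (hA : IsFilteredHopf G W) (g : G) (y : Pts B A S) (p : S ⊗[B] A) (D : S ⊗[B] A →+ S ⊗[B] A)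
    (E : (S ⊗[B] A) ⊗[B] A →+ (S ⊗[B] A) ⊗[B] A)
    (hD : ∀ t, D t = translate y (diag g t)) (hE : ∀ t a, E (t ⊗ₜ a) = D t ⊗ₜ (g • a)) :
    trivialCoact B A S (D p) = E (trivialCoact B A S p) := by
  induction p with
  | zero => simp
  | add s t hs ht => simp only [map_add, hs, ht]
  | tmul s a =>
    rw [hD, diag_tmul, trivialCoact_translate, trivialCoact_tmul, trivialCoact_tmul, hA.comul_smul]
    generalize Coalgebra.comul (R := B) a = t
    induction t with
    | zero => simp
    | add s t hs ht => simp only [map_add, hs, ht]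
    | tmul p q => simp [hE, hD]

theorem translate_mem (hA : IsFilteredHopf G W) (y : Pts B A S) {n : ℤ} {t : S ⊗[B] A} (ht : t ∈ (W n).baseChange S) :
    translate y t ∈ (W n).baseChange S := by
  refine baseChange_induction (p := fun t => translate y t ∈ (W n).baseChange S)
    (by simp) (fun s t h h' => by rw [map_add]; exact Submodule.add_mem _ h h') ?_ ht
  intro s a ha
  rw [translate_tmul]
  refine Submodule.smul_mem _ _ ?_
  refine tensorFil_induction (p := fun t => y.ofConv.toLinearMap.rTensor A t ∈ (W n).baseChange S)
    (by simp) (fun s t h h' => by rw [map_add]; exact Submodule.add_mem _ h h') ?_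
    (hA.comul_mem n a ha)
  intro i p hp q hq
  rcases lt_or_ge i 0 with hi | hi
  · rw [hA.rep.eq_bot_of_neg i hi, Submodule.mem_bot] at hp
    simp [hp]
  · exact Submodule.tmul_mem_baseChange_of_mem _ (hA.rep.mono (by omega) hq)

theorem diag_mem (hA : IsFilteredHopf G W) (g : G) {n : ℤ} {t : S ⊗[B] A} (ht : t ∈ (W n).baseChange S) :
    diag g t ∈ (W n).baseChange S := by
  refine baseChange_induction (p := fun t => diag g t ∈ (W n).baseChange S)
    (by simp) (fun s t h h' => by rw [map_add]; exact Submodule.add_mem _ h h') ?_ ht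
  intro s a ha
  exact Submodule.tmul_mem_baseChange_of_mem _ (hA.rep.smul_mem g n a ha)

theorem trivialCoact_mem (hA : IsFilteredHopf G W) (n : ℤ) (p : S ⊗[B] A) (hp : p ∈ (W n).baseChange S) :
    trivialCoact B A S p ∈
      tensorFil B (fun i => ((W i).baseChange S).restrictScalars B) W n := by
  refine baseChange_induction (p := fun p => trivialCoact B A S p ∈
      tensorFil B (fun i => ((W i).baseChange S).restrictScalars B) W n)
    (by simp) (fun s t h h' => by rw [map_add]; exact Submodule.add_mem _ h h') ?_ hp
  intro s a ha
  rw [trivialCoact_tmul]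
  refine tensorFil_induction (p := fun t => (TensorProduct.mk B S A s).rTensor A t ∈
      tensorFil B (fun i => ((W i).baseChange S).restrictScalars B) W n)
    (by simp) (fun s t h h' => by rw [map_add]; exact Submodule.add_mem _ h h') ?_
    (hA.comul_mem n a ha)
  intro i x hx y hy
  exact tmul_mem_tensorFil (W := fun i => ((W i).baseChange S).restrictScalars B) (V := W) (i := i)
    (j := n - i) (by ring) (Submodule.tmul_mem_baseChange_of_mem s hx) hy

theorem convMul_apply_mem (hA : IsFilteredHopf G W) {C : Type*} [CommRing C] [Algebra B C]
    (y z : Pts B A C) (V : Submodule B C) {n : ℤ}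
    (h : ∀ i, ∀ p ∈ W i, ∀ q ∈ W (n - i), y.ofConv p * z.ofConv q ∈ V) (a : A) (ha : a ∈ W n) :
    (y * z).ofConv a ∈ V := by
  rw [convMul_ofConv_apply]
  refine tensorFil_induction (p := fun t => Algebra.TensorProduct.lift y.ofConv z.ofConv
      (fun _ _ => Commute.all _ _) t ∈ V)
    (by rw [map_zero]; exact Submodule.zero_mem _)
    (fun s t h h' => by rw [map_add]; exact Submodule.add_mem _ h h') ?_ (hA.comul_mem n a ha)
  intro i p hp q hq
  rw [Algebra.TensorProduct.lift_tmul]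
  exact h i p hp q hq

theorem divPt_mem (hA : IsFilteredHopf G W) (n : ℤ) (a : A) (ha : a ∈ W n) :
    (divPt B A S).ofConv a ∈
      tensorFil S (fun i => (W i).baseChange S) (fun i => (W i).baseChange S) n := by
  refine convMul_apply_mem hA _ _ ((tensorFil S (fun i => (W i).baseChange S)
    (fun i => (W i).baseChange S) n).restrictScalars B) (fun i x hx y hy => ?_) a ha
  have : (mapPt ((Algebra.TensorProduct.includeLeft :
      S ⊗[B] A →ₐ[S] (S ⊗[B] A) ⊗[S] (S ⊗[B] A)).restrictScalars B) (unitPt B A S))⁻¹.ofConv x *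
      (mapPt ((Algebra.TensorProduct.includeRight :
      S ⊗[B] A →ₐ[S] (S ⊗[B] A) ⊗[S] (S ⊗[B] A)).restrictScalars B) (unitPt B A S)).ofConv y =
      ((1 : S) ⊗ₜ[B] HopfAlgebra.antipode B x) ⊗ₜ[S] ((1 : S) ⊗ₜ[B] y) := by
    change (((1 : S) ⊗ₜ[B] HopfAlgebra.antipode B x) ⊗ₜ[S] (1 : S ⊗[B] A)) *
      ((1 : S ⊗[B] A) ⊗ₜ[S] ((1 : S) ⊗ₜ[B] y)) = _
    rw [Algebra.TensorProduct.tmul_mul_tmul, mul_one, one_mul]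
  rw [this, Submodule.restrictScalars_mem]
  exact tmul_mem_tensorFil (W := fun i => (W i).baseChange S) (V := fun i => (W i).baseChange S)
    (i := i) (j := n - i) (by ring)
    (Submodule.tmul_mem_baseChange_of_mem _ (hA.antipode_mem i x hx))
    (Submodule.tmul_mem_baseChange_of_mem _ hy)

/-- The explicit inverse is filtered because the antipode is. -/
theorem trivialCan_strict (hA : IsFilteredHopf G W) (n : ℤ) :
    (canMap (trivialCoact B A S)) '' (tensorFil S (fun i => (W i).baseChange S)
        (fun i => (W i).baseChange S) n : Set ((S ⊗[B] A) ⊗[S] (S ⊗[B] A))) =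
      (tensorFil B (fun i => ((W i).baseChange S).restrictScalars B) W n :
        Set ((S ⊗[B] A) ⊗[B] A)) := by
  have hS := isFilteredAlgebra_baseChange (S := S) hA.alg
  have hS' : IsFilteredAlgebra (fun i => ((W i).baseChange S).restrictScalars B) :=
    ⟨hS.one_mem, hS.mul_mem⟩
  apply Set.Subset.antisymm
  · rintro _ ⟨t, ht, rfl⟩
    refine tensorFil_induction (p := fun t => canMap (trivialCoact B A S) t ∈
      tensorFil B (fun i => ((W i).baseChange S).restrictScalars B) W n)
      (by rw [map_zero]; exact Submodule.zero_mem _)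
      (fun s t h h' => by rw [map_add]; exact Submodule.add_mem _ h h') ?_ ht
    intro i x hx y hy
    have h1 : x ⊗ₜ[B] (1 : A) ∈
        tensorFil B (fun i => ((W i).baseChange S).restrictScalars B) W i :=
      tmul_mem_tensorFil (W := fun i => ((W i).baseChange S).restrictScalars B) (V := W) (i := i)
        (add_zero i) hx hA.alg.one_mem
    have h2 := mul_mem_tensorFil hS' hA.alg h1 (trivialCoact_mem hA _ y hy)
    rw [add_sub_cancel] at h2
    simpa [canMap] using h2
  · intro t ht
    refine ⟨trivialCanInv B A S t, ?_, canMap_trivialCanInv t⟩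
    refine tensorFil_induction (p := fun t => trivialCanInv B A S t ∈
      tensorFil S (fun i => (W i).baseChange S) (fun i => (W i).baseChange S) n)
      (by rw [map_zero]; exact Submodule.zero_mem _)
      (fun s t h h' => by rw [map_add]; exact Submodule.add_mem _ h h') ?_ ht
    intro i x hx y hy
    have h1 : x ⊗ₜ[S] (1 : S ⊗[B] A) ∈
        tensorFil S (fun i => (W i).baseChange S) (fun i => (W i).baseChange S) i :=
      tmul_mem_tensorFil (W := fun i => (W i).baseChange S) (V := fun i => (W i).baseChange S)
        (i := i) (add_zero i) hx hS.one_mem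
    have h2 := mul_mem_tensorFil hS hS h1 (divPt_mem hA _ y hy)
    rw [add_sub_cancel] at h2
    simpa [trivialCanInv] using h2

end
end TwistedTorsor

/-! ### Torsors with a point are twists of the trivial torsor -/

section TwistedTorsor

variable {G : Type v} {B A : Type u} [Group G] [TopologicalSpace G]
  [Field B] [TopologicalSpace B] [MulSemiringAction G B] [CommRing A] [HopfAlgebra B A]
  [MulSemiringAction G A] [SMulDistribClass G B A]
  {S : Type u} [CommRing S] [Algebra B S] [MulSemiringAction G S] [SMulDistribClass G B S]
  {W : ℤ → Submodule B A}
  [IsTopologicalGroup G] [CompactSpace G] [IsTopologicalRing B] [T2Space B]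
  [ContinuousSMul G B]

noncomputable section

theorem IsFilteredHopf.isFinCont_smul (hA : IsFilteredHopf G W) (a : A) :
    IsFinCont B (fun g : G => g • a) := by
  refine isFinCont_of_continuous ?_
  let _ : TopologicalSpace A := finTopology B A
  exact hA.rep.continuous_smul.comp (continuous_id.prodMk continuous_const)

theorem isFinCont_twist (hA : IsFilteredHopf G W) (hS : ∀ s : S, IsFinCont B (fun g : G => g • s))
    (c : Cocycle G B A S) (t : S ⊗[B] A) :
    IsFinCont B (fun g : G => translate (c.toFun g)⁻¹ (diag g t)) := by
  induction t with
  | zero => simpa using IsFinCont.zero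
  | add s t hs ht => simpa only [map_add] using hs.add ht
  | tmul s a =>
    -- Inverting a point is composing it with the antipode.
    have h1 : ∀ b : A, IsFinCont B (fun g : G => (c.toFun g)⁻¹.ofConv b) := fun b =>
      (continuous_pts_iff c.toFun).1 c.continuous_toFun (HopfAlgebra.antipode B b)
    have h2 : ∀ x : A ⊗[B] A, IsFinCont B (fun g : G =>
        (c.toFun g)⁻¹.ofConv.toLinearMap.rTensor A x) := by
      intro x
      induction x with
      | zero => simpa using IsFinCont.zero
      | add s t hs ht => simpa only [map_add] using hs.add ht
      | tmul p q => exact (h1 p).map ((TensorProduct.mk B S A).flip q)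
    have h3 := IsFinCont.apply_linear (fun g : G => (c.toFun g)⁻¹.ofConv.toLinearMap.rTensor A ∘ₗ
      Coalgebra.comul (R := B)) (fun b => h2 _) (hA.isFinCont_smul a)
    have h4 := ((hS s).map ((TensorProduct.mk B S A).flip 1)).mul h3
    have h5 : (fun g : G => translate (c.toFun g)⁻¹ (diag g (s ⊗ₜ[B] a))) = _ :=
      funext fun g => by rw [diag_tmul, translate_tmul, Algebra.smul_def]
    rw [h5]
    exact h4

/-- The trivial torsor with the action of `G` twisted by a cocycle. -/
def twistTorsor (hA : IsFilteredHopf G W) (hS : ∀ s : S, IsFinCont B (fun g : G => g • s))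
    (c : Cocycle G B A S) : Torsor G S W :=
  letI act : MulSemiringAction G (S ⊗[B] A) := twistAction hA c
  haveI semi : SMulDistribClass G S (S ⊗[B] A) := ⟨fun g s t => by
    change translate (c.toFun g)⁻¹ (diag g (s • t)) = (g • s) • translate (c.toFun g)⁻¹ (diag g t)
    rw [diag_smul, map_smul]⟩
  haveI semiBase : SMulDistribClass G B (S ⊗[B] A) := ⟨fun g b t => by
    have h : ∀ (b : B) (t : S ⊗[B] A), b • t = (b • (1 : S)) • t := fun b t => by
      rw [smul_assoc, one_smul]
    rw [h b t, smul_distrib_smul g (b • (1 : S)) t, smul_distrib_smul g b (1 : S), smul_one, ← h]⟩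
  haveI : Nontrivial A := ⟨1, 0, fun h => by
    have := congrArg (Coalgebra.counit (R := B)) h
    simp at this⟩
  { carrier := S ⊗[B] A
    action := act
    semilinear := semi
    semilinearBase := semiBase
    fil := fun n => (W n).baseChange S
    rep :=
      { continuous_smul := continuous_smul_finTopology (isFinCont_twist hA hS c)
        mono := fun i j h t ht => baseChange_induction (p := fun t => t ∈ (W j).baseChange S)
          (Submodule.zero_mem _) (fun _ _ => Submodule.add_mem _)
          (fun s x hx => Submodule.tmul_mem_baseChange_of_mem s (hA.rep.mono h hx)) ht
        eq_bot_of_neg := fun n hn => by rw [hA.rep.eq_bot_of_neg n hn, Submodule.baseChange_bot]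
        exhaustive := fun t => by
          have hm : ∀ {i j : ℤ}, i ≤ j → (W i).baseChange S ≤ (W j).baseChange S :=
            fun h t ht => baseChange_induction (p := fun t => t ∈ (W _).baseChange S)
              (Submodule.zero_mem _) (fun _ _ => Submodule.add_mem _)
              (fun s x hx => Submodule.tmul_mem_baseChange_of_mem s (hA.rep.mono h hx)) ht
          induction t with
          | zero => exact ⟨0, Submodule.zero_mem _⟩
          | add s t hs ht =>
            obtain ⟨i, hi⟩ := hs
            obtain ⟨j, hj⟩ := ht
            exact ⟨max i j, Submodule.add_mem _ (hm (le_max_left i j) hi)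
              (hm (le_max_right i j) hj)⟩
          | tmul s a =>
            obtain ⟨n, hn⟩ := hA.rep.exhaustive a
            exact ⟨n, Submodule.tmul_mem_baseChange_of_mem s hn⟩
        smul_mem := fun g n t ht => translate_mem hA _ (diag_mem hA g ht)
        fg := fun n => by
          obtain ⟨s, hs⟩ := hA.rep.fg n
          rw [← hs, Submodule.baseChange_span]
          exact Submodule.fg_span (s.finite_toSet.image _) }
    alg := isFilteredAlgebra_baseChange hA.alg
    coact := trivialCoact B A S
    coact_mem := trivialCoact_mem hA
    coact_smul := fun g p => trivialCoact_diag hA g (c.toFun g)⁻¹ p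
      (DistribSMul.toAddMonoidHom (S ⊗[B] A) g) (diag g) (fun _ => rfl) (fun _ _ => rfl)
    coact_coassoc := trivialCoact_coassoc
    coact_counit := trivialCoact_counit
    faithfullyFlat := inferInstance
    can_bijective := ⟨Function.LeftInverse.injective trivialCanInv_canMap,
      Function.RightInverse.surjective canMap_trivialCanInv⟩
    can_strict := trivialCan_strict hA
    rank := fun n => by
      have : Module.Finite B (W n) := Module.Finite.iff_fg.2 (hA.rep.fg n)
      exact ⟨((Module.finBasis B (W n)).baseChange S).map
        (Submodule.toBaseChange.toLinearEquiv S (W n))⟩ }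

namespace Torsor

/-- A point of a torsor gives an isomorphism with a twisted trivial torsor. -/
theorem nonempty_iso_twistTorsor (hA : IsFilteredHopf G W)
    (hS : ∀ s : S, IsFinCont B (fun g : G => g • s)) (P : Torsor G S W) (c : Cocycle G B A S)
    (x : P.carrier →ₐ[S] S) (hx : ∀ g, conj g x = act x (c.toFun g)) :
    Nonempty (P.Iso (twistTorsor hA hS c)) := by
  let ι : S →ₐ[S] S ⊗[B] A := Algebra.ofId S _
  -- Pullback along `u ↦ x u`; its inverse `σ` is pullback along `p ↦ diff x p`.
  let φ : P.carrier →ₐ[S] S ⊗[B] A := act (ι.comp x) (unitPt B A S)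
  let x' : P.carrier →ₐ[S] P.carrier := (Algebra.ofId S P.carrier).comp x
  let σ : S ⊗[B] A →ₐ[S] P.carrier := ofPt (diff x' (AlgHom.id S P.carrier))
  have h1 : σ.comp φ = AlgHom.id S P.carrier := by
    have e : σ.comp (ι.comp x) = x' := by
      ext p
      exact σ.commutes (x p)
    rw [comp_act, e, mapPt_ofPt_unitPt, act_diff]
  have h2 : φ.comp σ = AlgHom.id S (S ⊗[B] A) := by
    apply algHom_ext_unitPt
    have e : φ.comp x' = ι.comp x := by
      ext p
      exact φ.commutes (x p)
    have e1 : mapPt ((φ.comp σ).restrictScalars B) (unitPt B A S) =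
        mapPt (φ.restrictScalars B) (mapPt (σ.restrictScalars B) (unitPt B A S)) := rfl
    rw [e1, mapPt_ofPt_unitPt, mapPt_diff, e, AlgHom.comp_id, diff_act]
    rfl
  let E : P.carrier ≃ₐ[S] S ⊗[B] A := AlgEquiv.ofAlgHom φ σ h2 h1
  have hxg : ∀ g, act (conj g x) (c.toFun g)⁻¹ = x := fun g => by
    rw [hx, act_act, mul_inv_cancel, act_one]
  -- As `x = (g x) · (c g)⁻¹`, the map `u ↦ x u` is also `u ↦ (g x) · (c g)⁻¹ u`; in this form `φ (g
  -- • p)` can be compared with the twisted action.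
  have hφ' : ∀ g, φ = act (ι.comp (conj g x)) (basePt (c.toFun g)⁻¹ * unitPt B A S) := fun g => by
    rw [← act_act]
    change act (ι.comp x) _ = _
    conv_lhs => rw [← hxg g, comp_act]
    rfl
  have hsmul : ∀ (g : G) (p : P.carrier), φ (g • p) = translate (c.toFun g)⁻¹ (diag g (φ p)) := by
    intro g p
    conv_lhs => rw [hφ' g]
    rw [act_apply, P.coact_smul]
    change _ = translate (c.toFun g)⁻¹ (diag g (act (ι.comp x) (unitPt B A S) p))
    rw [act_apply]
    generalize P.coact p = t
    induction t with
    | zero => simp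
    | add s t hs ht => simp only [map_add, hs, ht]
    | tmul p a =>
      rw [diag_tmul, Algebra.TensorProduct.lift_tmul, Algebra.TensorProduct.lift_tmul,
        diag_map_mul, map_mul]
      congr 1
      · have e1 : conj g x (g • p) = g • x p := by simp [conj]
        have e2 : ι (g • x p) = translate (c.toFun g)⁻¹ (diag g (ι (x p))) := by
          change (g • x p) ⊗ₜ[B] (1 : A) = translate (c.toFun g)⁻¹ (diag g (x p ⊗ₜ[B] (1 : A)))
          rw [diag_tmul, smul_one]
          exact ((translate (c.toFun g)⁻¹).commutes (g • x p)).symm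
        rw [AlgHom.comp_apply, e1, e2, AlgHom.comp_apply]
      · change _ = translate (c.toFun g)⁻¹ (diag g ((1 : S) ⊗ₜ[B] a))
        rw [diag_tmul, smul_one, translate_tmul, basePt_mul_unitPt_apply, one_smul]
  have hmem : ∀ n, ∀ p ∈ P.fil n, φ p ∈ (W n).baseChange S := by
    intro n p hp
    change act (ι.comp x) (unitPt B A S) p ∈ _
    rw [act_apply]
    refine lTensorRange_induction (p := fun t => Algebra.TensorProduct.lift (ι.comp x)
      (unitPt B A S).ofConv (fun _ _ => Commute.all _ _) t ∈ (W n).baseChange S)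
      (by rw [map_zero]; exact Submodule.zero_mem _)
      (fun s t h h' => by rw [map_add]; exact Submodule.add_mem _ h h') ?_
      (P.coact_mem_lTensorRange n p hp hA.rep.mono)
    intro q a ha
    have e : Algebra.TensorProduct.lift (ι.comp x)
      (unitPt B A S).ofConv (fun _ _ => Commute.all _ _) (q ⊗ₜ[B] a) = x q ⊗ₜ[B] a := by
      rw [Algebra.TensorProduct.lift_tmul]
      change (x q ⊗ₜ[B] (1 : A)) * ((1 : S) ⊗ₜ[B] a) = _
      simp
    rw [e]
    exact Submodule.tmul_mem_baseChange_of_mem _ ha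
  have hmem' : ∀ n, ∀ t ∈ (W n).baseChange S, σ t ∈ P.fil n := by
    intro n t ht
    refine baseChange_induction (p := fun t => σ t ∈ P.fil n)
      (by rw [map_zero]; exact Submodule.zero_mem _)
      (fun s t h h' => by rw [map_add]; exact Submodule.add_mem _ h h') ?_ ht
    intro s a ha
    change ofPt (diff x' (AlgHom.id S P.carrier)) (s ⊗ₜ[B] a) ∈ _
    rw [ofPt_tmul, diff_apply]
    refine Submodule.smul_mem _ _ ?_
    refine lTensorRange_induction (p := fun t => Algebra.TensorProduct.lift x'
      (AlgHom.id S P.carrier) (fun _ _ => Commute.all _ _) t ∈ P.fil n)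
      (by rw [map_zero]; exact Submodule.zero_mem _)
      (fun s t h h' => by rw [map_add]; exact Submodule.add_mem _ h h') ?_
      ((P.corresponds_fil hA.rep.mono n).symm_mem a ha)
    intro p q hq
    rw [Algebra.TensorProduct.lift_tmul]
    change algebraMap S P.carrier (x p) * q ∈ P.fil n
    rw [← Algebra.smul_def]
    exact Submodule.smul_mem _ _ hq
  -- Strictness needs both `hmem` and `hmem'`: a filtered bijection alone need not have a filtered
  -- inverse.
  refine ⟨⟨E, fun g p => hsmul g p, fun n p => ⟨fun h => ?_, fun h => hmem n p h⟩, fun p => ?_⟩⟩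
  · have e : σ (φ p) = p := DFunLike.congr_fun h1 p
    rw [← e]
    exact hmem' n _ h
  · change trivialCoact B A S (φ p) = (φ.restrictScalars B).toLinearMap.rTensor A (P.coact p)
    have e : (trivialCoact B A S).comp φ =
        (Algebra.TensorProduct.map φ (AlgHom.id B A)).comp P.coact := by
      have e1 : P.coact = act (Algebra.TensorProduct.includeLeft : P.carrier →ₐ[S] P.carrier ⊗[B] A)
          (WithConv.toConv Algebra.TensorProduct.includeRight) := by
        ext p
        rw [act_apply]
        generalize P.coact p = t
        induction t with
        | zero => simp
        | add s t hs ht => simp only [map_add, ← hs, ← ht]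
        | tmul p a => simp
      conv_rhs => rw [e1]
      rw [comp_act, comp_act, mapPt_trivialCoact, ← act_act]
      congr 1
      · have e2 : (trivialCoact B A S).comp (ι.comp x) =
            (Algebra.TensorProduct.includeLeft : S ⊗[B] A →ₐ[S] (S ⊗[B] A) ⊗[B] A).comp
              (ι.comp x) := by
          ext p
          exact (trivialCoact B A S).commutes (x p)
        have e3 : (Algebra.TensorProduct.map φ (AlgHom.id B A)).comp
            (Algebra.TensorProduct.includeLeft : P.carrier →ₐ[S] P.carrier ⊗[B] A) =
            (Algebra.TensorProduct.includeLeft : S ⊗[B] A →ₐ[S] (S ⊗[B] A) ⊗[B] A).comp φ := by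
          ext p
          simp
        rw [e2, e3, comp_act]
        rfl
      · apply WithConv.ofConv_injective
        ext a
        simp
    exact DFunLike.congr_fun e p

/-- The point is the identity section, on which the twisted action gives `g (c g⁻¹)⁻¹`; the cocycle
identity for `g g⁻¹ = 1` turns this into `c g`. -/
theorem exists_point_twistTorsor (hA : IsFilteredHopf G W)
    (hS : ∀ s : S, IsFinCont B (fun g : G => g • s)) (c : Cocycle G B A S) :
    ∃ x : (twistTorsor hA hS c).carrier →ₐ[S] S, ∀ g, conj g x = act x (c.toFun g) := by
  let x : S ⊗[B] A →ₐ[S] S := ofPt 1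
  refine ⟨x, fun g => ?_⟩
  have hxt : ∀ (y : Pts B A S) (t : S ⊗[B] A),
      x (translate y t) = (ofPt y : S ⊗[B] A →ₐ[S] S) t := by
    intro y t
    have : x.comp (translate y) = ofPt y := by
      apply algHom_ext_unitPt
      have e1 : mapPt ((x.comp (translate y)).restrictScalars B) (unitPt B A S) =
        mapPt (x.restrictScalars B) (mapPt ((translate y).restrictScalars B) (unitPt B A S)) := rfl
      rw [e1, translate, mapPt_ofPt_unitPt, map_mul, mapPt_basePt, mapPt_ofPt_unitPt,
        mapPt_ofPt_unitPt, mul_one]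
      rfl
    exact DFunLike.congr_fun this t
  have hact : ∀ y : Pts B A S, act (P := twistTorsor hA hS c) x y = (ofPt y : S ⊗[B] A →ₐ[S] S) := by
    intro y
    change (Algebra.TensorProduct.lift x y.ofConv (fun _ _ => Commute.all _ _)).comp
      (trivialCoact B A S) = _
    apply algHom_ext_unitPt
    have e1 : mapPt (((Algebra.TensorProduct.lift x y.ofConv (fun _ _ => Commute.all _ _)).comp
        (trivialCoact B A S)).restrictScalars B) (unitPt B A S) =
        mapPt ((Algebra.TensorProduct.lift x y.ofConv (fun _ _ => Commute.all _ _)).restrictScalars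
          B) (mapPt ((trivialCoact B A S).restrictScalars B) (unitPt B A S)) := rfl
    have e2 : mapPt ((Algebra.TensorProduct.lift x y.ofConv
        (fun _ _ => Commute.all _ _)).restrictScalars B)
        (mapPt (Algebra.TensorProduct.includeLeft : S ⊗[B] A →ₐ[B] (S ⊗[B] A) ⊗[B] A)
          (unitPt B A S)) = mapPt (x.restrictScalars B) (unitPt B A S) := by
      apply WithConv.ofConv_injective
      ext a
      simp
    have e3 : mapPt ((Algebra.TensorProduct.lift x y.ofConv
        (fun _ _ => Commute.all _ _)).restrictScalars B)
        (WithConv.toConv Algebra.TensorProduct.includeRight) = y := by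
      apply WithConv.ofConv_injective
      ext a
      simp
    rw [e1, mapPt_trivialCoact, map_mul, e2, e3, mapPt_ofPt_unitPt, mapPt_ofPt_unitPt, one_mul]
  rw [hact]
  apply AlgHom.ext
  intro (t : S ⊗[B] A)
  change g • x (translate (c.toFun g⁻¹)⁻¹ (diag g⁻¹ t)) =
    (ofPt (c.toFun g) : S ⊗[B] A →ₐ[S] S) t
  rw [hxt]
  have hc : gact g (c.toFun g⁻¹)⁻¹ = c.toFun g := by
    have := c.map_mul g g⁻¹
    rw [mul_inv_cancel, c.map_one] at this
    rw [gact_inv hA, inv_eq_iff_mul_eq_one, mul_eq_one_comm, ← this]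
  induction t with
  | zero => simp
  | add s t hs ht => simp only [map_add, smul_add, hs, ht]
  | tmul s a =>
    rw [diag_tmul, ofPt_tmul, ofPt_tmul, smul_eq_mul, smul_mul', smul_inv_smul, ← hc,
      smul_eq_mul]
    rfl

end Torsor
end
end TwistedTorsor

/-! ### The bijection with cohomology -/

section Classification

variable {G : Type v} {B A : Type u} [Group G] [TopologicalSpace G]
  [Field B] [TopologicalSpace B] [MulSemiringAction G B] [CommRing A] [HopfAlgebra B A]
  [MulSemiringAction G A] [SMulDistribClass G B A]
  {S : Type u} [CommRing S] [Algebra B S] [MulSemiringAction G S] [SMulDistribClass G B S]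
  {W : ℤ → Submodule B A}

namespace Torsor

/-- Points of isomorphic torsors have cohomologous cocycles. -/
theorem Iso.equivalent {P Q : Torsor G S W} (f : P.Iso Q) (hA : IsFilteredHopf G W)
    {x : P.carrier →ₐ[S] S} {z : Q.carrier →ₐ[S] S} {c d : Cocycle G B A S}
    (hx : ∀ g, conj g x = act x (c.toFun g)) (hz : ∀ g, conj g z = act z (d.toFun g)) :
    cocycleSetoid S hA c d := by
  let x' : P.carrier →ₐ[S] S := z.comp f.toAlgEquiv.toAlgHom
  have h1 : ∀ y : Pts B A S, (act z y).comp f.toAlgEquiv.toAlgHom = act x' y := by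
    intro y
    apply AlgHom.ext
    intro p
    change act z y (f.toAlgEquiv p) = act x' y p
    rw [act_apply, act_apply, f.map_coact]
    generalize P.coact p = t
    induction t with
    | zero => simp
    | add s t hs ht => simp only [map_add, hs, ht]
    | tmul p a => simp [x']
  have h2 : ∀ g, conj g x' = act x' (d.toFun g) := by
    intro g
    rw [← h1, ← hz]
    apply AlgHom.ext
    intro p
    change g • z (f.toAlgEquiv (g⁻¹ • p)) = g • z (g⁻¹ • f.toAlgEquiv p)
    rw [f.map_smul]
  -- If `x' = x u`, then `x u · d g = g x' = (g x) · g u = x · c g · g u`, so `d g = u⁻¹ · c g · g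
  -- u`.
  refine ⟨(diff x x')⁻¹, fun g => ?_⟩
  have h3 : act x (diff x x' * d.toFun g) = act x (c.toFun g * gact g (diff x x')) := by
    rw [← act_act, ← act_act, act_diff, ← h2, ← hx, ← conj_act, act_diff]
  rw [inv_inv, mul_assoc, eq_inv_mul_iff_mul_eq]
  exact act_injective x h3

/-- Moving the base point realises every cocycle in the class; hence torsors with cohomologous
cocycles are twists by one and the same cocycle. -/
theorem exists_conj_eq_act {P : Torsor G S W} (hA : IsFilteredHopf G W) {x : P.carrier →ₐ[S] S}
    {c d : Cocycle G B A S} (hx : ∀ g, conj g x = act x (c.toFun g))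
    (h : cocycleSetoid S hA c d) :
    ∃ z : P.carrier →ₐ[S] S, ∀ g, conj g z = act z (d.toFun g) := by
  obtain ⟨y, hy⟩ := h
  refine ⟨act x y⁻¹, fun g => ?_⟩
  rw [conj_act, hx, act_act, act_act, hy, mul_assoc, inv_mul_cancel_left]

end Torsor

variable [IsTopologicalGroup G] [CompactSpace G] [IsTopologicalRing B] [T2Space B]
  [ContinuousSMul G B]

open TorsorSpaces.Torsor in
/-- Isomorphism classes of torsors are classified by the first cohomology set. -/
theorem exists_torsor_equiv_H1 [CharZero B] (hA : IsFilteredHopf G W) (hU : IsProUnipotent B A)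
    (hS : ∀ s : S, IsFinCont B (fun g : G => g • s)) :
    ∃ e : Quotient (torsorSetoid G S W) ≃ H1 S hA, ∀ P : Torsor G S W,
      Nonempty (P.carrier →ₐ[S] S) ∧ ∀ x : P.carrier →ₐ[S] S, ∃ c : Cocycle G B A S,
        (∀ g : G, conj g x = act x (c.toFun g)) ∧
        e (Quotient.mk (torsorSetoid G S W) P) = Quotient.mk (cocycleSetoid S hA) c := by
  have hpt : ∀ P : Torsor G S W, ∃ c : Cocycle G B A S, ∃ x : P.carrier →ₐ[S] S,
      ∀ g, conj g x = act x (c.toFun g) := fun P => by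
    obtain ⟨x⟩ := P.exists_point hA hU
    exact ⟨cocycle hS x, x, fun g => (act_cocycle hS x g).symm⟩
  choose c x hx using hpt
  let F : Quotient (torsorSetoid G S W) → H1 S hA :=
    Quotient.lift (fun P => Quotient.mk (cocycleSetoid S hA) (c P)) (by
      rintro P Q ⟨f⟩
      exact Quotient.sound (f.equivalent hA (hx P) (hx Q)))
  have hF : Function.Bijective F := by
    constructor
    · intro p q
      induction p using Quotient.inductionOn with | _ P
      induction q using Quotient.inductionOn with | _ Q
      intro h
      obtain ⟨z, hz⟩ := exists_conj_eq_act hA (hx P) (Quotient.exact h)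
      exact Quotient.sound ((torsorSetoid G S W).trans
        (nonempty_iso_twistTorsor hA hS P (c Q) z hz)
        ((torsorSetoid G S W).symm (nonempty_iso_twistTorsor hA hS Q (c Q) (x Q) (hx Q))))
    · intro q
      induction q using Quotient.inductionOn with | _ d
      obtain ⟨z, hz⟩ := exists_point_twistTorsor hA hS d
      obtain ⟨f⟩ := (torsorSetoid G S W).refl (twistTorsor hA hS d)
      exact ⟨Quotient.mk _ (twistTorsor hA hS d), Quotient.sound (f.equivalent hA (hx _) hz)⟩
  refine ⟨Equiv.ofBijective F hF, fun P => ⟨⟨x P⟩, fun z => ?_⟩⟩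
  have hz := fun g => (act_cocycle hS z g).symm
  -- Independence of the point is `Iso.equivalent` for the identity isomorphism.
  obtain ⟨f⟩ := (torsorSetoid G S W).refl P
  exact ⟨cocycle hS z, hz, Quotient.sound (f.equivalent hA (hx P) hz)⟩

theorem isFinCont_smul_baseChange {K R : Type*} [Field K] [Algebra K B] [SMulCommClass G K B]
    [CommRing R] [Algebra K R] (s : B ⊗[K] R) : IsFinCont B (fun g : G => g • s) := by
  induction s with
  | zero => simpa using IsFinCont.zero
  | add s t hs ht => simpa only [smul_add] using hs.add ht
  | tmul b r =>
    have h : Continuous (fun g : G => g • b) := continuous_id.smul continuous_const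
    convert IsFinCont.smul_const h ((1 : B) ⊗ₜ[K] r) using 2 with g
    rw [baseChangeAction_tmul, TensorProduct.smul_tmul', smul_eq_mul, mul_one]

end Classification

end TorsorSpaces

open scoped TensorProduct in
theorem proposition1 {G : Type v} {B K R A : Type u}
    [Group G] [TopologicalSpace G] [IsTopologicalGroup G] [CompactSpace G]
    [Field B] [CharZero B] [UniformSpace B] [IsUniformAddGroup B] [IsTopologicalDivisionRing B]
    [T2Space B] [CompleteSpace B]
    [MulSemiringAction G B] [ContinuousSMul G B]
    [Field K] [Algebra K B] [SMulCommClass G K B]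
    [FiniteDimensional K (FixedPoints.intermediateField G : IntermediateField K B)]
    [CommRing R] [Algebra K R]
    [CommRing A] [HopfAlgebra B A] [MulSemiringAction G A] [SMulDistribClass G B A]
    (W : ℤ → Submodule B A) (hA : TorsorSpaces.IsFilteredHopf G W)
    (hU : TorsorSpaces.IsProUnipotent B A) :
    ∃ e : Quotient (TorsorSpaces.torsorSetoid G (B ⊗[K] R) W) ≃
        TorsorSpaces.H1 (B ⊗[K] R) hA,
      ∀ P : TorsorSpaces.Torsor G (B ⊗[K] R) W,
        Nonempty (P.carrier →ₐ[B ⊗[K] R] B ⊗[K] R) ∧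
        ∀ x : P.carrier →ₐ[B ⊗[K] R] B ⊗[K] R,
          ∃ c : TorsorSpaces.Cocycle G B A (B ⊗[K] R),
            (∀ g : G, TorsorSpaces.conj g x = TorsorSpaces.actPt P.coact x (c.toFun g)) ∧
            e (Quotient.mk (TorsorSpaces.torsorSetoid G (B ⊗[K] R) W) P) =
              Quotient.mk (TorsorSpaces.cocycleSetoid (B ⊗[K] R) hA) c := by
  -- For points with values in `S` itself, `Torsor.act` is `actPt P.coact` by definition.
  exact TorsorSpaces.exists_torsor_equiv_H1 hA hU TorsorSpaces.isFinCont_smul_baseChange
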